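/- **Setting.** Let $\Delta$ be a reduced crystallographic root system (the root system of a complex semisimple Lie algebra $\mathfrak g$ with Cartan subalgebra $\mathfrak h$), $W$ its Weyl group, $\mathfrak h_{\mathbb R}$ the real span of the coroots, so that $\Delta\subset\mathfrak h_{\mathbb R}^*$, with the $W$-invariant scalar product $(x,y)=\sum_{\alpha\in\Delta}\alpha(x)\alpha(y)$ (the Killing form). Let $s\in W$ and let $s=s^1s^2$, where $s^1=s_{\eta_1}\cdots s_{\eta_n}$, $s^2=s_{\eta_{n+1}}\cdots s_{\eta_{l'}}$, the roots in each of the families $\eta_1,\dots,\eta_n$ and $\eta_{n+1},\dots,\eta_{l'}$ are mutually orthogonal, and $\eta_1,\dots,\eta_{l'}$ form a basis of the space of functionals on $\mathfrak h_{\mathbb R}$ that vanish on the fixed points of $s$. Let $\mathfrak h_{\mathbb R}=\bigoplus_{i=0}^K\mathfrak h_i$ be an orthogonal decomposition into subspaces invariant under $s,s^1,s^2$, where $\mathfrak h_0$ is the fixed space of $s$ and, for $i\ge1$, $\mathfrak h_i$ is either a plane on which $s$ is a rotation by an angle $\theta_i$, $0<\theta_i<\pi$, or a line on which $s=-1$.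 Let $h_i\in\mathfrak h_i$ be such that $\alpha(h_i)\ne0$ for every root $\alpha$ that does not vanish on $\mathfrak h_i$, put $\Delta_i=\{\alpha\in\Delta:\alpha(h_j)=0\ (j>i),\ \alpha(h_i)\neq0\}$, and let $i_0<\dots<i_M$ be the indices with $\Delta_{i}\ne\emptyset$. Assume that (a) $|\alpha(h_{i_k})|>\bigl|\sum_{l\le j<k}\alpha(h_{i_j})\bigr|$ for $\alpha\in\Delta_{i_k}$ and $l<k$; (b) $s^1$ does not act as $-1$ on any of the lines $\mathfrak h_{i_k}$, $i_k\neq 0$; (c) for every plane $\mathfrak h_{i_k}$, $i_k\ne0$, the reflections $s^1|_{\mathfrak h_{i_k}}$ and $s^2|_{\mathfrak h_{i_k}}$ have $(-1)$-eigenvectors $v^1$, $v^2$ with $(v^1,h_{i_k})>0$, $(v^2,h_{i_k})>0$ and $(v^1,v^2)<0$. Let $\bar h=\sum_k h_{i_k}$ and let $\Delta_+^s=\{\alpha\in\Delta:\alpha(\bar h)>0\}$ be the associated system of positive roots, $\Delta_-^s=-\Delta_+^s$. For $w\in W$ let $\Delta_w=\{\alpha\in\Delta_+^s:w\alpha\in\Delta_-^s\}$,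 and let $l(w)$ be the length of $w$ with respect to the simple roots of $\Delta_+^s$. An ordering of $\Delta_+^s$ is normal if, whenever $\alpha,\beta,\alpha+\beta\in\Delta_+^s$, the root $\alpha+\beta$ lies between $\alpha$ and $\beta$. Let $D=|\Delta_+^s|$ and $D_0=|\{\alpha\in\Delta_+^s:s\alpha=\alpha\}|$. **Proposition.** One has $l(s)=l(s^2)+l(s^1)$, $\Delta_s=\Delta_{s^2}\sqcup s^2(\Delta_{s^1})$ and $\Delta_{s^{-1}}=\Delta_{s^1}\sqcup s^1(\Delta_{s^2})$ (disjoint unions). Moreover, there are roots $\gamma_1,\dots,\gamma_{l'}\in\Delta_+^s$, forming a basis of the same space as the $\eta_j$, with $s^1=s_{\gamma_1}\cdots s_{\gamma_n}$, $s^2=s_{\gamma_{n+1}}\cdots s_{\gamma_{l'}}$ and each of the sets $\gamma_1,\dots,\gamma_n$ and $\gamma_{n+1},\dots,\gamma_{l'}$ mutually orthogonal, and a normal ordering of $\Delta_+^s$ that is the concatenation of segments $$A_1,\ B_1,\ M_1,\ C_1,\ R,\ A_2,\ M_2,\ B_2,\ C_2,\ Z$$ such that 1. $A_1\cup B_1\cup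 M_1\cup C_1=\Delta_{s^1}$ and $B_1\cup M_1=\{\alpha\in\Delta_+^s:s^1\alpha=-\alpha\}$, a set of $p$ elements; $M_1$ begins with $\gamma_1$, ends with $\gamma_n$, and contains $\gamma_1<\gamma_2<\dots<\gamma_n$; $|B_1|=\frac{p-n}2$ (if $n=0$, $B_1$ and $M_1$ are empty); 2. $A_2\cup M_2\cup B_2\cup C_2=\Delta_{s^2}$ and $M_2\cup B_2=\{\alpha\in\Delta_+^s:s^2\alpha=-\alpha\}$; $M_2$ begins with $\gamma_{n+1}$, ends with $\gamma_{l'}$, and contains $\gamma_{n+1}<\dots<\gamma_{l'}$; $|M_2\cup B_2|=2|M_2|-(l'-n)$ (if $l'=n$, $M_2$ and $B_2$ are empty); 3. $Z=\{\alpha\in\Delta_+^s:s\alpha=\alpha\}$; 4. the segment $\Delta_{\mathfrak m_+}=M_1,C_1,R,A_2,M_2$ has length $D-\left(\frac{l(s)-l'}2+D_0\right)$; 5. for $\alpha<\beta$ in $\Delta_{\mathfrak m_+}$ the sum $\alpha+\beta$ is not a linear combination, with coefficients in $\{0,1,2,\dots\}$, of roots $\gamma_j$ with $\alpha<\gamma_j<\beta$;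 6. if $\Delta_{s^1}\cap s^2(\Delta_{s^1})=\emptyset$, then $\Delta_s$ is a segment of the ordering that contains $\Delta_{s^2}$, begins after $\Delta_{s^1}$ and ends immediately before $Z$; 7. if $i_k\ne0$ and $\alpha,s\alpha\in\Delta_{i_k}\cap\Delta_+^s$, then $s\alpha>\alpha$; and if moreover $\beta,\gamma\in\Delta_{i_j}$, $j<k$, and $s\alpha+\beta,\alpha+\gamma\in\Delta$, then $s\alpha+\beta,\alpha+\gamma\in\Delta_+^s$ and $s\alpha+\beta>\alpha+\gamma$; 8. in particular, if $\alpha\in\Delta_+^s$, $s\alpha\ne\alpha$ and $s\alpha\in\Delta_+^s$, then $s\alpha>\alpha$, and if $\alpha_0\in\Delta$, $s\alpha_0=\alpha_0$ and $s\alpha+\alpha_0\in\Delta$, then $s\alpha+\alpha_0>\alpha$. -/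

import Mathlib

namespace WeylOrdering

section

variable {ι V N : Type*} [Fintype ι] [AddCommGroup V] [Module ℝ V] [AddCommGroup N] [Module ℝ N]

/-- The action of a Weyl group element `w` on the space `N` of coroots (the real form of the Cartan
subalgebra), contragredient to the action on `V`: `⟨y, w x⟩ = ⟨w⁻¹ y, x⟩`, see `pairing_coact`. -/
noncomputable def coact (P : RootPairing ι ℝ V N) (w : P.weylGroup) (x : N) : N :=
  MulOpposite.op ((w⁻¹ : P.weylGroup) : P.Aut) • x

theorem pairing_coact (P : RootPairing ι ℝ V N) (w : P.weylGroup) (y : V) (x : N) :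
    P.toLinearMap y (coact P w x) = P.toLinearMap (w⁻¹ • y) x := by
  have h := LinearMap.congr_fun (LinearMap.congr_fun
    ((w⁻¹ : P.weylGroup) : P.Aut).toHom.weight_coweight_transpose x) y
  exact h.symm

/-- `s = s₁ s₂`, where `s₁` and `s₂` are the products of the reflections in the roots of the
families `γ₁` and `γ₂`; the roots in each family are mutually orthogonal, and all of them together
form a basis of the space of those functionals on `N` that vanish on the fixed points of `s`. -/
structure IsDecomposition (P : RootPairing ι ℝ V N) (s s₁ s₂ : P.weylGroup) {n m : ℕ}
    (γ₁ : Fin n → ι) (γ₂ : Fin m → ι) : Prop where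
  eq_mul : s = s₁ * s₂
  eq_prod₁ : s₁ = (List.ofFn fun k => RootPairing.weylGroup.ofIdx P (γ₁ k)).prod
  eq_prod₂ : s₂ = (List.ofFn fun k => RootPairing.weylGroup.ofIdx P (γ₂ k)).prod
  orthogonal₁ : Pairwise fun j k => P.IsOrthogonal (γ₁ j) (γ₁ k)
  orthogonal₂ : Pairwise fun j k => P.IsOrthogonal (γ₂ j) (γ₂ k)
  linearIndependent : LinearIndependent ℝ (Sum.elim (P.root ∘ γ₁) (P.root ∘ γ₂))
  mem_span_iff : ∀ y : V,
    y ∈ Submodule.span ℝ (Set.range (Sum.elim (P.root ∘ γ₁) (P.root ∘ γ₂))) ↔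
      ∀ x : N, coact P s x = x → P.toLinearMap y x = 0

/-- `Δ_i`: the roots that vanish on all `h_j` with `j > i` but not on `h_i`. -/
def layer (P : RootPairing ι ℝ V N) {K : ℕ} (h : Fin (K + 1) → N) (i : Fin (K + 1)) : Set ι :=
  {α | (∀ j, i < j → P.root' α (h j) = 0) ∧ P.root' α (h i) ≠ 0}

/-- The choices from which a system of positive roots associated to `s = s₁ s₂` is built. The
scalar product on `N` is `P.CorootForm`, `(x, y) ↦ ∑ α, α(x) α(y)`, the Killing form. -/
structure Choice (P : RootPairing ι ℝ V N) (s s₁ s₂ : P.weylGroup) where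
  /-- the number of summands different from the fixed space -/
  K : ℕ
  /-- the summands of `N`, with the fixed space at index `0` -/
  U : Fin (K + 1) → Submodule ℝ N
  /-- the chosen vectors in the summands -/
  h : Fin (K + 1) → N
  isInternal : DirectSum.IsInternal U
  orthogonal : ∀ i j, i ≠ j → ∀ x ∈ U i, ∀ y ∈ U j, P.CorootForm x y = 0
  mem_zero_iff : ∀ x, x ∈ U 0 ↔ coact P s x = x
  invariant : ∀ i, ∀ x ∈ U i, coact P s x ∈ U i
  invariant₁ : ∀ i, ∀ x ∈ U i, coact P s₁ x ∈ U i
  invariant₂ : ∀ i, ∀ x ∈ U i, coact P s₂ x ∈ U i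
  /-- Every other summand is a plane on which the isometry `s` is a rotation by an angle strictly
  between `0` and `π`, or a line on which `s` is `-1`. -/
  rotation_or_neg : ∀ i, i ≠ 0 →
    (Module.finrank ℝ (U i) = 2 ∧ ∃ θ : ℝ, 0 < θ ∧ θ < Real.pi ∧
      ∀ x ∈ U i, P.CorootForm (coact P s x) x = Real.cos θ * P.CorootForm x x) ∨
    (Module.finrank ℝ (U i) = 1 ∧ ∀ x ∈ U i, coact P s x = -x)
  h_mem : ∀ i, h i ∈ U i
  h_generic : ∀ i α, (∃ x ∈ U i, P.root' α x ≠ 0) → P.root' α (h i) ≠ 0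
  /-- No line that carries roots of its layer is negated by `s₁`. -/
  no_neg_line : ∀ i, i ≠ 0 → (layer P h i).Nonempty → Module.finrank ℝ (U i) = 1 →
    ¬ ∀ x ∈ U i, coact P s₁ x = -x
  /-- In a plane that carries roots of its layer, the normals `v₁`, `v₂` of the lines of reflection
  of `s₁`, `s₂`, taken in the open half-plane of `h_i`, form an obtuse angle. -/
  obtuse : ∀ i, i ≠ 0 → (layer P h i).Nonempty → Module.finrank ℝ (U i) = 2 →
    ∃ v₁ ∈ U i, ∃ v₂ ∈ U i, coact P s₁ v₁ = -v₁ ∧ coact P s₂ v₂ = -v₂ ∧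
      0 < P.CorootForm (h i) v₁ ∧ 0 < P.CorootForm (h i) v₂ ∧ P.CorootForm v₁ v₂ < 0
  /-- Lower vectors, summed from any index on, are dominated by `h_k` on the `k`-th layer. -/
  dominant : ∀ k l, l < k → ∀ α ∈ layer P h k,
    open Classical in
    |∑ j with l ≤ j ∧ j < k ∧ (layer P h j).Nonempty, P.root' α (h j)| < |P.root' α (h k)|

namespace Choice

variable {P : RootPairing ι ℝ V N} {s s₁ s₂ : P.weylGroup}

/-- The sum of the `h_i` over the nonempty layers. -/
noncomputable def hbar (c : Choice P s s₁ s₂) : N :=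
  open Classical in ∑ i with (layer P c.h i).Nonempty, c.h i

/-- `Δ_+^s`: the system of positive roots associated to `s` by the choice `c`. -/
def pos (c : Choice P s s₁ s₂) : Set ι := {α | 0 < P.root' α c.hbar}

end Choice

/-- The negatives of the roots in `A`. -/
def negRoots (P : RootPairing ι ℝ V N) (A : Set ι) : Set ι :=
  {α | ∃ β ∈ A, P.root α = -P.root β}

/-- `Δ_w`: the positive roots that `w` makes negative. -/
def inversions (P : RootPairing ι ℝ V N) (pos : Set ι) (w : P.weylGroup) : Set ι :=
  {α | α ∈ pos ∧ w • α ∈ negRoots P pos}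

/-- The simple roots: positive roots that are not a sum of two positive roots. -/
def simpleRoots (P : RootPairing ι ℝ V N) (pos : Set ι) : Set ι :=
  {α | α ∈ pos ∧ ¬ ∃ β ∈ pos, ∃ δ ∈ pos, P.root α = P.root β + P.root δ}

/-- The length of `w` with respect to the simple reflections. -/
noncomputable def length (P : RootPairing ι ℝ V N) (pos : Set ι) (w : P.weylGroup) : ℕ :=
  sInf {k | ∃ l : List ι, (∀ α ∈ l, α ∈ simpleRoots P pos) ∧ l.length = k ∧
    w = (l.map (RootPairing.weylGroup.ofIdx P)).prod}

/-- `α` stands before `β` in the list `L` (used for lists without repetitions). -/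
def Before (L : List ι) (α β : ι) : Prop := List.Sublist [α, β] L

/-- `L` enumerates the positive roots in a normal ordering. -/
structure IsNormalOrdering (P : RootPairing ι ℝ V N) (pos : Set ι) (L : List ι) : Prop where
  nodup : L.Nodup
  mem_iff : ∀ α, α ∈ L ↔ α ∈ pos
  between : ∀ α ∈ pos, ∀ β ∈ pos, ∀ δ ∈ pos, P.root δ = P.root α + P.root β →
    (Before L α δ ∧ Before L δ β) ∨ (Before L β δ ∧ Before L δ α)

/-- The list `M` contains the roots of the family `γ` in their order, begins with the first of them
and ends with the last (and is empty if the family is). -/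
def SpannedBy {n : ℕ} (M : List ι) (γ : Fin n → ι) : Prop :=
  List.Sublist (List.ofFn γ) M ∧ M.head? = (List.ofFn γ).head? ∧
    M.getLast? = (List.ofFn γ).getLast?

/-- `α + β` is a linear combination, with natural coefficients, of roots from the families `γ₁`, `γ₂`
that stand strictly between `α` and `β` in `L`. -/
def SumRepresentable (P : RootPairing ι ℝ V N) (L : List ι) {n m : ℕ}
    (γ₁ : Fin n → ι) (γ₂ : Fin m → ι) (α β : ι) : Prop :=
  ∃ (c₁ : Fin n → ℕ) (c₂ : Fin m → ℕ),
    (∀ k, c₁ k ≠ 0 → Before L α (γ₁ k) ∧ Before L (γ₁ k) β) ∧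
    (∀ k, c₂ k ≠ 0 → Before L α (γ₂ k) ∧ Before L (γ₂ k) β) ∧
    P.root α + P.root β = ∑ k, c₁ k • P.root (γ₁ k) + ∑ k, c₂ k • P.root (γ₂ k)

end

end WeylOrdering

namespace WeylOrdering

open RootPairing

section WeylGroup

variable {ι V N : Type*} [AddCommGroup V] [Module ℝ V] [AddCommGroup N] [Module ℝ N]
  {P : RootPairing ι ℝ V N}

theorem root_smul (w : P.weylGroup) (α : ι) : P.root (w • α) = w • P.root α := by
  rw [weylGroup_apply_root]; rfl

theorem ofIdx_smul_eq (α : ι) (y : V) :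
    weylGroup.ofIdx P α • y = y - P.coroot' α y • P.root α :=
  P.reflection_apply α y

theorem root_ofIdx_smul (α β : ι) :
    P.root (weylGroup.ofIdx P α • β) = P.root β - P.pairing β α • P.root α := by
  rw [root_smul, ofIdx_smul_eq]; simp

theorem ofIdx_mul_self (α : ι) : weylGroup.ofIdx P α * weylGroup.ofIdx P α = 1 := by
  apply Subtype.ext
  change Equiv.reflection P α * Equiv.reflection P α = 1
  rw [mul_eq_one_iff_inv_eq, Equiv.reflection_inv]

theorem ofIdx_inv (α : ι) : (weylGroup.ofIdx P α)⁻¹ = weylGroup.ofIdx P α :=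
  inv_eq_of_mul_eq_one_left (ofIdx_mul_self α)

theorem ofIdx_smul_smul (α β : ι) : weylGroup.ofIdx P α • weylGroup.ofIdx P α • β = β := by
  rw [← mul_smul, ofIdx_mul_self, one_smul]

theorem weylGroup_ext {w w' : P.weylGroup} (h : ∀ y : V, w • y = w' • y) : w = w' := by
  apply Subtype.ext
  apply Equiv.weightHom_injective P
  ext y
  exact h y

theorem weyl_smul_real (w : P.weylGroup) (t : ℝ) (y : V) : w • (t • y) = t • (w • y) :=
  smul_comm (w : P.Aut) t y

/-- The action of a Weyl group element on `V` as a linear map. -/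
noncomputable def actLin (w : P.weylGroup) : V →ₗ[ℝ] V where
  toFun y := w • y
  map_add' := smul_add w
  map_smul' t y := weyl_smul_real w t y

@[simp] theorem actLin_apply (w : P.weylGroup) (y : V) : actLin w y = w • y := rfl

theorem coact_mul (w w' : P.weylGroup) (x : N) : coact P (w * w') x = coact P w (coact P w' x) := by
  simp only [coact, mul_inv_rev, Subgroup.coe_mul, MulOpposite.op_mul, mul_smul]

theorem coact_one (x : N) : coact P 1 x = x := by
  simp [coact]

/-- The action of a Weyl group element on `N` as a linear map. -/
noncomputable def coactLin (w : P.weylGroup) : N →ₗ[ℝ] N where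
  toFun x := coact P w x
  map_add' x y := smul_add _ x y
  map_smul' t x := smul_comm (MulOpposite.op ((w⁻¹ : P.weylGroup) : P.Aut)) t x

@[simp] theorem coactLin_apply (w : P.weylGroup) (x : N) : coactLin w x = coact P w x := rfl

theorem coact_add (w : P.weylGroup) (x y : N) : coact P w (x + y) = coact P w x + coact P w y :=
  map_add (coactLin w) x y

theorem coact_neg (w : P.weylGroup) (x : N) : coact P w (-x) = -coact P w x :=
  map_neg (coactLin w) x

theorem coact_smul (w : P.weylGroup) (t : ℝ) (x : N) : coact P w (t • x) = t • coact P w x :=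
  map_smul (coactLin w) t x

theorem coact_inv_coact (w : P.weylGroup) (x : N) : coact P w⁻¹ (coact P w x) = x := by
  rw [← coact_mul, inv_mul_cancel, coact_one]

theorem root'_smul [Fintype ι] (w : P.weylGroup) (α : ι) (x : N) :
    P.root' (w • α) x = P.root' α (coact P w⁻¹ x) := by
  simp only [RootPairing.root']
  rw [pairing_coact, inv_inv, root_smul]

theorem root'_eq_of_root_add {α β δ : ι} (h : P.root δ = P.root α + P.root β) (x : N) :
    P.root' δ x = P.root' α x + P.root' β x := by
  simp [RootPairing.root', h]

theorem coroot'_smul (w : P.weylGroup) (α : ι) (y : V) :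
    P.coroot' (w • α) (w • y) = P.coroot' α y := by
  have h1 := LinearMap.congr_fun (LinearMap.congr_fun
    (w : P.Aut).toHom.weight_coweight_transpose (P.coroot (w • α))) y
  have h2 := Hom.coroot_coweightMap_apply P P (w • α) (w : P.Aut).toHom
  have h3 : (w : P.Aut).toHom.indexEquiv.symm (w • α) = α :=
    Equiv.symm_apply_apply ((w : P.Aut).toHom.indexEquiv) α
  rw [h3] at h2
  change P.toLinearMap ((w : P.Aut).toHom.weightMap y) (P.coroot (w • α)) = _
  rw [RootPairing.coroot', ← h2]
  exact h1

theorem pairing_smul_smul (w : P.weylGroup) (α β : ι) :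
    P.pairing (w • α) (w • β) = P.pairing α β := by
  have := coroot'_smul w β (P.root α)
  rw [← root_smul] at this
  simpa using this

theorem ofIdx_conj (w : P.weylGroup) (α : ι) :
    weylGroup.ofIdx P (w • α) = w * weylGroup.ofIdx P α * w⁻¹ := by
  apply weylGroup_ext
  intro y
  obtain ⟨z, rfl⟩ : ∃ z, y = w • z := ⟨w⁻¹ • y, by simp⟩
  rw [ofIdx_smul_eq, coroot'_smul, root_smul, mul_smul, mul_smul, inv_smul_smul, ofIdx_smul_eq,
    smul_sub, weyl_smul_real]

theorem isOrthogonal_smul (w : P.weylGroup) {α β : ι} (h : P.IsOrthogonal α β) :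
    P.IsOrthogonal (w • α) (w • β) := by
  simpa only [RootPairing.IsOrthogonal, pairing_smul_smul] using h

theorem exists_root_neg (α : ι) : ∃ β, P.root β = -P.root α :=
  ⟨weylGroup.ofIdx P α • α, by rw [root_ofIdx_smul]; simp [two_smul]⟩

theorem pairing_eq_intCast [P.IsCrystallographic] (α β : ι) :
    P.pairing α β = (P.pairingIn ℤ α β : ℝ) := by
  rw [← P.algebraMap_pairingIn ℤ]; simp

end WeylGroup

section Crystallographic

variable {ι V N : Type*} [Fintype ι] [AddCommGroup V] [Module ℝ V] [AddCommGroup N] [Module ℝ N]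
  {P : RootPairing ι ℝ V N} [P.IsCrystallographic]

theorem exists_root_sub {α β : ι} (h : 0 < P.pairing α β) (hne : α ≠ β) :
    ∃ δ, P.root δ = P.root α - P.root β := by
  rw [pairing_eq_intCast] at h
  exact P.root_sub_root_mem_of_pairingIn_pos (by exact_mod_cast h) hne

theorem pairing_pos_comm {α β : ι} (h : 0 < P.pairing α β) : 0 < P.pairing β α := by
  rw [pairing_eq_intCast] at h ⊢
  have := (P.zero_lt_pairingIn_iff' ℤ (i := α) (j := β)).1 (by exact_mod_cast h)
  exact_mod_cast this

end Crystallographic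

theorem eq_or_neg_of_smul_eq {ι V N : Type*} [AddCommGroup V] [Module ℝ V]
    [AddCommGroup N] [Module ℝ N] {P : RootPairing ι ℝ V N} [P.IsReduced]
    {α β : ι} {a b : ℝ} (ha : a ≠ 0)
    (h : a • P.root α = b • P.root β) : P.root α = P.root β ∨ P.root α = -P.root β := by
  apply IsReduced.eq_or_eq_neg
  intro hli
  rw [LinearIndependent.pair_iff] at hli
  exact ha (hli a (-b) (by rw [h]; simp)).1

section PositiveSystem

variable {ι V N : Type*} [AddCommGroup V] [Module ℝ V] [AddCommGroup N] [Module ℝ N]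

/-- The roots on which the functional `g` is positive. -/
def posOf (P : RootPairing ι ℝ V N) (g : V →ₗ[ℝ] ℝ) : Set ι := {α | 0 < g (P.root α)}

/-- `α` is a positive root in the subspace `X` that is not a sum of two such roots. -/
def IsSimpleIn (P : RootPairing ι ℝ V N) (g : V →ₗ[ℝ] ℝ) (X : Submodule ℝ V) (α : ι) : Prop :=
  α ∈ posOf P g ∧ P.root α ∈ X ∧ ∀ β ∈ posOf P g, P.root β ∈ X → ∀ δ ∈ posOf P g, P.root δ ∈ X →
    P.root α ≠ P.root β + P.root δ

variable {P : RootPairing ι ℝ V N} {g : V →ₗ[ℝ] ℝ}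

theorem mem_posOf {α : ι} : α ∈ posOf P g ↔ 0 < g (P.root α) := Iff.rfl

theorem isSimpleIn_top_iff {α : ι} : IsSimpleIn P g ⊤ α ↔ α ∈ simpleRoots P (posOf P g) := by
  simp only [IsSimpleIn, simpleRoots, Submodule.mem_top, true_and, forall_true_left,
    Set.mem_ofPred_eq, not_exists, not_and]

theorem mem_negRoots_iff {α : ι} : α ∈ negRoots P (posOf P g) ↔ g (P.root α) < 0 := by
  constructor
  · rintro ⟨β, hβ, h⟩
    rw [h, map_neg]
    exact neg_neg_of_pos hβ
  · intro h
    obtain ⟨β, hβ⟩ := exists_root_neg (P := P) α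
    exact ⟨β, by rw [mem_posOf, hβ, map_neg]; linarith, by rw [hβ, neg_neg]⟩

theorem mem_inversions_iff {w : P.weylGroup} {α : ι} :
    α ∈ inversions P (posOf P g) w ↔ 0 < g (P.root α) ∧ g (w • P.root α) < 0 := by
  rw [← root_smul, ← mem_negRoots_iff]
  exact Iff.rfl

theorem eq_of_smul_eq_of_mem_posOf [P.IsReduced] {α β : ι} (hα : α ∈ posOf P g)
    (hβ : β ∈ posOf P g) {a b : ℝ} (ha : a ≠ 0)
    (h : a • P.root α = b • P.root β) : α = β := by
  rw [mem_posOf] at hα hβ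
  rcases eq_or_neg_of_smul_eq ha h with h | h
  · exact P.root.injective h
  · rw [h, map_neg] at hα
    linarith

theorem ofIdx_eq_of_root_eq_neg {α β : ι} (h : P.root β = -P.root α) :
    weylGroup.ofIdx P β = weylGroup.ofIdx P α := by
  have : β = weylGroup.ofIdx P α • α := by
    apply P.root.injective
    rw [root_ofIdx_smul, h]; simp [two_smul]
  rw [this, ofIdx_conj, ofIdx_mul_self, one_mul, ofIdx_inv]

/-- `w` is a product of `k` simple reflections. -/
def HasWord (P : RootPairing ι ℝ V N) (g : V →ₗ[ℝ] ℝ) (w : P.weylGroup) (k : ℕ) : Prop :=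
  ∃ l : List ι, (∀ α ∈ l, α ∈ simpleRoots P (posOf P g)) ∧ l.length = k ∧
    w = (l.map (weylGroup.ofIdx P)).prod

theorem HasWord.mul {w w' : P.weylGroup} {k k' : ℕ} (h : HasWord P g w k) (h' : HasWord P g w' k') :
    HasWord P g (w * w') (k + k') := by
  obtain ⟨l, h1, h2, h3⟩ := h
  obtain ⟨l', h1', h2', h3'⟩ := h'
  refine ⟨l ++ l', ?_, by simp [h2, h2'], by simp [h3, h3']⟩
  intro α hα
  rcases List.mem_append.1 hα with h | h
  exacts [h1 α h, h1' α h]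

theorem hasWord_one : HasWord P g 1 0 := ⟨[], by simp, rfl, by simp⟩

theorem hasWord_ofIdx {α : ι} (h : IsSimpleIn P g ⊤ α) : HasWord P g (weylGroup.ofIdx P α) 1 :=
  ⟨[α], by simpa using isSimpleIn_top_iff.1 h, rfl, by simp⟩

end PositiveSystem

section Simple

variable {ι V N : Type*} [Fintype ι] [AddCommGroup V] [Module ℝ V] [AddCommGroup N] [Module ℝ N]
  {P : RootPairing ι ℝ V N} {g : V →ₗ[ℝ] ℝ} {X : Submodule ℝ V}

theorem exists_isSimpleIn_of_pos (f : V →ₗ[ℝ] ℝ) {β : ι} (hβ : β ∈ posOf P g)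
    (hX : P.root β ∈ X) (hf : 0 < f (P.root β)) :
    ∃ α, IsSimpleIn P g X α ∧ 0 < f (P.root α) := by
  obtain ⟨α, ⟨h1, h2, h3⟩, hmin⟩ := Set.exists_min_image
    {α | α ∈ posOf P g ∧ P.root α ∈ X ∧ 0 < f (P.root α)} (fun α => g (P.root α))
    (Set.toFinite _) ⟨β, hβ, hX, hf⟩
  refine ⟨α, ⟨h1, h2, fun β hβ hβX δ hδ hδX h => ?_⟩, h3⟩
  rw [mem_posOf] at hβ hδ
  rw [h, map_add] at h3
  have hg : g (P.root α) = g (P.root β) + g (P.root δ) := by rw [h, map_add]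
  rcases lt_or_ge 0 (f (P.root β)) with hb | hb
  · have := hmin β ⟨hβ, hβX, hb⟩
    linarith
  · have := hmin δ ⟨hδ, hδX, by linarith⟩
    linarith

variable [P.IsCrystallographic] [P.IsReduced]

/-- A simple reflection permutes the other positive roots. -/
theorem IsSimpleIn.reflection_mem_posOf (hg : ∀ α, g (P.root α) ≠ 0) {α : ι}
    (hα : IsSimpleIn P g X α) {β : ι} (hβ : β ∈ posOf P g) (hβX : P.root β ∈ X) (hne : β ≠ α) :
    weylGroup.ofIdx P α • β ∈ posOf P g := by
  obtain ⟨h1, h2, h3⟩ := hα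
  have key : ∀ β ∈ posOf P g, P.root β ∈ X → ∀ δ, P.root δ = P.root β - P.root α →
      δ ∈ posOf P g := by
    intro β hβ hβX δ hδ
    by_contra hneg
    obtain ⟨δ', hδ'⟩ := exists_root_neg (P := P) δ
    refine h3 β hβ hβX δ' ?_ ?_ (by rw [hδ', hδ]; abel)
    · rw [mem_posOf] at hneg ⊢
      rw [hδ', map_neg]
      have := hg δ
      rcases lt_or_gt_of_ne this with h | h
      · linarith
      · exact absurd h hneg
    · rw [hδ', hδ]
      exact X.neg_mem (X.sub_mem hβX h2)
  obtain ⟨k, hk⟩ : ∃ k : ℕ, P.pairingIn ℤ β α ≤ k :=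
    ⟨(P.pairingIn ℤ β α).toNat, Int.self_le_toNat _⟩
  induction k using Nat.strong_induction_on generalizing β with
  | _ k ih =>
    rcases le_or_gt (P.pairing β α) 0 with hc | hc
    · rw [mem_posOf, root_ofIdx_smul, map_sub, map_smul, smul_eq_mul]
      rw [mem_posOf] at h1 hβ
      nlinarith
    · obtain ⟨δ, hδ⟩ := exists_root_sub hc hne
      have hδp := key β hβ hβX δ hδ
      have hδX : P.root δ ∈ X := by rw [hδ]; exact X.sub_mem hβX h2
      have hδne : δ ≠ α := by
        rintro rfl
        refine hne (eq_of_smul_eq_of_mem_posOf hβ h1 (a := 1) (b := 2) one_ne_zero ?_)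
        rw [one_smul, two_smul]
        exact sub_eq_iff_eq_add.1 hδ.symm
      have hpd : P.pairing δ α = P.pairing β α - 2 := by
        simp only [← RootPairing.root_coroot'_eq_pairing, hδ, map_sub]
        simp
      have hpdi : P.pairingIn ℤ δ α = P.pairingIn ℤ β α - 2 := by
        rw [pairing_eq_intCast, pairing_eq_intCast] at hpd
        exact_mod_cast hpd
      have hci : 0 < P.pairingIn ℤ β α := by
        rw [pairing_eq_intCast] at hc
        exact_mod_cast hc
      rcases eq_or_ne (P.pairingIn ℤ β α) 1 with h | h
      · have : weylGroup.ofIdx P α • β = δ := by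
          apply P.root.injective
          rw [root_ofIdx_smul, hδ, pairing_eq_intCast, h]; simp
        rwa [this]
      · have hs : weylGroup.ofIdx P α • δ ∈ posOf P g :=
          ih (k - 1) (by omega) hδp hδX hδne (by omega)
        refine key _ hs ?_ _ ?_
        · rw [root_ofIdx_smul]
          exact X.sub_mem hδX (X.smul_mem _ h2)
        · rw [root_ofIdx_smul, root_ofIdx_smul, hpd, hδ, sub_smul, two_smul]
          abel

theorem exists_isSimpleIn_lt (hg : ∀ α, g (P.root α) ≠ 0) {β : ι} (hβ : β ∈ posOf P g)
    (hX : P.root β ∈ X) (hns : ¬ IsSimpleIn P g X β) :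
    ∃ α, IsSimpleIn P g X α ∧ weylGroup.ofIdx P α • β ∈ posOf P g ∧
      g (P.root (weylGroup.ofIdx P α • β)) < g (P.root β) := by
  obtain ⟨α, hα, hf⟩ := exists_isSimpleIn_of_pos (P.coroot' β) hβ hX (by simp)
  have hne : β ≠ α := by rintro rfl; exact hns hα
  refine ⟨α, hα, hα.reflection_mem_posOf hg hβ hX hne, ?_⟩
  rw [RootPairing.root_coroot'_eq_pairing] at hf
  have := pairing_pos_comm hf
  have h1 := hα.1
  rw [mem_posOf] at h1
  rw [root_ofIdx_smul, map_sub, map_smul, smul_eq_mul]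
  nlinarith

theorem exists_hasWord_ofIdx (hg : ∀ α, g (P.root α) ≠ 0) (β : ι) :
    ∃ k, HasWord P g (weylGroup.ofIdx P β) k := by
  have hpos : ∀ β ∈ posOf P g, ∃ k, HasWord P g (weylGroup.ofIdx P β) k := by
    by_contra! hcon
    obtain ⟨β, ⟨hβ, hβn⟩, hmin⟩ := Set.exists_min_image
      {β | β ∈ posOf P g ∧ ∀ k, ¬ HasWord P g (weylGroup.ofIdx P β) k} (fun α => g (P.root α))
      (Set.toFinite _) hcon
    have hns : ¬ IsSimpleIn P g ⊤ β := fun h => hβn 1 (hasWord_ofIdx h)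
    obtain ⟨α, hα, h1, h2⟩ := exists_isSimpleIn_lt hg hβ Submodule.mem_top hns
    have : ∃ k, HasWord P g (weylGroup.ofIdx P (weylGroup.ofIdx P α • β)) k := by
      by_contra! h
      exact absurd (hmin _ ⟨h1, h⟩) (not_le.2 h2)
    obtain ⟨k, hk⟩ := this
    have h3 := ((hasWord_ofIdx hα).mul hk).mul (hasWord_ofIdx hα)
    rw [ofIdx_conj, ofIdx_inv, ← mul_assoc, ← mul_assoc, ofIdx_mul_self, one_mul, mul_assoc,
      ofIdx_mul_self, mul_one] at h3
    exact hβn _ h3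
  by_cases hβ : β ∈ posOf P g
  · exact hpos β hβ
  · obtain ⟨δ, hδ⟩ := exists_root_neg (P := P) β
    rw [← ofIdx_eq_of_root_eq_neg hδ]
    apply hpos
    rw [mem_posOf] at hβ ⊢
    rw [hδ, map_neg]
    have := hg β
    rcases lt_or_gt_of_ne this with h | h
    · linarith
    · exact absurd h hβ

theorem exists_hasWord (hg : ∀ α, g (P.root α) ≠ 0) (w : P.weylGroup) : ∃ k, HasWord P g w k := by
  obtain ⟨w, hw⟩ := w
  induction hw using weylGroup.induction with
  | mem i => exact exists_hasWord_ofIdx hg i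
  | one => exact ⟨0, hasWord_one⟩
  | mul x y hx hy h1 h2 =>
    obtain ⟨k, hk⟩ := h1
    obtain ⟨k', hk'⟩ := h2
    exact ⟨_, hk.mul hk'⟩

/-- The exchange property. -/
theorem HasWord.exchange (hg : ∀ α, g (P.root α) ≠ 0) {w : P.weylGroup} {k : ℕ}
    (h : HasWord P g w k) {α : ι} (hα : IsSimpleIn P g ⊤ α) (hneg : g (P.root (w • α)) < 0) :
    ∃ k', k = k' + 1 ∧ HasWord P g (w * weylGroup.ofIdx P α) k' := by
  obtain ⟨l, h1, rfl, rfl⟩ := h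
  induction l with
  | nil =>
    have := hα.1
    rw [mem_posOf] at this
    simp at hneg
    linarith
  | cons β t ih =>
    have hβ : IsSimpleIn P g ⊤ β := isSimpleIn_top_iff.2 (h1 β (by simp))
    have ht : ∀ α ∈ t, α ∈ simpleRoots P (posOf P g) := fun α hα => h1 α (by simp [hα])
    set w := (t.map (weylGroup.ofIdx P)).prod with hw
    rw [List.map_cons, List.prod_cons, ← hw, mul_smul] at hneg
    rw [List.map_cons, List.prod_cons, ← hw]
    rcases lt_or_gt_of_ne (hg (w • α)) with h | h
    · obtain ⟨k', hk', hk''⟩ := ih ht h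
      refine ⟨1 + k', by simp [hk', add_comm], ?_⟩
      rw [mul_assoc]
      exact (hasWord_ofIdx hβ).mul hk''
    · have heq : w • α = β := by
        by_contra hne
        have := hβ.reflection_mem_posOf hg (β := w • α) h Submodule.mem_top hne
        rw [mem_posOf] at this
        linarith
      refine ⟨t.length, rfl, t, ht, rfl, ?_⟩
      rw [← hw, ← heq, ofIdx_conj, inv_mul_cancel_right, mul_assoc, ofIdx_mul_self, mul_one]

theorem ncard_inversions_mul_ofIdx (hg : ∀ α, g (P.root α) ≠ 0) {w : P.weylGroup} {α : ι}
    (hα : IsSimpleIn P g ⊤ α) (hpos : 0 < g (P.root (w • α))) :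
    (inversions P (posOf P g) (w * weylGroup.ofIdx P α)).ncard =
      (inversions P (posOf P g) w).ncard + 1 := by
  have hαp := hα.1
  rw [mem_posOf] at hαp
  have hself : P.root (weylGroup.ofIdx P α • α) = -P.root α := by
    rw [root_ofIdx_smul]; simp [two_smul]
  have heq : inversions P (posOf P g) (w * weylGroup.ofIdx P α) =
      insert α ((weylGroup.ofIdx P α • ·) '' inversions P (posOf P g) w) := by
    ext β
    rw [mem_inversions_iff, Set.mem_insert_iff]
    constructor
    · rintro ⟨h1, h2⟩
      by_cases hβ : β = α
      · exact Or.inl hβ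
      · refine Or.inr ⟨weylGroup.ofIdx P α • β, ?_, ofIdx_smul_smul α β⟩
        rw [mem_inversions_iff]
        refine ⟨hα.reflection_mem_posOf hg h1 Submodule.mem_top hβ, ?_⟩
        rwa [root_smul, ← mul_smul]
    · rintro (rfl | ⟨δ, hδ, rfl⟩)
      · refine ⟨hαp, ?_⟩
        rw [mul_smul, ← root_smul, hself, smul_neg, ← root_smul, map_neg]
        linarith
      · rw [mem_inversions_iff] at hδ
        have hne : δ ≠ α := by
          rintro rfl
          rw [root_smul] at hpos
          linarith [hδ.2]
        refine ⟨hα.reflection_mem_posOf hg hδ.1 Submodule.mem_top hne, ?_⟩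
        rw [mul_smul, ← root_smul, ofIdx_smul_smul]
        exact hδ.2
  rw [heq, Set.ncard_insert_of_notMem _ (Set.toFinite _),
    Set.ncard_image_of_injective _ (MulAction.injective _)]
  rintro ⟨δ, hδ, h⟩
  have : δ = weylGroup.ofIdx P α • α :=
    (ofIdx_smul_smul (P := P) α δ).symm.trans (congrArg (weylGroup.ofIdx P α • ·) h)
  rw [mem_inversions_iff, this, hself, map_neg] at hδ
  linarith [hδ.1]

theorem ncard_inversions_le_of_hasWord (hg : ∀ α, g (P.root α) ≠ 0) {w : P.weylGroup} {k : ℕ}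
    (h : HasWord P g w k) :
    (inversions P (posOf P g) w).ncard ≤ k ∧
      HasWord P g w (inversions P (posOf P g) w).ncard := by
  obtain ⟨l, h1, rfl, rfl⟩ := h
  induction l using List.reverseRecOn with
  | nil =>
    have : inversions P (posOf P g) 1 = ∅ := by
      ext α
      rw [mem_inversions_iff, one_smul]
      constructor
      · rintro ⟨h1, h2⟩; linarith
      · exact fun h => h.elim
    rw [List.map_nil, List.prod_nil, this, Set.ncard_empty]
    exact ⟨le_rfl, hasWord_one⟩
  | append_singleton t α ih =>
    have hα : IsSimpleIn P g ⊤ α := isSimpleIn_top_iff.2 (h1 α (by simp))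
    obtain ⟨ih1, ih2⟩ := ih (fun α hα => h1 α (by simp [hα]))
    set w := (t.map (weylGroup.ofIdx P)).prod with hw
    rw [List.map_append, List.prod_append, ← hw, List.map_singleton, List.prod_singleton,
      List.length_append, List.length_singleton]
    rcases lt_or_gt_of_ne (hg (w • α)) with h | h
    · obtain ⟨k', hk', hk''⟩ := ih2.exchange hg hα h
      have hpos : 0 < g (P.root ((w * weylGroup.ofIdx P α) • α)) := by
        rw [mul_smul, root_smul, root_ofIdx_smul, P.pairing_same, two_smul]
        rw [root_smul] at h
        simp only [sub_add_cancel_left, smul_neg, map_neg]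
        linarith
      have := ncard_inversions_mul_ofIdx hg hα hpos
      rw [mul_assoc, ofIdx_mul_self, mul_one] at this
      have hk : (inversions P (posOf P g) (w * weylGroup.ofIdx P α)).ncard = k' := by omega
      exact ⟨by omega, hk ▸ hk''⟩
    · rw [ncard_inversions_mul_ofIdx hg hα h]
      exact ⟨by omega, ih2.mul (hasWord_ofIdx hα)⟩

theorem length_eq_ncard_inversions (hg : ∀ α, g (P.root α) ≠ 0) (w : P.weylGroup) :
    length P (posOf P g) w = (inversions P (posOf P g) w).ncard := by
  obtain ⟨k, hk⟩ := exists_hasWord hg w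
  apply le_antisymm
  · exact Nat.sInf_le (ncard_inversions_le_of_hasWord hg hk).2
  · exact le_csInf ⟨k, hk⟩ fun k hk => (ncard_inversions_le_of_hasWord hg hk).1

end Simple

section Lists

variable {ι : Type*}

theorem sublist_pair_or {L : List ι} {a b : ι} (ha : a ∈ L) (hb : b ∈ L) (hne : a ≠ b) :
    Before L a b ∨ Before L b a := by
  induction L with
  | nil => simp at ha
  | cons x t ih =>
    rcases List.mem_cons.1 ha with rfl | ha'
    · rcases List.mem_cons.1 hb with rfl | hb'
      · exact absurd rfl hne
      · exact Or.inl ((List.singleton_sublist.2 hb').cons_cons a)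
    · rcases List.mem_cons.1 hb with rfl | hb'
      · exact Or.inr ((List.singleton_sublist.2 ha').cons_cons b)
      · exact (ih ha' hb').imp (fun h => h.cons x) (fun h => h.cons x)

theorem Before.lt {T : Type*} [Preorder T] {κ : ι → T} {L : List ι}
    (hL : L.Pairwise fun a b => κ a < κ b) {a b : ι} (h : Before L a b) : κ a < κ b :=
  List.pairwise_iff_forall_sublist.1 hL h

theorem before_of_lt {T : Type*} [Preorder T] {κ : ι → T} {L : List ι}
    (hL : L.Pairwise fun a b => κ a < κ b) {a b : ι} (ha : a ∈ L) (hb : b ∈ L)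
    (h : κ a < κ b) : Before L a b := by
  rcases sublist_pair_or ha hb (by rintro rfl; exact lt_irrefl _ h) with h' | h'
  · exact h'
  · exact absurd (h'.lt hL) (lt_asymm h)

theorem nodup_of_pairwise_lt {T : Type*} [Preorder T] {κ : ι → T} {L : List ι}
    (hL : L.Pairwise fun a b => κ a < κ b) : L.Nodup :=
  hL.imp fun h => by rintro rfl; exact lt_irrefl _ h

theorem pairwise_idxOf [DecidableEq ι] {L : List ι} (hL : L.Nodup) :
    L.Pairwise fun a b => L.idxOf a < L.idxOf b := by
  rw [List.pairwise_iff_getElem]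
  intro i j hi hj hij
  rwa [hL.idxOf_getElem, hL.idxOf_getElem]

theorem length_eq_ncard {L : List ι} (hL : L.Nodup) {S : Set ι} (h : ∀ α, α ∈ L ↔ α ∈ S) :
    L.length = S.ncard := by
  classical
  rw [← List.toFinset_card_of_nodup hL, ← Set.ncard_coe_finset]
  congr 1
  ext α
  simp [h]

theorem exists_sorted_list [Finite ι] {T : Type*} [LinearOrder T] (κ : ι → T) (S : Set ι)
    (hinj : Set.InjOn κ S) :
    ∃ L : List ι, (∀ α, α ∈ L ↔ α ∈ S) ∧ L.Pairwise fun a b => κ a < κ b := by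
  classical
  have hS : S.Finite := Set.toFinite S
  let r : ι → ι → Prop := fun a b => κ a ≤ κ b
  have : Std.Total r := ⟨fun a b => le_total _ _⟩
  have : IsTrans ι r := ⟨fun a b c => le_trans⟩
  refine ⟨List.insertionSort r hS.toFinset.toList, fun α => by simp, ?_⟩
  have h1 := List.pairwise_insertionSort r hS.toFinset.toList
  have h2 : (List.insertionSort r hS.toFinset.toList).Nodup :=
    ((List.perm_insertionSort r _).nodup_iff).2 (Finset.nodup_toList _)
  refine (h1.and h2).imp_of_mem ?_
  rintro a b ha hb ⟨hab, hne⟩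
  refine lt_of_le_of_ne hab fun h => hne (hinj ?_ ?_ h)
  · simpa using ha
  · simpa using hb

end Lists

section ConvexOrders

variable {ι V N : Type*} [AddCommGroup V] [Module ℝ V] [AddCommGroup N] [Module ℝ N]

/-- The preorder on the roots in `S` given by `κ` is convex: a sum of two roots lies between them,
strictly if they are not equivalent. -/
def IsConvexOrder (P : RootPairing ι ℝ V N) (S : Set ι) {T : Type*} [LT T] (κ : ι → T) : Prop :=
  ∀ α ∈ S, ∀ β ∈ S, ∀ δ ∈ S, P.root δ = P.root α + P.root β →
    (κ α < κ β → κ α < κ δ ∧ κ δ < κ β) ∧ (κ α = κ β → κ δ = κ α)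

variable {P : RootPairing ι ℝ V N} {S : Set ι}

theorem lt_mediant {a b p q : ℝ} (hp : 0 < p) (hq : 0 < q) (h : a / p < b / q) :
    a / p < (a + b) / (p + q) ∧ (a + b) / (p + q) < b / q := by
  rw [div_lt_div_iff₀ hp hq] at h
  constructor
  · rw [div_lt_div_iff₀ hp (by positivity)]; nlinarith
  · rw [div_lt_div_iff₀ (by positivity) hq]; nlinarith

theorem mediant_eq {a b p q : ℝ} (hp : 0 < p) (hq : 0 < q) (h : a / p = b / q) :
    (a + b) / (p + q) = a / p := by
  rw [div_eq_div_iff hp.ne' hq.ne'] at h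
  rw [div_eq_div_iff (by positivity) hp.ne']
  linear_combination -h

theorem isConvexOrder_slope (f G : V →ₗ[ℝ] ℝ) (hG : ∀ α ∈ S, 0 < G (P.root α)) :
    IsConvexOrder P S fun α => f (P.root α) / G (P.root α) := by
  intro α hα β hβ δ _ h
  simp only [h, map_add]
  exact ⟨lt_mediant (hG α hα) (hG β hβ), mediant_eq (hG α hα) (hG β hβ)⟩

theorem IsConvexOrder.congr {T : Type*} [LT T] {κ κ' : ι → T} (h : IsConvexOrder P S κ)
    (heq : ∀ α ∈ S, κ' α = κ α) : IsConvexOrder P S κ' := by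
  intro α hα β hβ δ hδ hr
  rw [heq α hα, heq β hβ, heq δ hδ]
  exact h α hα β hβ δ hδ hr

theorem IsConvexOrder.mono {T : Type*} [LT T] {κ : ι → T} {S' : Set ι} (h : IsConvexOrder P S κ)
    (hS : S' ⊆ S) : IsConvexOrder P S' κ :=
  fun α hα β hβ δ hδ => h α (hS hα) β (hS hβ) δ (hS hδ)

theorem IsConvexOrder.lex {T T' : Type*} [LinearOrder T] [LinearOrder T'] {κ : ι → T} {κ' : ι → T'}
    (h : IsConvexOrder P S κ) (h' : ∀ t, IsConvexOrder P {α | α ∈ S ∧ κ α = t} κ') :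
    IsConvexOrder P S fun α => toLex (κ α, κ' α) := by
  intro α hα β hβ δ hδ hr
  obtain ⟨h1, h2⟩ := h α hα β hβ δ hδ hr
  have h3 : κ α = κ β → _ := fun e =>
    h' (κ α) α ⟨hα, rfl⟩ β ⟨hβ, e.symm⟩ δ ⟨hδ, h2 e⟩ hr
  simp only [Prod.Lex.toLex_lt_toLex, toLex_inj, Prod.mk.injEq]
  constructor
  · rintro (hlt | ⟨heq, hlt⟩)
    · exact ⟨Or.inl (h1 hlt).1, Or.inl (h1 hlt).2⟩
    · have := (h3 heq).1 hlt
      exact ⟨Or.inr ⟨(h2 heq).symm, this.1⟩, Or.inr ⟨(h2 heq).trans heq, this.2⟩⟩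
  · rintro ⟨heq, heq'⟩
    exact ⟨h2 heq, (h3 heq).2 heq'⟩

theorem root_ne_add_self [P.IsReduced] (α δ : ι) : P.root δ ≠ P.root α + P.root α := by
  intro h
  rw [← two_smul ℝ] at h
  have h0 := P.ne_zero α
  rcases eq_or_neg_of_smul_eq (P := P) (α := δ) (β := α) (a := 1) (b := 2) one_ne_zero
    (by rw [one_smul, h]) with
    h1 | h1
  · rw [h1, two_smul] at h
    exact h0 (by simpa using h)
  · rw [h1, ← sub_eq_zero] at h
    have : (-3 : ℝ) • P.root α = 0 := by rw [← h]; module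
    exact h0 ((smul_eq_zero.1 this).resolve_left (by norm_num))

theorem isNormalOrdering_of_isConvexOrder [P.IsReduced] {T : Type*} [LinearOrder T] {κ : ι → T}
    {L : List ι} (hconv : IsConvexOrder P S κ) (hmem : ∀ α, α ∈ L ↔ α ∈ S)
    (hL : L.Pairwise fun a b => κ a < κ b) : IsNormalOrdering P S L where
  nodup := nodup_of_pairwise_lt hL
  mem_iff := hmem
  between := by
    intro α hα β hβ δ hδ hr
    have hb := fun {a b} (ha : a ∈ S) (hb : b ∈ S) (h : κ a < κ b) =>
      before_of_lt hL ((hmem a).2 ha) ((hmem b).2 hb) h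
    rcases lt_trichotomy (κ α) (κ β) with h | h | h
    · obtain ⟨h1, h2⟩ := (hconv α hα β hβ δ hδ hr).1 h
      exact Or.inl ⟨hb hα hδ h1, hb hδ hβ h2⟩
    · exfalso
      have : α = β := by
        by_contra hne
        rcases sublist_pair_or ((hmem α).2 hα) ((hmem β).2 hβ) hne with h' | h'
        · exact (h'.lt hL).ne h
        · exact (h'.lt hL).ne' h
      subst this
      exact root_ne_add_self α δ hr
    · obtain ⟨h1, h2⟩ := (hconv β hβ α hα δ hδ (by rw [hr, add_comm])).1 h
      exact Or.inr ⟨hb hβ hδ h1, hb hδ hα h2⟩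

theorem IsNormalOrdering.isConvexOrder_idxOf [DecidableEq ι] [P.IsReduced] {L : List ι}
    (h : IsNormalOrdering P S L) : IsConvexOrder P S fun α => L.idxOf α := by
  intro α hα β hβ δ hδ hr
  have hp := pairwise_idxOf h.nodup
  refine ⟨fun hlt => ?_, fun heq => ?_⟩
  · rcases h.between α hα β hβ δ hδ hr with ⟨h1, h2⟩ | ⟨h1, h2⟩
    · exact ⟨h1.lt hp, h2.lt hp⟩
    · exact absurd ((h1.lt hp).trans (h2.lt hp)) (lt_asymm hlt)
  · have : α = β := (List.idxOf_inj ((h.mem_iff α).2 hα)).1 heq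
    subst this
    exact absurd hr (root_ne_add_self α δ)

theorem exists_generic_slope [Finite ι] [P.IsReduced] (g : V →ₗ[ℝ] ℝ) :
    ∃ f : V →ₗ[ℝ] ℝ, Set.InjOn (fun α => f (P.root α) / g (P.root α)) (posOf P g) := by
  let J := {p : ι × ι // p.1 ∈ posOf P g ∧ p.2 ∈ posOf P g ∧ p.1 ≠ p.2}
  obtain ⟨f, hf⟩ := Module.exists_dual_forall_apply_ne_zero (K := ℝ) (M := V)
    (fun p : J => g (P.root p.1.2) • P.root p.1.1 - g (P.root p.1.1) • P.root p.1.2) (by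
      rintro ⟨⟨a, b⟩, ha, hb, hne⟩ h
      exact hne (eq_of_smul_eq_of_mem_posOf ha hb (mem_posOf.1 hb).ne' (sub_eq_zero.1 h)))
  refine ⟨f, fun a ha b hb h => ?_⟩
  by_contra hne
  refine hf ⟨⟨a, b⟩, ha, hb, hne⟩ ?_
  rw [mem_posOf] at ha hb
  simp only [div_eq_div_iff ha.ne' hb.ne'] at h
  simp only [map_sub, map_smul, smul_eq_mul]
  linear_combination h

end ConvexOrders

section OrthogonalFamilies

variable {ι V N : Type*} [AddCommGroup V] [Module ℝ V] [AddCommGroup N] [Module ℝ N]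
  {P : RootPairing ι ℝ V N}

/-- The span of the roots of a family. -/
def rootSpanOf (P : RootPairing ι ℝ V N) {n : ℕ} (η : Fin n → ι) : Submodule ℝ V :=
  Submodule.span ℝ (Set.range (P.root ∘ η))

theorem root_mem_rootSpanOf {n : ℕ} (η : Fin n → ι) (k : Fin n) :
    P.root (η k) ∈ rootSpanOf P η :=
  Submodule.subset_span ⟨k, rfl⟩

theorem rootSpanOf_smul {n : ℕ} (η : Fin n → ι) {α : ι} (hα : P.root α ∈ rootSpanOf P η) :
    rootSpanOf P (fun k => weylGroup.ofIdx P α • η k) = rootSpanOf P η := by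
  set w := weylGroup.ofIdx P α
  have h1 : rootSpanOf P (fun k => w • η k) = (rootSpanOf P η).map (actLin w) := by
    rw [rootSpanOf, rootSpanOf, Submodule.map_span, ← Set.range_comp]
    congr 1
    ext y
    simp [root_smul]
  have h2 : (rootSpanOf P η).map (actLin w) ≤ rootSpanOf P η := by
    rintro _ ⟨y, hy, rfl⟩
    rw [actLin_apply, ofIdx_smul_eq]
    exact Submodule.sub_mem _ hy (Submodule.smul_mem _ _ hα)
  rw [h1]
  refine le_antisymm h2 fun y hy => ⟨w • y, h2 ⟨y, hy, rfl⟩, ?_⟩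
  rw [actLin_apply, ← mul_smul, ofIdx_mul_self, one_smul]

theorem mem_rootSpanOf_succ {n : ℕ} (η : Fin (n + 1) → ι) {y : V} :
    y ∈ rootSpanOf P η ↔ ∃ t : ℝ, ∃ z ∈ rootSpanOf P (η ∘ Fin.castSucc),
      y = t • P.root (η (Fin.last n)) + z := by
  have : Set.range (P.root ∘ η) =
      insert (P.root (η (Fin.last n))) (Set.range (P.root ∘ η ∘ Fin.castSucc)) := by
    ext y
    constructor
    · rintro ⟨k, rfl⟩
      induction k using Fin.lastCases with
      | last => exact Or.inl rfl
      | cast k => exact Or.inr ⟨k, rfl⟩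
    · rintro (rfl | ⟨k, rfl⟩)
      exacts [⟨_, rfl⟩, ⟨_, rfl⟩]
  rw [rootSpanOf, this, Submodule.mem_span_insert]
  rfl

theorem coroot'_eq_zero_of_mem_rootSpanOf {n : ℕ} {η : Fin n → ι} {γ : ι}
    (h : ∀ k, P.pairing (η k) γ = 0) {y : V} (hy : y ∈ rootSpanOf P η) : P.coroot' γ y = 0 := by
  have : rootSpanOf P η ≤ LinearMap.ker (P.coroot' γ) := by
    rw [rootSpanOf, Submodule.span_le]
    rintro _ ⟨k, rfl⟩
    simpa using h k
  exact this hy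

theorem ofFn_prod_smul {n : ℕ} (η : Fin n → ι)
    (horth : Pairwise fun j k => P.IsOrthogonal (η j) (η k))
    (y : V) :
    (List.ofFn fun k => weylGroup.ofIdx P (η k)).prod • y =
      y - ∑ k, P.coroot' (η k) y • P.root (η k) := by
  induction n with
  | zero => simp
  | succ n ih =>
    have ih' := ih (η ∘ Fin.succ) (fun j k hjk => horth (by simpa using hjk))
    simp only [Function.comp_apply] at ih'
    rw [List.ofFn_succ, List.prod_cons, mul_smul, ih', ofIdx_smul_eq, Fin.sum_univ_succ, map_sub,
      map_sum]
    have : ∑ k : Fin n, P.coroot' (η 0) (P.coroot' (η k.succ) y • P.root (η k.succ)) = 0 := by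
      apply Finset.sum_eq_zero
      intro k _
      rw [map_smul, RootPairing.root_coroot'_eq_pairing,
        (horth (Fin.succ_ne_zero k)).1, smul_zero]
    rw [this, sub_zero]
    abel

theorem ofFn_prod_smul_eq_neg {n : ℕ} {η : Fin n → ι}
    (horth : Pairwise fun j k => P.IsOrthogonal (η j) (η k)) {y : V} (hy : y ∈ rootSpanOf P η) :
    (List.ofFn fun k => weylGroup.ofIdx P (η k)).prod • y = -y := by
  set w := (List.ofFn fun k => weylGroup.ofIdx P (η k)).prod
  have : rootSpanOf P η ≤ LinearMap.ker (actLin w + LinearMap.id) := by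
    rw [rootSpanOf, Submodule.span_le]
    rintro _ ⟨k, rfl⟩
    rw [SetLike.mem_coe, LinearMap.mem_ker, LinearMap.add_apply, actLin_apply, LinearMap.id_apply,
      Function.comp_apply, ofFn_prod_smul η horth, Finset.sum_eq_single k]
    · rw [RootPairing.root_coroot'_eq_pairing, P.pairing_same, two_smul]; abel
    · intro j _ hj
      rw [RootPairing.root_coroot'_eq_pairing, (horth hj).2, zero_smul]
    · simp
  exact eq_neg_of_add_eq_zero_left (this hy)

section

variable [Fintype ι]

theorem rootForm_mul_coroot' (α : ι) (y : V) :
    P.coroot' α y * P.RootForm (P.root α) (P.root α) = 2 * P.RootForm (P.root α) y := by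
  have h := P.rootForm_reflection_reflection_apply α (P.root α) y
  rw [P.reflection_apply_self, P.reflection_apply] at h
  simp only [map_neg, LinearMap.neg_apply, map_sub, map_smul, smul_eq_mul] at h
  linarith

theorem rootForm_root_self_pos (α : ι) : 0 < P.RootForm (P.root α) (P.root α) :=
  P.rootForm_pos_of_ne_zero (Submodule.subset_span ⟨α, rfl⟩) (P.ne_zero α)

theorem coroot'_eq_zero_iff (α : ι) (y : V) : P.coroot' α y = 0 ↔ P.RootForm (P.root α) y = 0 := by
  have h := rootForm_mul_coroot' (P := P) α y
  have h' := rootForm_root_self_pos (P := P) α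
  constructor
  · intro h0
    rw [h0, zero_mul] at h
    linarith
  · intro h0
    rw [h0, mul_zero] at h
    exact (mul_eq_zero.1 h).resolve_right h'.ne'

/-- The product of the reflections in mutually orthogonal roots depends only on their span. -/
theorem ofFn_prod_eq_of_rootSpanOf_eq {n m : ℕ} {η : Fin n → ι} {γ : Fin m → ι}
    (hη : Pairwise fun j k => P.IsOrthogonal (η j) (η k))
    (hγ : Pairwise fun j k => P.IsOrthogonal (γ j) (γ k))
    (hspan : rootSpanOf P γ = rootSpanOf P η) :
    (List.ofFn fun k => weylGroup.ofIdx P (η k)).prod =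
      (List.ofFn fun k => weylGroup.ofIdx P (γ k)).prod := by
  apply weylGroup_ext
  intro y
  set x := (2⁻¹ : ℝ) • ∑ k, P.coroot' (η k) y • P.root (η k) with hx
  have hxX : x ∈ rootSpanOf P η := Submodule.smul_mem _ _
    (Submodule.sum_mem _ fun k _ => Submodule.smul_mem _ _ (root_mem_rootSpanOf η k))
  have h1 : (List.ofFn fun k => weylGroup.ofIdx P (η k)).prod • y = y - (2 : ℝ) • x := by
    rw [ofFn_prod_smul η hη, hx, smul_smul]; norm_num
  have h0 : ∀ k, P.coroot' (η k) (y - x) = 0 := by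
    intro k
    rw [map_sub, hx, map_smul, map_sum, Finset.sum_eq_single k]
    · rw [map_smul, RootPairing.root_coroot'_eq_pairing, P.pairing_same, smul_eq_mul, smul_eq_mul]
      ring
    · intro j _ hj
      rw [map_smul, RootPairing.root_coroot'_eq_pairing, (hη hj).1, smul_zero]
    · simp
  have hB : ∀ z ∈ rootSpanOf P η, P.RootForm z (y - x) = 0 := by
    have : rootSpanOf P η ≤ LinearMap.ker (P.RootForm.flip (y - x)) := by
      rw [rootSpanOf, Submodule.span_le]
      rintro _ ⟨k, rfl⟩
      exact (coroot'_eq_zero_iff _ _).1 (h0 k)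
    exact fun z hz => this hz
  have h2 : (List.ofFn fun k => weylGroup.ofIdx P (γ k)).prod • (y - x) = y - x := by
    rw [ofFn_prod_smul γ hγ, Finset.sum_eq_zero, sub_zero]
    intro k _
    rw [(coroot'_eq_zero_iff _ _).2 (hB _ (hspan ▸ root_mem_rootSpanOf γ k)), zero_smul]
  have h3 := ofFn_prod_smul_eq_neg hγ (hspan.symm ▸ hxX)
  rw [h1]
  calc y - (2 : ℝ) • x = (y - x) + -x := by rw [two_smul]; abel
    _ = _ := by rw [← h3]; nth_rewrite 1 [← h2]; rw [← smul_add, sub_add_cancel]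

end

end OrthogonalFamilies

section OrthogonalOrdering

variable {ι V N : Type*} [AddCommGroup V] [Module ℝ V] [AddCommGroup N] [Module ℝ N]

/-- `B ++ M` is a normal ordering of the roots in `S` in which `M` is spanned by the family `γ`, has
more than half of the roots, and is in general position with respect to `γ`. -/
structure IsOrthogonalOrdering (P : RootPairing ι ℝ V N) (S : Set ι) {n : ℕ} (γ : Fin n → ι)
    (B M : List ι) : Prop where
  normal : IsNormalOrdering P S (B ++ M)
  spanned : SpannedBy M γ
  length_eq : 2 * B.length + n = (B ++ M).length
  add_ne : ∀ α ∈ M, ∀ β ∈ M, ∀ c : Fin n → ℕ,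
    (∀ k, c k ≠ 0 → Before M α (γ k) ∧ Before M (γ k) β) →
      P.root α + P.root β ≠ ∑ k, c k • P.root (γ k)
  ne_sum : ∀ α ∈ M, ∀ c : Fin n → ℕ, (∀ k, c k ≠ 0 → Before M α (γ k)) →
    P.root α ≠ ∑ k, c k • P.root (γ k)

theorem SpannedBy.mem {ι : Type*} {n : ℕ} {M : List ι} {γ : Fin n → ι}
    (h : SpannedBy M γ) (k : Fin n) :
    γ k ∈ M :=
  h.1.subset (by simp [List.mem_ofFn])

variable [Fintype ι] {P : RootPairing ι ℝ V N} {g : V →ₗ[ℝ] ℝ} [P.IsCrystallographic] [P.IsReduced]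

/-- An orthogonal family can be replaced by one with the same span that ends in a simple root. -/
theorem exists_family_last_isSimpleIn (hg : ∀ α, g (P.root α) ≠ 0) {n : ℕ} (η : Fin (n + 1) → ι)
    (horth : Pairwise fun j k => P.IsOrthogonal (η j) (η k)) :
    ∃ η' : Fin (n + 1) → ι, (Pairwise fun j k => P.IsOrthogonal (η' j) (η' k)) ∧
      rootSpanOf P η' = rootSpanOf P η ∧ IsSimpleIn P g (rootSpanOf P η) (η' (Fin.last n)) := by
  obtain ⟨η', ⟨h1, h2, h3⟩, hmin⟩ := Set.exists_min_image
    {η' : Fin (n + 1) → ι | (Pairwise fun j k => P.IsOrthogonal (η' j) (η' k)) ∧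
      rootSpanOf P η' = rootSpanOf P η ∧ η' (Fin.last n) ∈ posOf P g}
    (fun η' => g (P.root (η' (Fin.last n)))) (Set.toFinite _) (by
      by_cases h : η (Fin.last n) ∈ posOf P g
      · exact ⟨η, horth, rfl, h⟩
      · refine ⟨fun k => weylGroup.ofIdx P (η (Fin.last n)) • η k,
          fun j k hjk => isOrthogonal_smul _ (horth hjk),
          rootSpanOf_smul η (root_mem_rootSpanOf η _), ?_⟩
        rw [mem_posOf] at h ⊢
        rw [root_ofIdx_smul, P.pairing_same, two_smul, sub_add_cancel_left, map_neg]
        rcases lt_or_gt_of_ne (hg (η (Fin.last n))) with h' | h'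
        · linarith
        · exact absurd h' h)
  refine ⟨η', h1, h2, ?_⟩
  have hX : P.root (η' (Fin.last n)) ∈ rootSpanOf P η := h2 ▸ root_mem_rootSpanOf η' _
  by_contra hns
  obtain ⟨α, hα, h4, h5⟩ := exists_isSimpleIn_lt hg h3 hX hns
  refine absurd (hmin (fun k => weylGroup.ofIdx P α • η' k)
    ⟨fun j k hjk => isOrthogonal_smul _ (h1 hjk), ?_, h4⟩) (not_le.2 h5)
  rw [← h2]
  exact rootSpanOf_smul η' (h2.symm ▸ hα.2.1)

theorem exists_isOrthogonalOrdering_succ (hg : ∀ α, g (P.root α) ≠ 0) {n : ℕ}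
    {η : Fin (n + 1) → ι}
    (horth : Pairwise fun j k => P.IsOrthogonal (η j) (η k))
    (hsimple : IsSimpleIn P g (rootSpanOf P η) (η (Fin.last n)))
    {γ' : Fin n → ι} {B' M' : List ι}
    (h' : IsOrthogonalOrdering P {α | α ∈ posOf P g ∧ P.root α ∈ rootSpanOf P (η ∘ Fin.castSucc)}
      γ' B' M') :
    ∃ B M, IsOrthogonalOrdering P {α | α ∈ posOf P g ∧ P.root α ∈ rootSpanOf P η}
      (Fin.snoc γ' (η (Fin.last n)) : Fin (n + 1) → ι) B M := by
  classical
  set γ := η (Fin.last n) with hγ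
  set X := rootSpanOf P η with hX
  set S : Set ι := {α | α ∈ posOf P g ∧ P.root α ∈ X} with hS
  set S' : Set ι := {α | α ∈ posOf P g ∧ P.root α ∈ rootSpanOf P (η ∘ Fin.castSucc)} with hS'
  have hγS : γ ∈ S := ⟨hsimple.1, hsimple.2.1⟩
  have hperp : ∀ y ∈ rootSpanOf P (η ∘ Fin.castSucc), P.coroot' γ y = 0 := fun y hy =>
    coroot'_eq_zero_of_mem_rootSpanOf
      (fun k => (horth (Fin.castSucc_lt_last k).ne).1) hy
  have hmemS' : ∀ α, α ∈ S' ↔ α ∈ S ∧ P.pairing α γ = 0 := by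
    intro α
    constructor
    · rintro ⟨h1, h2⟩
      refine ⟨⟨h1, (mem_rootSpanOf_succ η).2 ⟨0, _, h2, by simp⟩⟩, ?_⟩
      simpa using hperp _ h2
    · rintro ⟨⟨h1, h2⟩, h3⟩
      obtain ⟨t, z, hz, h4⟩ := (mem_rootSpanOf_succ η).1 h2
      have ht : t = 0 := by
        rw [← RootPairing.root_coroot'_eq_pairing, h4, map_add, hperp z hz, map_smul, ← hγ,
          RootPairing.root_coroot'_eq_pairing, P.pairing_same] at h3
        simpa using h3
      refine ⟨h1, ?_⟩
      rw [h4, ht, zero_smul, zero_add]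
      exact hz
  -- the slope with respect to `γ`, with `γ` moved to the end
  let gs : V →ₗ[ℝ] ℝ := g - (g (P.root γ) / 2) • P.coroot' γ
  have hgs : ∀ α ∈ S, α ≠ γ → 0 < gs (P.root α) := by
    intro α hα hne
    have h1 := hsimple.reflection_mem_posOf hg hα.1 hα.2 hne
    have h2 := hα.1
    rw [mem_posOf] at h1 h2
    rw [root_ofIdx_smul, map_sub, map_smul, smul_eq_mul] at h1
    simp only [gs, LinearMap.sub_apply, LinearMap.smul_apply, smul_eq_mul,
      RootPairing.root_coroot'_eq_pairing]
    linarith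
  have hgsγ : gs (P.root γ) = 0 := by
    simp only [gs, LinearMap.sub_apply, LinearMap.smul_apply, smul_eq_mul,
      RootPairing.root_coroot'_eq_pairing, P.pairing_same]
    ring
  let σ : ι → ℝ := fun α => P.coroot' γ (P.root α) / gs (P.root α)
  obtain ⟨C, hC⟩ : ∃ C, ∀ α, σ α < C := by
    obtain ⟨C, hC⟩ := (Set.finite_range σ).bddAbove
    exact ⟨C + 1, fun α => lt_of_le_of_lt (hC ⟨α, rfl⟩) (lt_add_one C)⟩
  let κ₀ : ι → ℝ := fun α => if α = γ then C else σ α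
  have hκγ : κ₀ γ = C := if_pos rfl
  have hκne : ∀ α, α ≠ γ → κ₀ α = σ α := fun α h => if_neg h
  have hσ : ∀ α, σ α = P.pairing α γ / gs (P.root α) := fun α => by
    simp only [σ, RootPairing.root_coroot'_eq_pairing]
  have hconv₀ : IsConvexOrder P S κ₀ := by
    intro α hα β hβ δ hδ hr
    have hδγ : δ ≠ γ := by
      rintro rfl
      exact hsimple.2.2 α hα.1 hα.2 β hβ.1 hβ.2 hr
    have hstep : ∀ α ∈ S, α ≠ γ → P.root δ = P.root α + P.root γ → κ₀ α < κ₀ δ := by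
      intro α hα hne hr
      rw [hκne α hne, hκne δ hδγ]
      simp only [σ, hr, map_add, hgsγ, add_zero]
      apply div_lt_div_of_pos_right _ (hgs α hα hne)
      simp
    by_cases h1 : α = γ
    · by_cases h2 : β = γ
      · subst h1 h2
        exact absurd hr (root_ne_add_self _ _)
      · have h3 : κ₀ β < κ₀ α := by rw [hκne β h2, h1, hκγ]; exact hC β
        exact ⟨fun h => absurd h (lt_asymm h3), fun h => absurd h h3.ne'⟩
    · by_cases h2 : β = γ
      · have h3 : κ₀ α < κ₀ β := by rw [hκne α h1, h2, hκγ]; exact hC α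
        refine ⟨fun _ => ⟨hstep α hα h1 (by rw [hr, h2]), ?_⟩, fun h => absurd h h3.ne⟩
        rw [hκne δ hδγ, h2, hκγ]
        exact hC δ
      · rw [hκne α h1, hκne β h2, hκne δ hδγ]
        exact isConvexOrder_slope (S := {α | α ∈ S ∧ α ≠ γ}) (P.coroot' γ) gs
          (fun α hα => hgs α hα.1 hα.2) α ⟨hα, h1⟩ β ⟨hβ, h2⟩ δ ⟨hδ, hδγ⟩ hr
  obtain ⟨f, hf⟩ := exists_generic_slope (P := P) g
  let κ₁ : ι → ℝ := fun α =>
    if α ∈ S' then ((B' ++ M').idxOf α : ℝ) else f (P.root α) / g (P.root α)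
  have hσ0 : ∀ α ∈ S, α ≠ γ → (σ α = 0 ↔ P.pairing α γ = 0) := by
    intro α hα hne
    rw [hσ, div_eq_zero_iff, or_iff_left (hgs α hα hne).ne']
  have hS'ne : ∀ α ∈ S', α ≠ γ := by
    rintro α hα rfl
    have := ((hmemS' _).1 hα).2
    rw [P.pairing_same] at this
    norm_num at this
  have hS'κ : ∀ α ∈ S', κ₀ α = 0 := fun α hα => by
    rw [hκne α (hS'ne α hα)]
    exact (hσ0 α ((hmemS' α).1 hα).1 (hS'ne α hα)).2 ((hmemS' α).1 hα).2
  have hidx : IsConvexOrder P S' fun α => ((B' ++ M').idxOf α : ℝ) := by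
    intro α hα β hβ δ hδ hr
    have := h'.normal.isConvexOrder_idxOf α hα β hβ δ hδ hr
    simpa only [Nat.cast_lt, Nat.cast_inj] using this
  have hC0 : 0 < C := by
    have := hC γ
    rw [hσ, hgsγ, div_zero] at this
    exact this
  have hzero : ∀ α ∈ S, κ₀ α = 0 → α ∈ S' := by
    intro α hα h0
    have hne : α ≠ γ := by rintro rfl; rw [hκγ] at h0; exact hC0.ne' h0
    rw [hκne α hne, hσ0 α hα hne] at h0
    exact (hmemS' α).2 ⟨hα, h0⟩
  let κ : ι → ℝ ×ₗ ℝ := fun α => toLex (κ₀ α, κ₁ α)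
  have hconv : IsConvexOrder P S κ := by
    apply hconv₀.lex
    intro t
    by_cases ht : t = 0
    · refine (hidx.mono (S' := {α | α ∈ S ∧ κ₀ α = t}) ?_).congr ?_
      · rintro α ⟨h1, h2⟩
        exact hzero α h1 (h2.trans ht)
      · rintro α ⟨h1, h2⟩
        exact if_pos (hzero α h1 (h2.trans ht))
    · refine (isConvexOrder_slope (S := {α | α ∈ S ∧ κ₀ α = t}) f g fun α hα => hα.1.1).congr ?_
      rintro α ⟨h1, h2⟩
      exact if_neg fun h => ht (h2.symm.trans (hS'κ α h))
  have hinj : Set.InjOn κ S := by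
    intro α hα β hβ h
    simp only [κ, toLex_inj, Prod.mk.injEq] at h
    obtain ⟨h1, h2⟩ := h
    by_cases hα' : α ∈ S'
    · have hβ' : β ∈ S' := hzero β hβ (h1.symm.trans (hS'κ α hα'))
      simp only [κ₁, if_pos hα', if_pos hβ', Nat.cast_inj] at h2
      exact (List.idxOf_inj ((h'.normal.mem_iff α).2 hα')).1 h2
    · have hβ' : β ∉ S' := fun h => hα' (hzero α hα (h1.trans (hS'κ β h)))
      simp only [κ₁, if_neg hα', if_neg hβ'] at h2
      exact hf hα.1 hβ.1 h2
  obtain ⟨Qm, hQm, hQms⟩ := exists_sorted_list κ {α | α ∈ S ∧ P.pairing α γ < 0}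
    (hinj.mono fun α h => h.1)
  obtain ⟨Qp, hQp, hQps⟩ := exists_sorted_list κ {α | (α ∈ S ∧ α ≠ γ) ∧ 0 < P.pairing α γ}
    (hinj.mono fun α h => h.1.1)
  have hQmκ : ∀ α ∈ Qm, κ₀ α < 0 := by
    intro α hα
    obtain ⟨h1, h2⟩ := (hQm α).1 hα
    have hne : α ≠ γ := by rintro rfl; rw [P.pairing_same] at h2; linarith
    rw [hκne α hne, hσ]
    exact div_neg_of_neg_of_pos h2 (hgs α h1 hne)
  have hQpκ : ∀ α ∈ Qp, 0 < κ₀ α := by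
    intro α hα
    obtain ⟨h1, h2⟩ := (hQp α).1 hα
    rw [hκne α h1.2, hσ]
    exact div_pos h2 (hgs α h1.1 h1.2)
  have hBMκ : ∀ α ∈ B' ++ M', κ₀ α = 0 := fun α hα => hS'κ α ((h'.normal.mem_iff α).1 hα)
  have hBMs : (B' ++ M').Pairwise fun a b => κ a < κ b := by
    refine (pairwise_idxOf h'.normal.nodup).imp_of_mem fun {a b} ha hb hab => ?_
    refine Prod.Lex.toLex_lt_toLex.2 (Or.inr ⟨(hBMκ a ha).trans (hBMκ b hb).symm, ?_⟩)
    simp only [κ₁, if_pos ((h'.normal.mem_iff a).1 ha), if_pos ((h'.normal.mem_iff b).1 hb)]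
    exact_mod_cast hab
  have hlt : ∀ {a b}, κ₀ a < κ₀ b → κ a < κ b := fun h => Prod.Lex.toLex_lt_toLex.2 (Or.inl h)
  have hQpC : ∀ α ∈ Qp, κ₀ α < κ₀ γ := fun α hα => by
    rw [hκγ, hκne α ((hQp α).1 hα).1.2]
    exact hC α
  have hsorted : (Qm ++ ((B' ++ M') ++ (Qp ++ [γ]))).Pairwise fun a b => κ a < κ b := by
    refine List.pairwise_append.2 ⟨hQms, List.pairwise_append.2 ⟨hBMs,
      List.pairwise_append.2 ⟨hQps, List.pairwise_singleton _ _, ?_⟩, ?_⟩, ?_⟩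
    · intro a ha b hb
      rw [List.mem_singleton.1 hb]
      exact hlt (hQpC a ha)
    · intro a ha b hb
      apply hlt
      rw [hBMκ a ha]
      rcases List.mem_append.1 hb with h | h
      · exact hQpκ b h
      · rw [List.mem_singleton.1 h, hκγ]
        exact hC0
    · intro a ha b hb
      apply hlt
      rcases List.mem_append.1 hb with h | h
      · rw [hBMκ b h]
        exact hQmκ a ha
      · refine (hQmκ a ha).trans ?_
        rcases List.mem_append.1 h with h | h
        · exact hQpκ b h
        · rw [List.mem_singleton.1 h, hκγ]
          exact hC0
  have hassoc : (Qm ++ B') ++ (M' ++ Qp ++ [γ]) = Qm ++ ((B' ++ M') ++ (Qp ++ [γ])) := by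
    simp only [List.append_assoc]
  have hmem : ∀ α, α ∈ (Qm ++ B') ++ (M' ++ Qp ++ [γ]) ↔ α ∈ S := by
    intro α
    rw [hassoc, List.mem_append, List.mem_append (s := B' ++ M'), List.mem_append (s := Qp), hQm,
      hQp,
      h'.normal.mem_iff, List.mem_singleton]
    constructor
    · rintro (h | h | h | h)
      · exact h.1
      · exact ((hmemS' α).1 h).1
      · exact h.1.1
      · exact h ▸ hγS
    · intro h
      by_cases hne : α = γ
      · exact Or.inr (Or.inr (Or.inr hne))
      · rcases lt_trichotomy (P.pairing α γ) 0 with h1 | h1 | h1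
        · exact Or.inl ⟨h, h1⟩
        · exact Or.inr (Or.inl ((hmemS' α).2 ⟨h, h1⟩))
        · exact Or.inr (Or.inr (Or.inl ⟨⟨h, hne⟩, h1⟩))
  rw [← hassoc] at hsorted
  have hMs : (M' ++ Qp ++ [γ]).Pairwise fun a b => κ a < κ b :=
    (List.pairwise_append.1 hsorted).2.1
  have hM's : M'.Pairwise fun a b => κ a < κ b := (List.pairwise_append.1 hBMs).2.1
  have hMS : ∀ α ∈ M' ++ Qp ++ [γ], α ∈ S := fun α hα => (hmem α).1 (List.mem_append_right _ hα)
  have hM'S : ∀ α ∈ M', α ∈ S' := fun α hα => (h'.normal.mem_iff α).1 (List.mem_append_right _ hα)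
  have hMpos : ∀ α ∈ M' ++ Qp ++ [γ], 0 ≤ P.pairing α γ ∧ (P.pairing α γ = 0 → α ∈ M') := by
    intro α hα
    rw [List.mem_append, List.mem_append, List.mem_singleton] at hα
    rcases hα with (h | h) | h
    · exact ⟨((hmemS' α).1 (hM'S α h)).2.ge, fun _ => h⟩
    · have := ((hQp α).1 h).2
      exact ⟨this.le, fun h0 => absurd h0 this.ne'⟩
    · rw [h, P.pairing_same]
      exact ⟨by norm_num, fun h0 => by norm_num at h0⟩
  have hγM' : ∀ k, γ' k ∈ M' := h'.spanned.mem
  have hγ'0 : ∀ k, P.coroot' γ (P.root (γ' k)) = 0 := fun k => by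
    rw [RootPairing.root_coroot'_eq_pairing]
    exact ((hmemS' _).1 (hM'S _ (hγM' k))).2
  have htrans : ∀ {a b}, a ∈ M' → b ∈ M' → Before (M' ++ Qp ++ [γ]) a b → Before M' a b :=
    fun ha hb h => before_of_lt hM's ha hb (h.lt hMs)
  have hne_sum' : ∀ c : Fin (n + 1) → ℕ,
      ∑ k, c k • P.root ((Fin.snoc γ' γ : Fin (n + 1) → ι) k) =
        ∑ k : Fin n, c k.castSucc • P.root (γ' k) + c (Fin.last n) • P.root γ := by
    intro c
    rw [Fin.sum_univ_castSucc]
    simp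
  refine ⟨Qm ++ B', M' ++ Qp ++ [γ], isNormalOrdering_of_isConvexOrder hconv hmem hsorted,
    ⟨?_, ?_, ?_⟩, ?_, ?_, ?_⟩
  · rw [List.ofFn_succ', List.concat_eq_append]
    simp only [Fin.snoc_castSucc, Fin.snoc_last]
    exact (h'.spanned.1.trans (List.sublist_append_left _ _)).append (List.Sublist.refl _)
  · rw [List.ofFn_succ', List.concat_eq_append]
    simp only [Fin.snoc_castSucc, Fin.snoc_last]
    have hhead := h'.spanned.2.1
    rcases n with _ | n
    · have hM' : M' = [] := by simpa using hhead
      have hQ : Qp = [] := by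
        rw [List.eq_nil_iff_forall_not_mem]
        intro α hα
        obtain ⟨⟨⟨h1, h2⟩, h3⟩, -⟩ := (hQp α).1 hα
        obtain ⟨t, z, hz, h4⟩ := (mem_rootSpanOf_succ η).1 h2
        have hz0 : z = 0 := by
          have : Set.range (P.root ∘ η ∘ Fin.castSucc : Fin 0 → V) = ∅ := Set.range_eq_empty _
          rw [rootSpanOf, this, Submodule.span_empty] at hz
          simpa using hz
        refine h3 (eq_of_smul_eq_of_mem_posOf h1 hsimple.1 (a := 1) (b := t) one_ne_zero ?_)
        rw [one_smul, h4, hz0, add_zero]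
      simp [hM', hQ]
    · have hne : M' ≠ [] := List.ne_nil_of_mem (hγM' 0)
      have hne' : List.ofFn γ' ≠ [] := by simp
      rw [List.append_assoc, List.head?_append_of_ne_nil _ hne, List.head?_append_of_ne_nil _ hne',
        hhead]
  · rw [List.ofFn_succ', List.concat_eq_append]
    simp
  · have hcard : Qm.length = Qp.length := by
      rw [length_eq_ncard (nodup_of_pairwise_lt hQms) hQm,
        length_eq_ncard (nodup_of_pairwise_lt hQps) hQp,
        ← Set.ncard_image_of_injective _ (MulAction.injective (weylGroup.ofIdx P γ))]
      congr 1
      have hpair : ∀ α, P.pairing (weylGroup.ofIdx P γ • α) γ = -P.pairing α γ := by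
        intro α
        rw [← RootPairing.root_coroot'_eq_pairing, root_ofIdx_smul, map_sub, map_smul,
          RootPairing.root_coroot'_eq_pairing, RootPairing.root_coroot'_eq_pairing, P.pairing_same,
          smul_eq_mul]
        ring
      have hmaps : ∀ α ∈ S, α ≠ γ → weylGroup.ofIdx P γ • α ∈ S := fun α hα hne =>
        ⟨hsimple.reflection_mem_posOf hg hα.1 hα.2 hne, by
          rw [root_ofIdx_smul]
          exact X.sub_mem hα.2 (X.smul_mem _ hsimple.2.1)⟩
      ext α
      constructor
      · rintro ⟨β, ⟨h1, h2⟩, rfl⟩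
        have hne : β ≠ γ := by rintro rfl; rw [P.pairing_same] at h2; linarith
        have hp : 0 < P.pairing (weylGroup.ofIdx P γ • β) γ := by rw [hpair]; linarith
        refine ⟨⟨hmaps β h1 hne, fun he => ?_⟩, hp⟩
        have hβ : β = weylGroup.ofIdx P γ • γ :=
          (ofIdx_smul_smul (P := P) γ β).symm.trans (congrArg (weylGroup.ofIdx P γ • ·) he)
        have hr := root_ofIdx_smul (P := P) γ γ
        rw [← hβ, P.pairing_same, two_smul, sub_add_cancel_left] at hr
        have h3 := h1.1
        have h4 := hsimple.1
        rw [mem_posOf] at h3 h4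
        rw [hr, map_neg] at h3
        linarith
      · rintro ⟨⟨h1, h2⟩, h3⟩
        exact ⟨weylGroup.ofIdx P γ • α, ⟨hmaps α h1 h2, by rw [hpair]; linarith⟩,
          ofIdx_smul_smul γ α⟩
    have := h'.length_eq
    simp only [List.length_append, List.length_singleton] at this ⊢
    omega
  · intro α hα β hβ c hc hsum
    have hlast : c (Fin.last n) = 0 := by
      by_contra h
      have := (hc _ h).2.lt hMs
      rw [Fin.snoc_last] at this
      by_cases hβγ : β = γ
      · rw [hβγ] at this
        exact lt_irrefl _ this
      · refine lt_asymm this (hlt ?_)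
        rw [hκγ, hκne β hβγ]
        exact hC β
    rw [hne_sum', hlast, zero_smul, add_zero] at hsum
    have h0 := congrArg (P.coroot' γ) hsum
    rw [map_add, map_sum, Finset.sum_eq_zero (fun k _ => by rw [map_nsmul, hγ'0, smul_zero]),
      RootPairing.root_coroot'_eq_pairing, RootPairing.root_coroot'_eq_pairing] at h0
    obtain ⟨hα0, hαM⟩ := hMpos α hα
    obtain ⟨hβ0, hβM⟩ := hMpos β hβ
    have hαM' := hαM (by linarith)
    have hβM' := hβM (by linarith)
    refine h'.add_ne α hαM' β hβM' (fun k => c k.castSucc) (fun k hk => ?_) hsum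
    have := hc _ hk
    rw [Fin.snoc_castSucc] at this
    exact ⟨htrans hαM' (hγM' k) this.1, htrans (hγM' k) hβM' this.2⟩
  · intro α hα c hc hsum
    rw [hne_sum'] at hsum
    by_cases hαM : α ∈ M'
    · have h0 := congrArg (P.coroot' γ) hsum
      rw [map_add, map_sum, Finset.sum_eq_zero (fun k _ => by rw [map_nsmul, hγ'0, smul_zero]),
        map_nsmul, RootPairing.root_coroot'_eq_pairing, RootPairing.root_coroot'_eq_pairing,
        ((hmemS' α).1 (hM'S α hαM)).2, P.pairing_same] at h0
      have hlast : c (Fin.last n) = 0 := by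
        have : (c (Fin.last n) : ℝ) = 0 := by simpa using h0.symm
        exact_mod_cast this
      rw [hlast, zero_smul, add_zero] at hsum
      refine h'.ne_sum α hαM (fun k => c k.castSucc) (fun k hk => ?_) hsum
      have := hc _ hk
      rw [Fin.snoc_castSucc] at this
      exact htrans hαM (hγM' k) this
    · have hz : ∀ k : Fin n, c k.castSucc = 0 := by
        intro k
        by_contra hk
        have := (hc _ hk).lt hMs
        rw [Fin.snoc_castSucc] at this
        refine lt_asymm this (hlt ?_)
        rw [hS'κ _ (hM'S _ (hγM' k))]
        rw [List.mem_append, List.mem_append, List.mem_singleton] at hα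
        rcases hα with (h | h) | h
        · exact absurd h hαM
        · exact hQpκ α h
        · rw [h, hκγ]
          exact hC0
      rw [Finset.sum_eq_zero (fun k _ => by rw [hz, zero_smul]), zero_add] at hsum
      have hαγ : α = γ := by
        refine eq_of_smul_eq_of_mem_posOf (hMS α hα).1 hsimple.1 (a := 1)
          (b := (c (Fin.last n) : ℝ)) one_ne_zero ?_
        rw [one_smul, hsum, Nat.cast_smul_eq_nsmul]
      have hlast : c (Fin.last n) ≠ 0 := by
        intro h
        rw [h, zero_smul] at hsum
        exact P.ne_zero α hsum
      have := (hc _ hlast).lt hMs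
      rw [Fin.snoc_last, hαγ] at this
      exact lt_irrefl _ this

/-- The positive roots in the span of mutually orthogonal roots have a normal ordering that is
adapted to an orthogonal family of positive roots with the same span. -/
theorem exists_isOrthogonalOrdering (hg : ∀ α, g (P.root α) ≠ 0) {n : ℕ} (η : Fin n → ι)
    (horth : Pairwise fun j k => P.IsOrthogonal (η j) (η k)) :
    ∃ γ : Fin n → ι, (Pairwise fun j k => P.IsOrthogonal (γ j) (γ k)) ∧ (∀ k, γ k ∈ posOf P g) ∧
      rootSpanOf P γ = rootSpanOf P η ∧
      ∃ B M, IsOrthogonalOrdering P {α | α ∈ posOf P g ∧ P.root α ∈ rootSpanOf P η} γ B M := by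
  induction n with
  | zero =>
    have hempty : ∀ α, P.root α ∉ rootSpanOf P η := by
      intro α hα
      rw [rootSpanOf, Set.range_eq_empty, Submodule.span_empty, Submodule.mem_bot] at hα
      exact P.ne_zero α hα
    refine ⟨η, horth, fun k => k.elim0, rfl, [], [], ⟨⟨by simp, fun α => ?_, ?_⟩, ?_, rfl, ?_, ?_⟩⟩
    · exact ⟨fun h => by simp at h, fun h => absurd h.2 (hempty α)⟩
    · intro α hα
      exact absurd hα.2 (hempty α)
    · simp [SpannedBy]
    · simp
    · simp
  | succ n ih =>
    obtain ⟨η', h1, h2, h3⟩ := exists_family_last_isSimpleIn hg η horth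
    rw [← h2] at h3 ⊢
    have hinj : Function.Injective (Fin.castSucc : Fin n → Fin (n + 1)) :=
      Fin.castSucc_injective n
    obtain ⟨γ', g1, g2, g3, B', M', h'⟩ := ih (η' ∘ Fin.castSucc) (h1.comp_of_injective hinj)
    obtain ⟨B, M, hBM⟩ := exists_isOrthogonalOrdering_succ hg h1 h3 h'
    have horth' : ∀ k, P.IsOrthogonal (γ' k) (η' (Fin.last n)) := by
      intro k
      have := coroot'_eq_zero_of_mem_rootSpanOf (P := P) (η := η' ∘ Fin.castSucc)
        (γ := η' (Fin.last n)) (fun k => (h1 (Fin.castSucc_lt_last k).ne).1)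
        (g3 ▸ root_mem_rootSpanOf γ' k)
      rw [RootPairing.root_coroot'_eq_pairing] at this
      exact P.isOrthogonal_iff_pairing_eq_zero.2 this
    refine ⟨Fin.snoc γ' (η' (Fin.last n)), ?_, ?_, ?_, B, M, hBM⟩
    · intro j k hjk
      induction j using Fin.lastCases with
      | last =>
        induction k using Fin.lastCases with
        | last => exact absurd rfl hjk
        | cast k => simpa using (horth' k).symm
      | cast j =>
        induction k using Fin.lastCases with
        | last => simpa using horth' j
        | cast k =>
          simp only [Fin.snoc_castSucc]
          exact g1 (fun h => hjk (by rw [h]))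
    · intro k
      induction k using Fin.lastCases with
      | last => simpa using h3.1
      | cast k => simpa using g2 k
    · ext y
      rw [mem_rootSpanOf_succ, mem_rootSpanOf_succ]
      have : (Fin.snoc γ' (η' (Fin.last n)) : Fin (n + 1) → ι) ∘ Fin.castSucc = γ' := by
        ext k; simp
      rw [this, g3]
      simp

end OrthogonalOrdering

section Pairing

variable {ι V N : Type*} [AddCommGroup V] [Module ℝ V] [AddCommGroup N] [Module ℝ N]
  {P : RootPairing ι ℝ V N}

theorem ext_root' [P.IsRootSystem] {x y : N} (h : ∀ α, P.root' α x = P.root' α y) : x = y := by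
  have hinj : Function.Injective P.toLinearMap.flip := P.flip.toPerfPair.injective
  apply hinj
  apply LinearMap.ext_on_range (v := P.root) (IsRootSystem.span_root_eq_top)
  exact h

theorem ext_toLinearMap {y z : V} (h : ∀ x, P.toLinearMap y x = P.toLinearMap z x) : y = z :=
  P.toPerfPair.injective (LinearMap.ext h)

variable [Fintype ι]

theorem corootForm_coact (w : P.weylGroup) (x y : N) :
    P.CorootForm (coact P w x) (coact P w y) = P.CorootForm x y := by
  rw [P.corootForm_apply_apply, P.corootForm_apply_apply,
    ← Equiv.sum_comp (MulAction.toPerm w⁻¹) (fun i => P.root' i x * P.root' i y)]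
  refine Finset.sum_congr rfl fun α _ => ?_
  rw [MulAction.toPerm_apply, root'_smul, root'_smul, inv_inv]

theorem corootForm_comm (x y : N) : P.CorootForm x y = P.CorootForm y x := by
  rw [P.corootForm_apply_apply, P.corootForm_apply_apply]
  exact Finset.sum_congr rfl fun _ _ => mul_comm _ _

variable [P.IsRootSystem]

theorem corootForm_self_pos {x : N} (hx : x ≠ 0) : 0 < P.CorootForm x x := by
  rw [P.corootForm_apply_apply]
  have hnn : ∀ i ∈ (Finset.univ : Finset ι), 0 ≤ P.root' i x * P.root' i x :=
    fun i _ => mul_self_nonneg _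
  refine lt_of_le_of_ne (Finset.sum_nonneg hnn) fun h => hx ?_
  apply ext_root' (P := P)
  intro α
  rw [map_zero]
  exact mul_self_eq_zero.1 ((Finset.sum_eq_zero_iff_of_nonneg hnn).1 h.symm α (Finset.mem_univ α))

theorem eq_zero_of_corootForm_self {x : N} (h : P.CorootForm x x = 0) : x = 0 := by
  by_contra hx
  exact (corootForm_self_pos (P := P) hx).ne' h

end Pairing

section Decomposition

variable {ι V N : Type*} [AddCommGroup V] [Module ℝ V] [AddCommGroup N] [Module ℝ N]
  {P : RootPairing ι ℝ V N} {s s₁ s₂ : P.weylGroup} {n m : ℕ} {η₁ : Fin n → ι} {η₂ : Fin m → ι}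

theorem ofFn_prod_mul_self (horth : Pairwise fun j k => P.IsOrthogonal (η₁ j) (η₁ k)) :
    (List.ofFn fun k => weylGroup.ofIdx P (η₁ k)).prod *
      (List.ofFn fun k => weylGroup.ofIdx P (η₁ k)).prod = 1 := by
  apply weylGroup_ext
  intro y
  have hz : ∑ k, P.coroot' (η₁ k) y • P.root (η₁ k) ∈ rootSpanOf P η₁ :=
    Submodule.sum_mem _ fun k _ => Submodule.smul_mem _ _ (root_mem_rootSpanOf η₁ k)
  rw [mul_smul, ofFn_prod_smul η₁ horth y, smul_sub, ofFn_prod_smul_eq_neg horth hz,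
    ofFn_prod_smul η₁ horth y, one_smul]
  abel

theorem ofFn_prod_smul_eq_neg_iff (horth : Pairwise fun j k => P.IsOrthogonal (η₁ j) (η₁ k))
    {y : V} : (List.ofFn fun k => weylGroup.ofIdx P (η₁ k)).prod • y = -y ↔
      y ∈ rootSpanOf P η₁ := by
  refine ⟨fun h => ?_, ofFn_prod_smul_eq_neg horth⟩
  rw [ofFn_prod_smul η₁ horth y] at h
  have : y = (2⁻¹ : ℝ) • ∑ k, P.coroot' (η₁ k) y • P.root (η₁ k) := by
    rw [sub_eq_iff_eq_add, ← sub_eq_iff_eq_add'] at h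
    rw [← h, sub_neg_eq_add, ← two_smul ℝ y, smul_smul]
    norm_num
  rw [this]
  exact Submodule.smul_mem _ _
    (Submodule.sum_mem _ fun k _ => Submodule.smul_mem _ _ (root_mem_rootSpanOf η₁ k))

theorem IsDecomposition.mul_self₁ (hd : IsDecomposition P s s₁ s₂ η₁ η₂) : s₁ * s₁ = 1 := by
  rw [hd.eq_prod₁]; exact ofFn_prod_mul_self hd.orthogonal₁

theorem IsDecomposition.mul_self₂ (hd : IsDecomposition P s s₁ s₂ η₁ η₂) : s₂ * s₂ = 1 := by
  rw [hd.eq_prod₂]; exact ofFn_prod_mul_self hd.orthogonal₂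

theorem IsDecomposition.inv₁ (hd : IsDecomposition P s s₁ s₂ η₁ η₂)
    : s₁⁻¹ = s₁ := inv_eq_of_mul_eq_one_left hd.mul_self₁

theorem IsDecomposition.inv₂ (hd : IsDecomposition P s s₁ s₂ η₁ η₂)
    : s₂⁻¹ = s₂ := inv_eq_of_mul_eq_one_left hd.mul_self₂

theorem IsDecomposition.inv (hd : IsDecomposition P s s₁ s₂ η₁ η₂) : s⁻¹ = s₂ * s₁ := by
  rw [hd.eq_mul, mul_inv_rev, hd.inv₁, hd.inv₂]

theorem IsDecomposition.smul_eq_neg_iff₁ (hd : IsDecomposition P s s₁ s₂ η₁ η₂)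
    {y : V} : s₁ • y = -y ↔ y ∈ rootSpanOf P η₁ := by
  rw [hd.eq_prod₁]; exact ofFn_prod_smul_eq_neg_iff hd.orthogonal₁

theorem IsDecomposition.smul_eq_neg_iff₂ (hd : IsDecomposition P s s₁ s₂ η₁ η₂)
    {y : V} : s₂ • y = -y ↔ y ∈ rootSpanOf P η₂ := by
  rw [hd.eq_prod₂]; exact ofFn_prod_smul_eq_neg_iff hd.orthogonal₂

theorem IsDecomposition.coact_coact₁ (hd : IsDecomposition P s s₁ s₂ η₁ η₂)
    (x : N) : coact P s₁ (coact P s₁ x) = x := by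
  rw [← coact_mul, hd.mul_self₁, coact_one]

theorem IsDecomposition.coact_coact₂ (hd : IsDecomposition P s s₁ s₂ η₁ η₂)
    (x : N) : coact P s₂ (coact P s₂ x) = x := by
  rw [← coact_mul, hd.mul_self₂, coact_one]

theorem IsDecomposition.coact_eq (hd : IsDecomposition P s s₁ s₂ η₁ η₂)
    (x : N) : coact P s x = coact P s₁ (coact P s₂ x) := by
  rw [hd.eq_mul, coact_mul]

theorem IsDecomposition.smul_eq (hd : IsDecomposition P s s₁ s₂ η₁ η₂)
    (y : V) : s • y = s₁ • s₂ • y := by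
  rw [hd.eq_mul, mul_smul]

variable [Fintype ι] [P.IsRootSystem]

theorem IsDecomposition.coact_eq_self₁ (hd : IsDecomposition P s s₁ s₂ η₁ η₂)
    {x : N} (hx : coact P s x = x) : coact P s₁ x = x := by
  apply ext_root' (P := P)
  intro α
  rw [← hd.inv₁, ← root'_smul]
  simp only [RootPairing.root', root_smul, hd.eq_prod₁]
  rw [ofFn_prod_smul η₁ hd.orthogonal₁, map_sub, LinearMap.sub_apply, map_sum,
    LinearMap.sum_apply, Finset.sum_eq_zero, sub_zero]
  intro k _
  rw [map_smul, LinearMap.smul_apply,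
    (hd.mem_span_iff (P.root (η₁ k))).1 (Submodule.subset_span ⟨Sum.inl k, rfl⟩) x hx, smul_zero]

theorem IsDecomposition.coact_eq_self₂ (hd : IsDecomposition P s s₁ s₂ η₁ η₂)
    {x : N} (hx : coact P s x = x) : coact P s₂ x = x := by
  have h := hd.coact_eq x
  rw [hx, ← hd.coact_eq_self₁ hx, hd.coact_eq_self₁ hx] at h
  have h' := congrArg (coact P s₁) h
  rwa [hd.coact_coact₁, hd.coact_eq_self₁ hx, eq_comm] at h'

end Decomposition

section Fixed

variable {ι V N : Type*} [Fintype ι] [AddCommGroup V] [Module ℝ V] [AddCommGroup N] [Module ℝ N]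
  {P : RootPairing ι ℝ V N}

/-- An involution fixes a vector that is annihilated only by those roots that it negates. -/
theorem exists_generic_fixed {w : P.weylGroup} (hw : w * w = 1) :
    ∃ e : N, coact P w e = e ∧ ∀ α, P.root' α e = 0 → w • P.root α = -P.root α := by
  let F : Submodule ℝ N := LinearMap.ker (coactLin w - LinearMap.id)
  have hF : ∀ x, x ∈ F ↔ coact P w x = x := fun x => by
    rw [LinearMap.mem_ker, LinearMap.sub_apply, sub_eq_zero]; rfl
  obtain ⟨e, heF, he⟩ := Module.Dual.exists_forall_mem_ne_zero_of_forall_exists F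
    (fun α : {α : ι // ∃ x ∈ F, P.root' α x ≠ 0} => P.root' α.1) (fun α => α.2)
  refine ⟨e, (hF e).1 heF, fun α hα => ?_⟩
  have hall : ∀ x ∈ F, P.root' α x = 0 := by
    by_contra! h
    exact he ⟨α, h⟩ hα
  have hinv : w⁻¹ = w := inv_eq_of_mul_eq_one_left hw
  refine eq_neg_of_add_eq_zero_left (ext_toLinearMap (P := P) fun x => ?_)
  have := hall (coact P w x + x) (by
    rw [hF, coact_add, ← coact_mul, hw, coact_one, add_comm])
  rw [map_zero, LinearMap.zero_apply, map_add, LinearMap.add_apply]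
  rw [map_add, RootPairing.root', pairing_coact, hinv] at this
  exact this

end Fixed

section Layers

variable {ι V N : Type*} [Fintype ι] [AddCommGroup V] [Module ℝ V] [AddCommGroup N] [Module ℝ N]
  {P : RootPairing ι ℝ V N} {s s₁ s₂ : P.weylGroup}
  (c : Choice P s s₁ s₂)

namespace Choice

/-- The functional on `V` given by `hbar`. -/
noncomputable def height : V →ₗ[ℝ] ℝ := P.toLinearMap.flip c.hbar

theorem pos_eq : c.pos = posOf P c.height := rfl

theorem root'_eq_zero {α : ι} {k j : Fin (c.K + 1)} (hα : α ∈ layer P c.h k) (hkj : k < j) {x : N}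
    (hx : x ∈ c.U j) : P.root' α x = 0 := by
  by_contra h
  exact c.h_generic j α ⟨x, hx, h⟩ (hα.1 j hkj)

theorem layer_unique {α : ι} {k j : Fin (c.K + 1)} (hk : α ∈ layer P c.h k)
    (hj : α ∈ layer P c.h j) : k = j := by
  rcases lt_trichotomy k j with h | h | h
  · exact absurd (hk.1 j h) hj.2
  · exact h
  · exact absurd (hj.1 k h) hk.2

theorem exists_layer (α : ι) : ∃ k, α ∈ layer P c.h k := by
  classical
  have hne : (Finset.univ.filter fun j => P.root' α (c.h j) ≠ 0).Nonempty := by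
    by_contra hcon
    rw [Finset.not_nonempty_iff_eq_empty, Finset.filter_eq_empty_iff] at hcon
    have hker : ⨆ i, c.U i ≤ LinearMap.ker (P.root' α) := by
      refine iSup_le fun i x hx => ?_
      by_contra h
      exact hcon (Finset.mem_univ i) (c.h_generic i α ⟨x, hx, h⟩)
    rw [c.isInternal.submodule_iSup_eq_top] at hker
    have : P.root' α (P.coroot α) = 0 := hker Submodule.mem_top
    rw [RootPairing.root'_coroot_eq_pairing, P.pairing_same] at this
    norm_num at this
  refine ⟨Finset.max' _ hne, fun j hj => ?_, (Finset.mem_filter.1 (Finset.max'_mem _ hne)).2⟩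
  by_contra h
  exact absurd (Finset.le_max' _ j (Finset.mem_filter.2 ⟨Finset.mem_univ j, h⟩)) (not_le.2 hj)

theorem root'_hbar {α : ι} {k : Fin (c.K + 1)} (hα : α ∈ layer P c.h k) :
    (0 < P.root' α c.hbar ↔ 0 < P.root' α (c.h k)) ∧ P.root' α c.hbar ≠ 0 := by
  classical
  have hsum : P.root' α c.hbar = P.root' α (c.h k) +
      ∑ j with 0 ≤ j ∧ j < k ∧ (layer P c.h j).Nonempty, P.root' α (c.h j) := by
    have hmem : k ∈ Finset.univ.filter fun i => (layer P c.h i).Nonempty :=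
      Finset.mem_filter.2 ⟨Finset.mem_univ k, ⟨α, hα⟩⟩
    have h1 : P.root' α c.hbar = ∑ i with (layer P c.h i).Nonempty, P.root' α (c.h i) := by
      rw [Choice.hbar, map_sum]
    rw [h1, ← Finset.add_sum_erase _ _ hmem]
    congr 1
    symm
    apply Finset.sum_subset
    · intro j hj
      rw [Finset.mem_filter] at hj
      exact Finset.mem_erase.2 ⟨hj.2.2.1.ne, Finset.mem_filter.2 ⟨hj.1, hj.2.2.2⟩⟩
    · intro j hj hj'
      rw [Finset.mem_erase, Finset.mem_filter] at hj
      rw [Finset.mem_filter] at hj'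
      have : k < j := by
        by_contra h
        exact hj' ⟨hj.2.1, Fin.zero_le j, lt_of_le_of_ne (not_lt.1 h) hj.1, hj.2.2⟩
      exact hα.1 j this
  have hdom : |∑ j with 0 ≤ j ∧ j < k ∧ (layer P c.h j).Nonempty, P.root' α (c.h j)| <
      |P.root' α (c.h k)| := by
    by_cases hk : k = 0
    · rw [Finset.sum_eq_zero, abs_zero]
      · exact abs_pos.2 hα.2
      · intro j hj
        rw [Finset.mem_filter, hk] at hj
        exact absurd hj.2.2.1 (Fin.not_lt_zero j)
    · convert c.dominant k 0 (Fin.pos_of_ne_zero hk) α hα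
  rw [hsum]
  set r := ∑ j with 0 ≤ j ∧ j < k ∧ (layer P c.h j).Nonempty, P.root' α (c.h j)
  have hα0 := hα.2
  rcases lt_or_gt_of_ne hα0 with h | h
  · rw [abs_of_neg h, abs_lt] at hdom
    exact ⟨⟨fun _ => by linarith [hdom.2], fun _ => by linarith⟩, by linarith [hdom.2]⟩
  · rw [abs_of_pos h, abs_lt] at hdom
    exact ⟨⟨fun _ => h, fun _ => by linarith [hdom.1]⟩, by linarith [hdom.1]⟩

theorem height_ne_zero (α : ι) : c.height (P.root α) ≠ 0 := by
  obtain ⟨k, hk⟩ := c.exists_layer α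
  exact (c.root'_hbar hk).2

theorem mem_pos_iff_of_mem_layer {α : ι} {k : Fin (c.K + 1)} (hα : α ∈ layer P c.h k) :
    α ∈ c.pos ↔ 0 < P.root' α (c.h k) := (c.root'_hbar hα).1

theorem smul_mem_layer {w : P.weylGroup} (hw : ∀ i, ∀ x ∈ c.U i, coact P w x ∈ c.U i)
    (hw' : ∀ i, ∀ x ∈ c.U i, coact P w⁻¹ x ∈ c.U i) {α : ι} {k : Fin (c.K + 1)}
    (hα : α ∈ layer P c.h k) : w • α ∈ layer P c.h k := by
  refine ⟨fun j hj => ?_, c.h_generic k _ ⟨coact P w (c.h k), hw k _ (c.h_mem k), ?_⟩⟩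
  · rw [root'_smul]
    exact c.root'_eq_zero hα hj (hw' j _ (c.h_mem j))
  · rw [root'_smul, coact_inv_coact]
    exact hα.2

theorem mem_inversions_iff_of_mem_layer {w : P.weylGroup}
    (hw : ∀ i, ∀ x ∈ c.U i, coact P w x ∈ c.U i)
    (hw' : ∀ i, ∀ x ∈ c.U i, coact P w⁻¹ x ∈ c.U i) {α : ι} {k : Fin (c.K + 1)}
    (hα : α ∈ layer P c.h k) (hpos : α ∈ c.pos) :
    α ∈ inversions P c.pos w ↔ P.root' α (coact P w⁻¹ (c.h k)) < 0 := by
  have hwα := c.smul_mem_layer hw hw' hα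
  rw [c.pos_eq, mem_inversions_iff, ← root'_smul, ← root_smul]
  have h1 := c.mem_pos_iff_of_mem_layer hwα
  have h2 := c.height_ne_zero (w • α)
  have h3 : 0 < c.height (P.root (w • α)) ↔ 0 < P.root' (w • α) (c.h k) := h1
  constructor
  · rintro ⟨-, h⟩
    by_contra h4
    have h5 := lt_of_le_of_ne (not_lt.1 h4) hwα.2.symm
    exact lt_asymm h (h3.2 h5)
  · intro h
    refine ⟨hpos, ?_⟩
    by_contra h4
    have h5 := lt_of_le_of_ne (not_lt.1 h4) h2.symm
    exact lt_asymm h (h3.1 h5)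

end Choice

end Layers

section Real

/-- The order automorphism of `ℝ` that is the identity up to `c` and has slope `r` from there. -/
theorem exists_orderIso_kink (c : ℝ) {r : ℝ} (hr : 0 < r) :
    ∃ ψ : ℝ ≃o ℝ, (∀ x ≤ c, ψ x = x) ∧ ∀ x, c < x → ψ x = c + r * (x - c) := by
  let f : ℝ → ℝ := fun x => if x ≤ c then x else c + r * (x - c)
  have h1 : ∀ x ≤ c, f x = x := fun x hx => if_pos hx
  have h2 : ∀ x, c < x → f x = c + r * (x - c) := fun x hx => if_neg (not_le.2 hx)
  have hmono : StrictMono f := by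
    intro x y hxy
    rcases le_or_gt y c with hy | hy
    · rw [h1 x (hxy.le.trans hy), h1 y hy]; exact hxy
    · rw [h2 y hy]
      rcases le_or_gt x c with hx | hx
      · rw [h1 x hx]; nlinarith [mul_pos hr (sub_pos.2 hy)]
      · rw [h2 x hx]; nlinarith
  have hsurj : Function.Surjective f := by
    intro y
    rcases le_or_gt y c with hy | hy
    · exact ⟨y, h1 y hy⟩
    · have : 0 < (y - c) / r := div_pos (sub_pos.2 hy) hr
      refine ⟨c + (y - c) / r, ?_⟩
      rw [h2 _ (by linarith)]
      field_simp
      ring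
  exact ⟨hmono.orderIsoOfSurjective f hsurj, h1, h2⟩

/-- Any finite increasing sequence is taken to `1, 2, …` by an order automorphism of `ℝ`. -/
theorem exists_orderIso_eq_natCast (a : ℕ → ℝ) (n : ℕ) (ha : ∀ i < n, a i < a (i + 1)) :
    ∃ ψ : ℝ ≃o ℝ, ∀ i ≤ n, ψ (a i) = i + 1 := by
  induction n with
  | zero =>
    refine ⟨OrderIso.addRight (1 - a 0), fun i hi => ?_⟩
    rw [Nat.le_zero.1 hi]
    simp
  | succ n ih =>
    obtain ⟨ψ, hψ⟩ := ih fun i hi => ha i (by omega)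
    have hlt : (n : ℝ) + 1 < ψ (a (n + 1)) := by
      rw [← hψ n le_rfl]
      exact ψ.lt_iff_lt.2 (ha n (by omega))
    have hpos : 0 < ψ (a (n + 1)) - (n + 1) := by linarith
    obtain ⟨φ, h1, h2⟩ := exists_orderIso_kink (n + 1) (inv_pos.2 hpos)
    refine ⟨ψ.trans φ, fun i hi => ?_⟩
    rw [OrderIso.trans_apply]
    rcases Nat.lt_or_ge i (n + 1) with h | h
    · rw [hψ i (by omega), h1]
      have : (i : ℝ) ≤ n := by exact_mod_cast (by omega : i ≤ n)
      linarith
    · obtain rfl : i = n + 1 := by omega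
      rw [h2 _ hlt, inv_mul_cancel₀ hpos.ne']
      push_cast
      ring

theorem exists_orderIso_six {a₁ a₂ a₃ a₄ a₅ a₆ : ℝ} (h₁ : a₁ < a₂) (h₂ : a₂ < a₃) (h₃ : a₃ < a₄)
    (h₄ : a₄ < a₅) (h₅ : a₅ < a₆) :
    ∃ ψ : ℝ ≃o ℝ, ψ a₁ = 1 ∧ ψ a₂ = 2 ∧ ψ a₃ = 3 ∧ ψ a₄ = 4 ∧ ψ a₅ = 5 ∧ ψ a₆ = 6 := by
  let a : ℕ → ℝ := fun i => [a₁, a₂, a₃, a₄, a₅].getD i a₆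
  obtain ⟨ψ, hψ⟩ := exists_orderIso_eq_natCast a 5 (by
    intro i hi
    interval_cases i <;> simpa [a])
  refine ⟨ψ, ?_, ?_, ?_, ?_, ?_, ?_⟩
  · simpa [a] using hψ 0 (by norm_num)
  · have := hψ 1 (by norm_num); norm_num [a] at this; exact this
  · have := hψ 2 (by norm_num); norm_num [a] at this; exact this
  · have := hψ 3 (by norm_num); norm_num [a] at this; exact this
  · have := hψ 4 (by norm_num); norm_num [a] at this; exact this
  · have := hψ 5 (by norm_num); norm_num [a] at this; exact this

end Real

section Geometry

variable {ι V N : Type*} [Fintype ι] [AddCommGroup V] [Module ℝ V] [AddCommGroup N] [Module ℝ N]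
  {P : RootPairing ι ℝ V N} {s s₁ s₂ : P.weylGroup}

/-- A rotation by an angle strictly between `0` and `π` is not an involution. -/
theorem false_of_rotation_of_involutive [P.IsRootSystem] {U : Submodule ℝ N} {θ : ℝ}
    (h0 : 0 < θ) (hπ : θ < Real.pi)
    (hU : ∀ x ∈ U, coact P s x ∈ U)
    (hrot : ∀ x ∈ U, P.CorootForm (coact P s x) x = Real.cos θ * P.CorootForm x x)
    (hinv : ∀ x ∈ U, coact P s (coact P s x) = x) {x : N} (hx : x ∈ U) (hx0 : x ≠ 0) : False := by
  have hlt : Real.cos θ < 1 := by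
    have := Real.cos_lt_cos_of_nonneg_of_le_pi le_rfl hπ.le h0
    rwa [Real.cos_zero] at this
  have hgt : -1 < Real.cos θ := by
    have := Real.cos_lt_cos_of_nonneg_of_le_pi h0.le le_rfl hπ
    rwa [Real.cos_pi] at this
  have hy := hrot (x + coact P s x) (U.add_mem hx (hU x hx))
  rw [coact_add, hinv x hx, add_comm (coact P s x) x] at hy
  have hy0 : x + coact P s x = 0 := by
    apply eq_zero_of_corootForm_self (P := P)
    have : (1 - Real.cos θ) * P.CorootForm (x + coact P s x) (x + coact P s x) = 0 := by linarith
    exact (mul_eq_zero.1 this).resolve_left (by linarith)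
  have hx' := hrot x hx
  rw [(eq_neg_of_add_eq_zero_right hy0), map_neg, LinearMap.neg_apply] at hx'
  have hp := corootForm_self_pos (P := P) hx0
  nlinarith

variable (c : Choice P s s₁ s₂) {n m : ℕ} {η₁ : Fin n → ι} {η₂ : Fin m → ι}

namespace Choice

theorem coact_eq_on_line (hd : IsDecomposition P s s₁ s₂ η₁ η₂)
    {i : Fin (c.K + 1)} (hi : i ≠ 0) (hne : (layer P c.h i).Nonempty)
    (hrank : Module.finrank ℝ (c.U i) = 1) {x : N} (hx : x ∈ c.U i) :
    coact P s₁ x = x ∧ coact P s₂ x = -x := by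
  have hneg : ∀ x ∈ c.U i, coact P s x = -x := by
    rcases c.rotation_or_neg i hi with h | h
    · rw [h.1] at hrank; norm_num at hrank
    · exact h.2
  obtain ⟨v, hv0, hv⟩ := finrank_eq_one_iff'.1 hrank
  obtain ⟨a, ha⟩ := hv ⟨_, c.invariant₁ i v v.2⟩
  have hav : coact P s₁ (v : N) = a • (v : N) := (congrArg Subtype.val ha).symm
  have hv0' : (v : N) ≠ 0 := fun h => hv0 (Subtype.ext h)
  have hall : ∀ x ∈ c.U i, coact P s₁ x = a • x := by
    intro x hx
    obtain ⟨t, ht⟩ := hv ⟨x, hx⟩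
    have : x = t • (v : N) := (congrArg Subtype.val ht).symm
    rw [this, coact_smul, hav, smul_comm]
  have hsq : (a * a) = 1 := by
    have h := hd.coact_coact₁ (v : N)
    rw [hav, coact_smul, hav, smul_smul] at h
    have : (a * a - 1) • (v : N) = 0 := by rw [sub_smul, h, one_smul, sub_self]
    exact sub_eq_zero.1 ((smul_eq_zero.1 this).resolve_right hv0')
  have ha1 : a = 1 := by
    rcases mul_self_eq_one_iff.1 hsq with h | h
    · exact h
    · exfalso
      refine c.no_neg_line i hi hne hrank fun x hx => ?_
      rw [hall x hx, h, neg_one_smul]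
  have h1 : ∀ x ∈ c.U i, coact P s₁ x = x := fun x hx => by rw [hall x hx, ha1, one_smul]
  refine ⟨h1 x hx, ?_⟩
  have h := hd.coact_eq x
  rw [h1 _ (c.invariant₂ i x hx), hneg x hx] at h
  exact h.symm

/-- In a plane that carries roots of its layer, `s₁` and `s₂` are reflections, written here in the
basis of their unit normals. -/
theorem exists_plane_data (hd : IsDecomposition P s s₁ s₂ η₁ η₂)
    [P.IsRootSystem] {i : Fin (c.K + 1)} (hi : i ≠ 0) (hne : (layer P c.h i).Nonempty)
    (hrank : Module.finrank ℝ (c.U i) = 2) :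
    ∃ v₁ ∈ c.U i, ∃ v₂ ∈ c.U i, ∃ ρ a b : ℝ, 0 < ρ ∧ ρ < 1 ∧ 0 < a ∧ 0 < b ∧
      0 < a - ρ * b ∧ 0 < b - ρ * a ∧ c.h i = a • v₁ + b • v₂ ∧
      coact P s₁ v₁ = -v₁ ∧ coact P s₂ v₂ = -v₂ ∧
      coact P s₁ v₂ = v₂ + (2 * ρ) • v₁ ∧ coact P s₂ v₁ = v₁ + (2 * ρ) • v₂ := by
  obtain ⟨θ, hθ0, hθπ, hrot⟩ : ∃ θ : ℝ, 0 < θ ∧ θ < Real.pi ∧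
      ∀ x ∈ c.U i, P.CorootForm (coact P s x) x = Real.cos θ * P.CorootForm x x := by
    rcases c.rotation_or_neg i hi with h | h
    · exact h.2
    · rw [h.1] at hrank; norm_num at hrank
  obtain ⟨w₁, hw₁, w₂, hw₂, hs₁, hs₂, hp₁, hp₂, hobt⟩ := c.obtuse i hi hne hrank
  have hunit : ∀ w : N, w ≠ 0 → ∃ t : ℝ, 0 < t ∧ P.CorootForm (t • w) (t • w) = 1 := by
    intro w hw
    have hpos := corootForm_self_pos (P := P) hw
    refine ⟨(Real.sqrt (P.CorootForm w w))⁻¹, inv_pos.2 (Real.sqrt_pos.2 hpos), ?_⟩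
    simp only [map_smul, LinearMap.smul_apply, smul_eq_mul]
    rw [← mul_assoc, ← mul_inv, Real.mul_self_sqrt hpos.le, inv_mul_cancel₀ hpos.ne']
  have hw₁0 : w₁ ≠ 0 := by rintro rfl; simp at hp₁
  have hw₂0 : w₂ ≠ 0 := by rintro rfl; simp at hp₂
  obtain ⟨t₁, ht₁, hu₁⟩ := hunit w₁ hw₁0
  obtain ⟨t₂, ht₂, hu₂⟩ := hunit w₂ hw₂0
  have hv₁ : t₁ • w₁ ∈ c.U i := (c.U i).smul_mem _ hw₁
  have hv₂ : t₂ • w₂ ∈ c.U i := (c.U i).smul_mem _ hw₂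
  replace hs₁ : coact P s₁ (t₁ • w₁) = -(t₁ • w₁) := by rw [coact_smul, hs₁, smul_neg]
  replace hs₂ : coact P s₂ (t₂ • w₂) = -(t₂ • w₂) := by rw [coact_smul, hs₂, smul_neg]
  replace hp₁ : 0 < P.CorootForm (c.h i) (t₁ • w₁) := by
    rw [map_smul, smul_eq_mul]; positivity
  replace hp₂ : 0 < P.CorootForm (c.h i) (t₂ • w₂) := by
    rw [map_smul, smul_eq_mul]; positivity
  replace hobt : P.CorootForm (t₁ • w₁) (t₂ • w₂) < 0 := by
    simp only [map_smul, LinearMap.smul_apply, smul_eq_mul]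
    nlinarith [mul_pos ht₁ ht₂]
  generalize t₁ • w₁ = v₁ at *
  generalize t₂ • w₂ = v₂ at *
  obtain ⟨ρ, hρ⟩ : ∃ ρ, P.CorootForm v₁ v₂ = -ρ := ⟨_, (neg_neg _).symm⟩
  have hρ' : P.CorootForm v₂ v₁ = -ρ := by rw [corootForm_comm, hρ]
  have hρ0 : 0 < ρ := by linarith
  have hform : ∀ a b a' b' : ℝ, P.CorootForm (a • v₁ + b • v₂) (a' • v₁ + b' • v₂) =
      a * a' + b * b' - ρ * (a * b' + b * a') := by
    intro a b a' b'
    simp only [map_add, map_smul, LinearMap.add_apply, LinearMap.smul_apply, smul_eq_mul, hu₁, hu₂,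
      hρ, hρ']
    ring
  have hρ1 : ρ < 1 := by
    have hne0 : ρ • v₁ + (1 : ℝ) • v₂ ≠ 0 := by
      intro h0
      have := congrArg (P.CorootForm (c.h i)) h0
      simp only [map_add, map_smul, smul_eq_mul, map_zero, one_mul] at this
      nlinarith [mul_pos hρ0 hp₁]
    have := corootForm_self_pos (P := P) hne0
    rw [hform] at this
    nlinarith
  have hli : LinearIndependent ℝ ![(⟨v₁, hv₁⟩ : c.U i), ⟨v₂, hv₂⟩] := by
    rw [LinearIndependent.pair_iff]
    intro a b hab
    have h0 : a • v₁ + b • v₂ = 0 := congrArg Subtype.val hab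
    have h1 := hform a b a b
    rw [h0] at h1
    simp only [map_zero] at h1
    have h2 : (a - ρ * b) ^ 2 + (1 - ρ ^ 2) * b ^ 2 = 0 := by
      linear_combination -h1
    have h3 : 0 < 1 - ρ ^ 2 := by nlinarith
    have hb : b = 0 := by
      by_contra hb
      have : 0 < b ^ 2 := by positivity
      nlinarith [sq_nonneg (a - ρ * b)]
    subst hb
    refine ⟨?_, rfl⟩
    simpa using h2
  have hspan : ∀ x ∈ c.U i, ∃ a b : ℝ, x = a • v₁ + b • v₂ := by
    intro x hx
    have htop := hli.span_eq_top_of_card_eq_finrank (by simp [hrank])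
    have : (⟨x, hx⟩ : c.U i) ∈ Submodule.span ℝ (Set.range ![(⟨v₁, hv₁⟩ : c.U i), ⟨v₂, hv₂⟩]) := by
      rw [htop]; exact Submodule.mem_top
    rw [Matrix.range_cons, Matrix.range_cons, Matrix.range_empty, Set.union_empty,
      Set.singleton_union, Submodule.mem_span_pair] at this
    obtain ⟨a, b, hab⟩ := this
    exact ⟨a, b, (congrArg Subtype.val hab).symm⟩
  have hli' : ∀ a b : ℝ, a • v₁ + b • v₂ = 0 → a = 0 ∧ b = 0 := fun a b hab =>
    (LinearIndependent.pair_iff.1 hli) a b (Subtype.ext hab)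
  have hv₁0 : v₁ ≠ 0 := by
    rintro rfl
    simp at hu₁
  obtain ⟨a, b, hab⟩ := hspan _ (c.h_mem i)
  have ha : 0 < a - ρ * b := by
    have := hform a b 1 0
    rw [← hab, one_smul, zero_smul, add_zero] at this
    rw [this] at hp₁
    linarith
  have hb : 0 < b - ρ * a := by
    have := hform a b 0 1
    rw [← hab, one_smul, zero_smul, zero_add] at this
    rw [this] at hp₂
    linarith
  have hρ2 : 0 ≤ 1 - ρ ^ 2 := by nlinarith
  have ha0 : 0 < a := pos_of_mul_pos_left (b := 1 - ρ ^ 2) (by nlinarith [mul_pos hρ0 hb]) hρ2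
  have hb0 : 0 < b := pos_of_mul_pos_left (b := 1 - ρ ^ 2) (by nlinarith [mul_pos hρ0 ha]) hρ2
  refine ⟨v₁, hv₁, v₂, hv₂, ρ, a, b, hρ0, hρ1, ha0, hb0, ha, hb, hab, hs₁, hs₂, ?_, ?_⟩
  · obtain ⟨p, q, hpq⟩ := hspan _ (c.invariant₁ i v₂ hv₂)
    have h1 := corootForm_coact s₁ v₁ v₂
    rw [hs₁, hpq, hρ] at h1
    have h2 := hform (-1) 0 p q
    rw [zero_smul, add_zero, neg_one_smul, h1] at h2
    have h3 := hd.coact_coact₁ v₂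
    rw [hpq, coact_add, coact_smul, coact_smul, hs₁, hpq] at h3
    have h4 := hli' (q * p - p) (q * q - 1) (by
      have h5 := sub_eq_zero.2 h3
      rw [← h5]
      module)
    rcases mul_self_eq_one_iff.1 (sub_eq_zero.1 h4.2) with hq | hq
    · rw [hpq, hq]
      have : p = 2 * ρ := by rw [hq] at h2; linarith
      rw [this, one_smul, add_comm]
    · exfalso
      have hp : p = 0 := by rw [hq] at h2; linarith
      have hneg : ∀ x ∈ c.U i, coact P s₁ x = -x := by
        intro x hx
        obtain ⟨a, b, rfl⟩ := hspan x hx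
        rw [coact_add, coact_smul, coact_smul, hs₁, hpq, hp, hq]
        module
      refine false_of_rotation_of_involutive hθ0 hθπ (c.invariant i) hrot (fun x hx => ?_) hv₁ hv₁0
      rw [hd.coact_eq, hd.coact_eq, hneg _ (c.invariant₂ i x hx), coact_neg,
        hd.coact_coact₂, hneg _ ((c.U i).neg_mem hx), neg_neg]
  · obtain ⟨p, q, hpq⟩ := hspan _ (c.invariant₂ i v₁ hv₁)
    have h1 := corootForm_coact s₂ v₂ v₁
    rw [hs₂, hpq, hρ'] at h1
    have h2 := hform 0 (-1) p q
    rw [zero_smul, zero_add, neg_one_smul, h1] at h2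
    have h3 := hd.coact_coact₂ v₁
    rw [hpq, coact_add, coact_smul, coact_smul, hs₂, hpq] at h3
    have h4 := hli' (p * p - 1) (p * q - q) (by
      have h5 := sub_eq_zero.2 h3
      rw [← h5]
      module)
    rcases mul_self_eq_one_iff.1 (sub_eq_zero.1 h4.1) with hq | hq
    · rw [hpq, hq]
      have : q = 2 * ρ := by rw [hq] at h2; linarith
      rw [this, one_smul]
    · exfalso
      have hp : q = 0 := by rw [hq] at h2; linarith
      have hneg : ∀ x ∈ c.U i, coact P s₂ x = -x := by
        intro x hx
        obtain ⟨a, b, rfl⟩ := hspan x hx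
        rw [coact_add, coact_smul, coact_smul, hs₂, hpq, hp, hq]
        module
      refine false_of_rotation_of_involutive hθ0 hθπ (c.invariant i) hrot (fun x hx => ?_) hv₁ hv₁0
      rw [hd.coact_eq x, hneg _ hx, hd.coact_eq, coact_neg, coact_neg,
        hneg _ (c.invariant₁ i x hx), neg_neg, hd.coact_coact₁]

end Choice

end Geometry

section LayerKey

variable {ι V N : Type*} [Fintype ι] [AddCommGroup V] [Module ℝ V] [AddCommGroup N] [Module ℝ N]
  {P : RootPairing ι ℝ V N} {s s₁ s₂ : P.weylGroup}
  (c : Choice P s s₁ s₂)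

/-- The slope `α(u) / α(h_k)` of a root in the `k`-th layer. -/
noncomputable def Choice.slope (k : Fin (c.K + 1)) (u : N) (α : ι) : ℝ :=
  P.root' α u / P.root' α (c.h k)

/-- `ψ` rescales the slopes with respect to `u` in the `k`-th layer in such a way that the values
`1` and `5` single out the roots negated by `s₁` and `s₂`, and the inversions of `s₁`, `s`, `s₂` are
cut off at `2`, `3`, `4`. -/
structure IsLayerKey (k : Fin (c.K + 1)) (u : N) (ψ : ℝ ≃o ℝ) : Prop where
  mem : u ∈ c.U k
  fixed₁ : coact P s₁ (u - ψ.symm 1 • c.h k) = u - ψ.symm 1 • c.h k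
  fixed₂ : coact P s₂ (u - ψ.symm 5 • c.h k) = u - ψ.symm 5 • c.h k
  inv₁ : ∀ α ∈ layer P c.h k, α ∈ c.pos →
    (α ∈ inversions P c.pos s₁ ↔ ψ (c.slope k u α) < 2)
  inv₂ : ∀ α ∈ layer P c.h k, α ∈ c.pos →
    (α ∈ inversions P c.pos s₂ ↔ 4 < ψ (c.slope k u α) ∧ ψ (c.slope k u α) < 6)
  inv : Disjoint (inversions P c.pos s₁) ((s₂ • ·) '' inversions P c.pos s₁) →
    ∀ α ∈ layer P c.h k, α ∈ c.pos →
    (α ∈ inversions P c.pos s ↔ 3 < ψ (c.slope k u α) ∧ ψ (c.slope k u α) < 6)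
  lt_six : k ≠ 0 → ∀ α ∈ layer P c.h k, α ∈ c.pos → ψ (c.slope k u α) < 6
  eq_seven : k = 0 → ∀ α ∈ layer P c.h k, ψ (c.slope k u α) = 7
  lt_smul : k ≠ 0 → ∀ α ∈ layer P c.h k, α ∈ c.pos → s • α ∈ c.pos →
    ψ (c.slope k u α) < ψ (c.slope k u (s • α))

variable {c}

theorem Choice.slope_smul {k : Fin (c.K + 1)} {α : ι} (hα : α ∈ layer P c.h k) (t : ℝ) :
    c.slope k (t • c.h k) α = t := by
  rw [Choice.slope, map_smul, smul_eq_mul, mul_div_cancel_right₀ _ hα.2]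

section

variable {n m : ℕ} {η₁ : Fin n → ι} {η₂ : Fin m → ι}

namespace Choice

theorem invariant_inv₁ (hd : IsDecomposition P s s₁ s₂ η₁ η₂)
    (i : Fin (c.K + 1)) (x : N) (hx : x ∈ c.U i) : coact P s₁⁻¹ x ∈ c.U i := by
  rw [hd.inv₁]; exact c.invariant₁ i x hx

theorem invariant_inv₂ (hd : IsDecomposition P s s₁ s₂ η₁ η₂)
    (i : Fin (c.K + 1)) (x : N) (hx : x ∈ c.U i) : coact P s₂⁻¹ x ∈ c.U i := by
  rw [hd.inv₂]; exact c.invariant₂ i x hx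

theorem invariant_inv (hd : IsDecomposition P s s₁ s₂ η₁ η₂)
    (i : Fin (c.K + 1)) (x : N) (hx : x ∈ c.U i) : coact P s⁻¹ x ∈ c.U i := by
  rw [hd.inv, coact_mul]
  exact c.invariant₂ i _ (c.invariant₁ i x hx)

theorem mem_inversions₁ (hd : IsDecomposition P s s₁ s₂ η₁ η₂)
    {k : Fin (c.K + 1)} {α : ι} (hα : α ∈ layer P c.h k) (hpos : α ∈ c.pos) :
    α ∈ inversions P c.pos s₁ ↔ P.root' α (coact P s₁ (c.h k)) < 0 := by
  rw [c.mem_inversions_iff_of_mem_layer c.invariant₁ (invariant_inv₁ hd) hα hpos, hd.inv₁]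

theorem mem_inversions₂ (hd : IsDecomposition P s s₁ s₂ η₁ η₂)
    {k : Fin (c.K + 1)} {α : ι} (hα : α ∈ layer P c.h k) (hpos : α ∈ c.pos) :
    α ∈ inversions P c.pos s₂ ↔ P.root' α (coact P s₂ (c.h k)) < 0 := by
  rw [c.mem_inversions_iff_of_mem_layer c.invariant₂ (invariant_inv₂ hd) hα hpos, hd.inv₂]

theorem mem_inversions (hd : IsDecomposition P s s₁ s₂ η₁ η₂)
    {k : Fin (c.K + 1)} {α : ι} (hα : α ∈ layer P c.h k) (hpos : α ∈ c.pos) :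
    α ∈ inversions P c.pos s ↔ P.root' α (coact P s₂ (coact P s₁ (c.h k))) < 0 := by
  rw [c.mem_inversions_iff_of_mem_layer c.invariant (invariant_inv hd) hα hpos, hd.inv, coact_mul]

theorem smul_mem_layer_self (hd : IsDecomposition P s s₁ s₂ η₁ η₂)
    {k : Fin (c.K + 1)} {α : ι} (hα : α ∈ layer P c.h k) :
    s • α ∈ layer P c.h k :=
  c.smul_mem_layer c.invariant (invariant_inv hd) hα

end Choice

theorem isLayerKey_zero (hd : IsDecomposition P s s₁ s₂ η₁ η₂) [P.IsRootSystem] :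
    IsLayerKey c 0 ((7 : ℝ) • c.h 0) (OrderIso.refl ℝ) := by
  have h1 : ∀ x ∈ c.U 0, coact P s₁ x = x := fun x hx => hd.coact_eq_self₁ ((c.mem_zero_iff x).1 hx)
  have h2 : ∀ x ∈ c.U 0, coact P s₂ x = x := fun x hx => hd.coact_eq_self₂ ((c.mem_zero_iff x).1 hx)
  have hm := c.h_mem 0
  have hmul : ∀ t : ℝ, (7 : ℝ) • c.h 0 - t • c.h 0 ∈ c.U 0 := fun t =>
    (c.U 0).sub_mem ((c.U 0).smul_mem _ hm) ((c.U 0).smul_mem _ hm)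
  refine ⟨(c.U 0).smul_mem _ hm, h1 _ (hmul _), h2 _ (hmul _), ?_, ?_, ?_, fun h => absurd rfl h,
    fun _ α hα => c.slope_smul hα _, fun h => absurd rfl h⟩
  · intro α hα hpos
    rw [Choice.mem_inversions₁ hd hα hpos, h1 _ hm, c.slope_smul hα]
    have := (c.mem_pos_iff_of_mem_layer hα).1 hpos
    exact ⟨fun h => by linarith, fun h => by norm_num at h⟩
  · intro α hα hpos
    rw [Choice.mem_inversions₂ hd hα hpos, h2 _ hm, c.slope_smul hα]
    have := (c.mem_pos_iff_of_mem_layer hα).1 hpos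
    exact ⟨fun h => by linarith, fun h => by norm_num at h⟩
  · intro _ α hα hpos
    rw [Choice.mem_inversions hd hα hpos, h1 _ hm, h2 _ hm, c.slope_smul hα]
    have := (c.mem_pos_iff_of_mem_layer hα).1 hpos
    exact ⟨fun h => by linarith, fun h => by norm_num at h⟩

theorem isLayerKey_line (hd : IsDecomposition P s s₁ s₂ η₁ η₂)
    {k : Fin (c.K + 1)} (hk : k ≠ 0) (hne : (layer P c.h k).Nonempty)
    (hrank : Module.finrank ℝ (c.U k) = 1) :
    IsLayerKey c k ((5 : ℝ) • c.h k) (OrderIso.refl ℝ) := by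
  have h1 : ∀ x ∈ c.U k, coact P s₁ x = x := fun x hx => (c.coact_eq_on_line hd hk hne hrank hx).1
  have h2 : ∀ x ∈ c.U k, coact P s₂ x = -x := fun x hx => (c.coact_eq_on_line hd hk hne hrank hx).2
  have hm := c.h_mem k
  refine ⟨(c.U k).smul_mem _ hm,
    h1 _ ((c.U k).sub_mem ((c.U k).smul_mem _ hm) ((c.U k).smul_mem _ hm)), ?_, ?_, ?_, ?_, ?_,
    fun h => absurd h hk, ?_⟩
  · rw [show (OrderIso.refl ℝ).symm (5 : ℝ) = 5 from rfl, sub_self]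
    exact map_zero (coactLin s₂)
  · intro α hα hpos
    rw [Choice.mem_inversions₁ hd hα hpos, h1 _ hm, c.slope_smul hα]
    have := (c.mem_pos_iff_of_mem_layer hα).1 hpos
    exact ⟨fun h => by linarith, fun h => by norm_num at h⟩
  · intro α hα hpos
    rw [Choice.mem_inversions₂ hd hα hpos, h2 _ hm, c.slope_smul hα, map_neg]
    have := (c.mem_pos_iff_of_mem_layer hα).1 hpos
    exact ⟨fun h => by norm_num, fun h => by linarith⟩
  · intro _ α hα hpos
    rw [Choice.mem_inversions hd hα hpos, h1 _ hm, h2 _ hm, c.slope_smul hα, map_neg]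
    have := (c.mem_pos_iff_of_mem_layer hα).1 hpos
    exact ⟨fun h => by norm_num, fun h => by linarith⟩
  · intro _ α hα _
    rw [c.slope_smul hα]
    norm_num
  · intro _ α hα hpos hspos
    exfalso
    have h3 := (c.mem_pos_iff_of_mem_layer (Choice.smul_mem_layer_self hd hα)).1 hspos
    rw [root'_smul, hd.inv, coact_mul, h1 _ hm, h2 _ hm, map_neg] at h3
    have := (c.mem_pos_iff_of_mem_layer hα).1 hpos
    linarith

theorem exists_isLayerKey_plane (hd : IsDecomposition P s s₁ s₂ η₁ η₂)
    [P.IsRootSystem] {k : Fin (c.K + 1)} (hk : k ≠ 0)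
    (hne : (layer P c.h k).Nonempty) (hrank : Module.finrank ℝ (c.U k) = 2) :
    ∃ u ψ, IsLayerKey c k u ψ := by
  classical
  obtain ⟨v₁, hv₁, v₂, hv₂, ρ, a, b, hρ0, hρ1, ha, hb, hp, hq, hab, h11, h22, h12, h21⟩ :=
    c.exists_plane_data hd hk hne hrank
  obtain ⟨p, hpdef⟩ : ∃ p, p = a - ρ * b := ⟨_, rfl⟩
  obtain ⟨q, hqdef⟩ : ∃ q, q = b - ρ * a := ⟨_, rfl⟩
  rw [← hpdef] at hp
  rw [← hqdef] at hq
  have hquad : 0 < a ^ 2 + b ^ 2 - 2 * ρ * a * b := by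
    nlinarith [mul_pos ha hb, sq_nonneg (a - b)]
  let μ := 2 * ρ * (a ^ 2 + b ^ 2 - 2 * ρ * a * b) / b
  let ν := (4 * ρ ^ 2 * b - 2 * ρ * a - b) / b
  have hμ : 0 < μ := by positivity
  let t₁ := -1 / (2 * p)
  let t₂ := ν / μ
  let t₃ := (2 * ρ * a - b) / (2 * q * a)
  let a₁ := -1 / p
  let a₅ := ρ / q
  have ha₁t₁ : a₁ < t₁ := by
    simp only [a₁, t₁]
    rw [div_lt_div_iff₀ hp (by positivity)]
    linarith
  have ht₁t₃ : t₁ < t₃ := by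
    simp only [t₁, t₃]
    rw [div_lt_div_iff₀ (by positivity) (by positivity)]
    have : (2 * ρ * a - b) * (2 * p) - -1 * (2 * q * a) =
        2 * ρ * (a ^ 2 + b ^ 2 - 2 * ρ * a * b) := by rw [hpdef, hqdef]; ring
    nlinarith [mul_pos hρ0 hquad]
  have ht₂t₃ : t₂ < t₃ := by
    simp only [t₂]
    rw [div_lt_iff₀ hμ, ← sub_pos]
    have : t₃ * μ - ν = p * b / (q * a) := by
      simp only [t₃, μ, ν]
      field_simp
      rw [hpdef, hqdef]
      ring
    rw [this]
    positivity
  have ht₃a₅ : t₃ < a₅ := by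
    simp only [t₃, a₅]
    rw [div_lt_div_iff₀ (by positivity) hq]
    nlinarith [mul_pos hq hb]
  obtain ⟨a₂, ha₁₂, ha₂t₁⟩ : ∃ a₂, (∀ y ∈ insert a₁ ((Finset.univ.image (c.slope k (-v₁))).filter
      (· < t₁)), y < a₂) ∧ a₂ < t₁ := by
    obtain ⟨m, h1, h2⟩ := Order.exists_between_finsets
      (lo := insert a₁ ((Finset.univ.image (c.slope k (-v₁))).filter (· < t₁))) (hi := {t₁}) (by
      intro x hx y hy
      rw [Finset.mem_singleton.1 hy]
      rcases Finset.mem_insert.1 hx with rfl | h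
      · exact ha₁t₁
      · exact (Finset.mem_filter.1 h).2)
    exact ⟨m, h1, h2 _ (Finset.mem_singleton_self _)⟩
  obtain ⟨a₆, ha₆⟩ : ∃ a₆, ∀ y ∈ insert a₅ (Finset.univ.image (c.slope k (-v₁))), y < a₆ := by
    obtain ⟨m, h1, -⟩ := Order.exists_between_finsets
      (lo := insert a₅ (Finset.univ.image (c.slope k (-v₁)))) (hi := ∅) (by simp)
    exact ⟨m, h1⟩
  have hlt₂ : ∀ α, c.slope k (-v₁) α < a₂ ↔ c.slope k (-v₁) α < t₁ := fun α =>
    ⟨fun h => h.trans ha₂t₁, fun h => ha₁₂ _ (Finset.mem_insert_of_mem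
      (Finset.mem_filter.2 ⟨Finset.mem_image_of_mem _ (Finset.mem_univ α), h⟩))⟩
  obtain ⟨ψ, hψ₁, hψ₂, hψ₃, hψ₄, hψ₅, hψ₆⟩ := exists_orderIso_six
    (a₁ := a₁) (a₂ := a₂) (a₃ := max t₁ t₂) (a₄ := t₃) (a₅ := a₅) (a₆ := a₆)
    (ha₁₂ _ (Finset.mem_insert_self _ _)) (ha₂t₁.trans_le (le_max_left _ _))
    (max_lt ht₁t₃ ht₂t₃) ht₃a₅ (ha₆ _ (Finset.mem_insert_self _ _))
  have hsym₁ : ψ.symm 1 = a₁ := by rw [← hψ₁, OrderIso.symm_apply_apply]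
  have hsym₅ : ψ.symm 5 = a₅ := by rw [← hψ₅, OrderIso.symm_apply_apply]
  have hsix : ∀ α, ψ (c.slope k (-v₁) α) < 6 := fun α => by
    rw [← hψ₆, ψ.lt_iff_lt]
    exact ha₆ _ (Finset.mem_insert_of_mem (Finset.mem_image_of_mem _ (Finset.mem_univ α)))
  -- coordinates of a root in the layer
  have hA : ∀ α, P.root' α (c.h k) = a * P.root' α v₁ + b * P.root' α v₂ := fun α => by
    rw [hab, map_add, map_smul, map_smul, smul_eq_mul, smul_eq_mul]
  have hs₁h : coact P s₁ (c.h k) = (2 * ρ * b - a) • v₁ + b • v₂ := by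
    rw [hab, coact_add, coact_smul, coact_smul, h11, h12]
    module
  have hs₂h : coact P s₂ (c.h k) = a • v₁ + (2 * ρ * a - b) • v₂ := by
    rw [hab, coact_add, coact_smul, coact_smul, h22, h21]
    module
  have hsh : coact P s₂ (coact P s₁ (c.h k)) =
      (2 * ρ * b - a) • v₁ + (2 * ρ * (2 * ρ * b - a) - b) • v₂ := by
    rw [hs₁h, coact_add, coact_smul, coact_smul, h22, h21]
    module
  have hcoord : ∀ α ∈ layer P c.h k,
      P.root' α v₁ = -(c.slope k (-v₁) α) * P.root' α (c.h k) ∧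
      P.root' α v₂ = (1 + a * c.slope k (-v₁) α) / b * P.root' α (c.h k) := by
    intro α hα
    have h0 := hα.2
    have h1 : P.root' α v₁ = -(c.slope k (-v₁) α) * P.root' α (c.h k) := by
      rw [Choice.slope, map_neg, neg_div, neg_neg, div_mul_cancel₀ _ h0]
    refine ⟨h1, ?_⟩
    have h2 := hA α
    rw [h1] at h2
    field_simp
    linarith
  have hinv₁ : ∀ α ∈ layer P c.h k, P.root' α (coact P s₁ (c.h k)) =
      2 * p * (c.slope k (-v₁) α - t₁) * P.root' α (c.h k) := by
    intro α hα
    obtain ⟨h1, h2⟩ := hcoord α hα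
    rw [hs₁h, map_add, map_smul, map_smul, smul_eq_mul, smul_eq_mul, h1, h2]
    simp only [t₁]
    field_simp
    rw [hpdef]
    ring
  have hinv₂ : ∀ α ∈ layer P c.h k, P.root' α (coact P s₂ (c.h k)) =
      2 * q * a / b * (t₃ - c.slope k (-v₁) α) * P.root' α (c.h k) := by
    intro α hα
    obtain ⟨h1, h2⟩ := hcoord α hα
    rw [hs₂h, map_add, map_smul, map_smul, smul_eq_mul, smul_eq_mul, h1, h2]
    simp only [t₃]
    field_simp
    rw [hqdef]
    ring
  have hinv : ∀ α ∈ layer P c.h k, P.root' α (coact P s₂ (coact P s₁ (c.h k))) =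
      μ * (t₂ - c.slope k (-v₁) α) * P.root' α (c.h k) := by
    intro α hα
    obtain ⟨h1, h2⟩ := hcoord α hα
    have h3 : μ * (t₂ - c.slope k (-v₁) α) = ν - μ * c.slope k (-v₁) α := by
      simp only [t₂]
      field_simp
    rw [hsh, map_add, map_smul, map_smul, smul_eq_mul, smul_eq_mul, h1, h2, h3]
    simp only [μ, ν]
    field_simp
    ring
  have hneg : ∀ {x y z : ℝ}, 0 < x → 0 < z → (x * y * z < 0 ↔ y < 0) := by
    intro x y z hx hz
    constructor
    · intro h
      by_contra h'
      have := mul_nonneg (mul_nonneg hx.le (not_lt.1 h')) hz.le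
      linarith
    · exact fun h => mul_neg_of_neg_of_pos (mul_neg_of_pos_of_neg hx h) hz
  have hmem₁ : ∀ α ∈ layer P c.h k, α ∈ c.pos →
      (α ∈ inversions P c.pos s₁ ↔ c.slope k (-v₁) α < t₁) := by
    intro α hα hpos
    rw [Choice.mem_inversions₁ hd hα hpos, hinv₁ α hα,
      hneg (by positivity) ((c.mem_pos_iff_of_mem_layer hα).1 hpos), sub_neg]
  have hmem₂ : ∀ α ∈ layer P c.h k, α ∈ c.pos →
      (α ∈ inversions P c.pos s₂ ↔ t₃ < c.slope k (-v₁) α) := by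
    intro α hα hpos
    rw [Choice.mem_inversions₂ hd hα hpos, hinv₂ α hα,
      hneg (by positivity) ((c.mem_pos_iff_of_mem_layer hα).1 hpos), sub_neg]
  have hmem : ∀ α ∈ layer P c.h k, α ∈ c.pos →
      (α ∈ inversions P c.pos s ↔ t₂ < c.slope k (-v₁) α) := by
    intro α hα hpos
    rw [Choice.mem_inversions hd hα hpos, hinv α hα,
      hneg (by positivity) ((c.mem_pos_iff_of_mem_layer hα).1 hpos), sub_neg]
  refine ⟨-v₁, ψ, (c.U k).neg_mem hv₁, ?_, ?_, ?_, ?_, ?_, fun _ α _ _ => hsix α,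
    fun h => absurd h hk, ?_⟩
  · have : -v₁ - ψ.symm 1 • c.h k = (b / p) • (v₂ + ρ • v₁) := by
      have hp' : a = p + ρ * b := by rw [hpdef]; ring
      rw [hsym₁, hab]
      simp only [a₁]
      match_scalars
      · field_simp; rw [hp']; ring
      · field_simp
    rw [this, coact_smul, coact_add, coact_smul, h11, h12]
    module
  · have : -v₁ - ψ.symm 5 • c.h k = (-b / q) • (v₁ + ρ • v₂) := by
      have hq' : b = q + ρ * a := by rw [hqdef]; ring
      rw [hsym₅, hab]
      simp only [a₅]
      match_scalars
      · field_simp; rw [hq']; ring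
      · field_simp
    rw [this, coact_smul, coact_add, coact_smul, h22, h21]
    module
  · intro α hα hpos
    rw [hmem₁ α hα hpos, ← hψ₂, ψ.lt_iff_lt, hlt₂]
  · intro α hα hpos
    rw [hmem₂ α hα hpos, and_iff_left (hsix α), ← hψ₄, ψ.lt_iff_lt]
  · intro hdisj α hα hpos
    rw [hmem α hα hpos, and_iff_left (hsix α), ← hψ₃, ψ.lt_iff_lt, max_lt_iff]
    refine ⟨fun h => ⟨?_, h⟩, fun h => h.2⟩
    by_contra hle
    have hαs := (hmem α hα hpos).2 h
    have hne₁ : c.slope k (-v₁) α ≠ t₁ := by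
      intro he
      have h1 := (c.smul_mem_layer c.invariant₁ (Choice.invariant_inv₁ hd) hα).2
      rw [root'_smul, hd.inv₁, hinv₁ α hα, he] at h1
      simp at h1
    have hα₁ := (hmem₁ α hα hpos).2 (lt_of_le_of_ne (not_lt.1 hle) hne₁)
    have hα₂ : α ∉ inversions P c.pos s₂ := fun h2 =>
      absurd ((hmem₂ α hα hpos).1 h2) (not_lt.2 ((not_lt.1 hle).trans ht₁t₃.le))
    refine Set.disjoint_left.1 hdisj hα₁ ⟨s₂ • α, ?_, ?_⟩
    · rw [c.pos_eq, mem_inversions_iff] at hα₂ hαs ⊢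
      rw [root_smul]
      rw [hd.smul_eq] at hαs
      refine ⟨?_, hαs.2⟩
      rw [not_and] at hα₂
      have h3 := c.height_ne_zero (s₂ • α)
      rw [root_smul] at h3
      exact lt_of_le_of_ne (not_lt.1 (hα₂ hαs.1)) h3.symm
    · change s₂ • s₂ • α = α
      rw [← mul_smul, hd.mul_self₂, one_smul]
  · intro _ α hα hpos hspos
    rw [ψ.lt_iff_lt]
    have h1 := (c.mem_pos_iff_of_mem_layer hα).1 hpos
    have h2 := (c.mem_pos_iff_of_mem_layer (Choice.smul_mem_layer_self hd hα)).1 hspos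
    have hsv : coact P s₂ (coact P s₁ v₁) = -v₁ - (2 * ρ) • v₂ := by
      rw [h11, coact_neg, h21]
      module
    rw [Choice.slope, Choice.slope, div_lt_div_iff₀ h1 h2]
    rw [root'_smul, root'_smul, hd.inv, coact_mul, coact_mul, coact_neg, coact_neg, hsv, hsh, hA α]
    rw [hA α] at h1
    simp only [map_add, map_neg, map_sub, map_smul, smul_eq_mul]
    generalize P.root' α v₁ = x at h1 ⊢
    generalize P.root' α v₂ = y at h1 ⊢
    have hxy : 0 < (x + ρ * y) ^ 2 + (1 - ρ ^ 2) * y ^ 2 := by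
      have h3 : 0 < 1 - ρ ^ 2 := by nlinarith
      by_cases hy : y = 0
      · subst hy
        have hx : x ≠ 0 := by rintro rfl; simp at h1
        have : 0 < x ^ 2 := by positivity
        simpa using this
      · have : 0 < y ^ 2 := by positivity
        nlinarith [sq_nonneg (x + ρ * y), mul_pos h3 this]
    have h4 := mul_pos (mul_pos hρ0 hb) hxy
    nlinarith

/-- Every layer that contains roots has a key. -/
theorem exists_isLayerKey (hd : IsDecomposition P s s₁ s₂ η₁ η₂)
    [P.IsRootSystem] (k : Fin (c.K + 1)) (hne : (layer P c.h k).Nonempty) :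
    ∃ u ψ, IsLayerKey c k u ψ := by
  by_cases hk : k = 0
  · subst hk
    exact ⟨_, _, isLayerKey_zero hd⟩
  · rcases c.rotation_or_neg k hk with h | h
    · exact exists_isLayerKey_plane hd hk hne h.1
    · exact ⟨_, _, isLayerKey_line hd hk hne h.1⟩

end

end LayerKey

section Perturbation

open Filter Topology

variable {ι V N : Type*} [Fintype ι] [AddCommGroup V] [Module ℝ V] [AddCommGroup N] [Module ℝ N]
  {P : RootPairing ι ℝ V N} {s s₁ s₂ : P.weylGroup}
  (c : Choice P s s₁ s₂)

/-- The sum of the vectors `x j`, where each is infinitely small compared to the next, and `e` is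
infinitely small compared to all of them. -/
noncomputable def Choice.perturb (x : Fin (c.K + 1) → N) (e : N) (ε : ℝ) : N :=
  ∑ j : Fin (c.K + 1), ε ^ (c.K - (j : ℕ)) • x j + ε ^ (c.K + 1) • e

variable {c}

theorem Choice.root'_perturb (x : Fin (c.K + 1) → N) (e : N) (ε : ℝ) (α : ι) :
    P.root' α (c.perturb x e ε) =
      ∑ j : Fin (c.K + 1), ε ^ (c.K - (j : ℕ)) * P.root' α (x j) + ε ^ (c.K + 1) * P.root' α e := by
  simp only [Choice.perturb, map_add, map_sum, map_smul, smul_eq_mul]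

theorem Choice.coact_perturb {w : P.weylGroup} {x : Fin (c.K + 1) → N} {e : N}
    (hx : ∀ j, coact P w (x j) = x j) (he : coact P w e = e) (ε : ℝ) :
    coact P w (c.perturb x e ε) = c.perturb x e ε := by
  rw [← coactLin_apply, Choice.perturb, map_add, map_sum, map_smul, coactLin_apply, he]
  congr 1
  exact Finset.sum_congr rfl fun j _ => by rw [map_smul, coactLin_apply, hx]

theorem Choice.exists_leading_term {α : ι} {k : Fin (c.K + 1)} (hα : α ∈ layer P c.h k)
    {x : Fin (c.K + 1) → N} (hx : ∀ j, x j ∈ c.U j) (e : N) :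
    ∃ F : ℝ → ℝ, Continuous F ∧ F 0 = P.root' α (x k) ∧
      ∀ ε, P.root' α (c.perturb x e ε) = ε ^ (c.K - (k : ℕ)) * F ε := by
  refine ⟨fun ε => ∑ j : Fin (c.K + 1),
    (if j ≤ k then ε ^ ((k : ℕ) - (j : ℕ)) * P.root' α (x j) else 0) +
    ε ^ ((k : ℕ) + 1) * P.root' α e, ?_, ?_, fun ε => ?_⟩
  · refine Continuous.add (continuous_finsetSum _ fun j _ => ?_) (by fun_prop)
    split_ifs <;> fun_prop
  · simp only [ne_eq, Nat.add_eq_zero_iff, one_ne_zero, and_false, not_false_eq_true, zero_pow,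
      zero_mul, add_zero]
    rw [Finset.sum_eq_single k]
    · simp
    · intro j _ hj
      split_ifs with h
      · have h1 : (j : ℕ) < k := lt_of_le_of_ne h fun h' => hj (Fin.ext h')
        rw [zero_pow (by omega), zero_mul]
      · rfl
    · simp
  · rw [Choice.root'_perturb, mul_add, Finset.mul_sum]
    have hk : (k : ℕ) ≤ c.K := Nat.lt_succ_iff.1 k.2
    congr 1
    · refine Finset.sum_congr rfl fun j _ => ?_
      split_ifs with h
      · have h1 : (j : ℕ) ≤ k := h
        rw [← mul_assoc, ← pow_add]
        congr 2
        omega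
      · rw [c.root'_eq_zero hα (not_le.1 h) (hx j), mul_zero, mul_zero]
    · rw [← mul_assoc, ← pow_add]
      congr 2
      omega

theorem Choice.tendsto_root'_perturb_div {α : ι} {k : Fin (c.K + 1)} (hα : α ∈ layer P c.h k)
    {x : Fin (c.K + 1) → N} (hx : ∀ j, x j ∈ c.U j) (e : N) :
    Tendsto (fun ε => P.root' α (c.perturb x e ε) / P.root' α (c.perturb c.h 0 ε)) (𝓝[>] 0)
      (𝓝 (P.root' α (x k) / P.root' α (c.h k))) := by
  obtain ⟨F, hF, hF0, hFe⟩ := Choice.exists_leading_term hα hx e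
  obtain ⟨G, hG, hG0, hGe⟩ := Choice.exists_leading_term hα c.h_mem 0
  have h : Tendsto (fun ε => F ε / G ε) (𝓝[>] 0) (𝓝 (F 0 / G 0)) :=
    ((hF.tendsto 0).mono_left nhdsWithin_le_nhds).div
      ((hG.tendsto 0).mono_left nhdsWithin_le_nhds) (by rw [hG0]; exact hα.2)
  rw [hF0, hG0] at h
  refine h.congr' ?_
  filter_upwards [self_mem_nhdsWithin] with ε hε
  rw [hFe, hGe, mul_div_mul_left _ _ (pow_pos hε _).ne']

theorem Choice.eventually_root'_perturb_pos {α : ι} (hα : α ∈ c.pos) :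
    ∀ᶠ ε in 𝓝[>] (0 : ℝ), 0 < P.root' α (c.perturb c.h 0 ε) := by
  obtain ⟨k, hk⟩ := c.exists_layer α
  obtain ⟨G, hG, hG0, hGe⟩ := Choice.exists_leading_term hk c.h_mem 0
  have h : ∀ᶠ ε in 𝓝[>] (0 : ℝ), 0 < G ε :=
    ((hG.tendsto 0).mono_left nhdsWithin_le_nhds).eventually
      (lt_mem_nhds (by rw [hG0]; exact (c.mem_pos_iff_of_mem_layer hk).1 hα))
  filter_upwards [h, self_mem_nhdsWithin] with ε h1 h2
  rw [hGe]
  exact mul_pos (pow_pos h2 _) h1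

theorem Choice.eventually_root'_perturb_ne_zero {α : ι} (x : Fin (c.K + 1) → N) {e : N}
    (he : P.root' α e ≠ 0) : ∀ᶠ ε in 𝓝[>] (0 : ℝ), P.root' α (c.perturb x e ε) ≠ 0 := by
  let p : Polynomial ℝ := ∑ j : Fin (c.K + 1), Polynomial.C (P.root' α (x j)) *
    Polynomial.X ^ (c.K - (j : ℕ)) + Polynomial.C (P.root' α e) * Polynomial.X ^ (c.K + 1)
  have hp : p ≠ 0 := by
    intro h0
    have h1 := congrArg (fun q => Polynomial.coeff q (c.K + 1)) h0
    simp only [p, Polynomial.coeff_add, Polynomial.finsetSum_coeff, Polynomial.coeff_C_mul,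
      Polynomial.coeff_X_pow, Polynomial.coeff_zero] at h1
    rw [Finset.sum_eq_zero (fun j _ => by rw [if_neg (by omega), mul_zero])] at h1
    simp at h1
    exact he h1
  have hfin : {ε : ℝ | p.IsRoot ε}.Finite := Polynomial.finite_setOfPred_isRoot hp
  have h : ∀ᶠ ε in 𝓝[>] (0 : ℝ), ¬ p.IsRoot ε :=
    (nhdsGT_le_nhdsNE 0).trans (nhdsNE_le_cofinite 0) hfin.compl_mem_cofinite
  filter_upwards [h] with ε hε h0
  apply hε
  rw [Polynomial.IsRoot, ← h0, Choice.root'_perturb]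
  simp only [p, Polynomial.eval_add, Polynomial.eval_finsetSum, Polynomial.eval_mul,
    Polynomial.eval_C, Polynomial.eval_pow, Polynomial.eval_X]
  congr 1
  · exact Finset.sum_congr rfl fun j _ => mul_comm _ _
  · exact mul_comm _ _

end Perturbation

section KeyData

open Filter Topology

variable {ι V N : Type*} [Fintype ι] [AddCommGroup V] [Module ℝ V] [AddCommGroup N] [Module ℝ N]
  {P : RootPairing ι ℝ V N} {s s₁ s₂ : P.weylGroup}

/-- The coarse order on the positive roots, given by `key`, together with functionals `D t` and `H`
whose quotients refine it on the roots with key `t`. -/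
structure IsKeyData (c : Choice P s s₁ s₂) (key : ι → ℝ) (H : N) (D : ℝ → N) : Prop where
  H_pos : ∀ α ∈ c.pos, 0 < P.root' α H
  add : ∀ α ∈ c.pos, ∀ β ∈ c.pos, ∀ δ ∈ c.pos, P.root δ = P.root α + P.root β →
    (key α < key β → key α ≤ key δ ∧ key δ ≤ key β) ∧ (key α = key β → key δ = key α)
  lt : ∀ α ∈ c.pos, ∀ β ∈ c.pos, key α < key β →
    P.root' α (D (key α)) / P.root' α H < P.root' β (D (key α)) / P.root' β H
  gt : ∀ α ∈ c.pos, ∀ β ∈ c.pos, key β < key α →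
    P.root' β (D (key α)) / P.root' β H < P.root' α (D (key α)) / P.root' α H
  pos₁ : ∀ α ∈ c.pos, 1 < key α → 0 < P.root' α (D 1)
  neg₁ : ∀ α ∈ c.pos, key α < 1 → P.root' α (D 1) < 0
  pos₂ : ∀ α ∈ c.pos, 5 < key α → 0 < P.root' α (D 5)
  neg₂ : ∀ α ∈ c.pos, key α < 5 → P.root' α (D 5) < 0
  fixed₁ : coact P s₁ (D 1) = D 1
  fixed₂ : coact P s₂ (D 5) = D 5
  negated₁ : ∀ α ∈ c.pos, s₁ • P.root α = -P.root α ↔ key α = 1 ∧ P.root' α (D 1) = 0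
  negated₂ : ∀ α ∈ c.pos, s₂ • P.root α = -P.root α ↔ key α = 5 ∧ P.root' α (D 5) = 0
  inv₁ : ∀ α ∈ c.pos, (α ∈ inversions P c.pos s₁ ↔ key α < 2)
  inv₂ : ∀ α ∈ c.pos, (α ∈ inversions P c.pos s₂ ↔ 4 < key α ∧ key α < 6)
  inv : Disjoint (inversions P c.pos s₁) ((s₂ • ·) '' inversions P c.pos s₁) →
    ∀ α ∈ c.pos, (α ∈ inversions P c.pos s ↔ 3 < key α ∧ key α < 6)
  lt_six : ∀ α ∈ c.pos, s • P.root α ≠ P.root α → key α < 6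
  eq_seven : ∀ α ∈ c.pos, s • P.root α = P.root α → key α = 7
  mem_layer_zero : ∀ α ∈ c.pos, s • P.root α = P.root α ↔ α ∈ layer P c.h 0
  lt_smul : ∀ α ∈ c.pos, s • P.root α ≠ P.root α → s • α ∈ c.pos → key α < key (s • α)
  add_lower : ∀ k, ∀ α ∈ layer P c.h k, ∀ j, j < k → ∀ β ∈ layer P c.h j, ∀ δ,
    P.root δ = P.root α + P.root β → key δ = key α

theorem Choice.add_mem_layer {c : Choice P s s₁ s₂} {α β δ : ι} {j k : Fin (c.K + 1)}
    (hα : α ∈ layer P c.h k)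
    (hβ : β ∈ layer P c.h j) (hjk : j < k) (hδ : P.root δ = P.root α + P.root β) :
    δ ∈ layer P c.h k ∧ ∀ x ∈ c.U k, P.root' δ x = P.root' α x := by
  have h : ∀ x ∈ c.U k, P.root' δ x = P.root' α x := fun x hx => by
    rw [root'_eq_of_root_add hδ, c.root'_eq_zero hβ hjk hx, add_zero]
  refine ⟨⟨fun i hi => ?_, ?_⟩, h⟩
  · rw [root'_eq_of_root_add hδ, hα.1 i hi, hβ.1 i (hjk.trans hi), add_zero]
  · rw [h _ (c.h_mem k)]
    exact hα.2

theorem smul_eq_self_of_mem_layer_zero {c : Choice P s s₁ s₂} {n m : ℕ} {η₁ : Fin n → ι}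
    {η₂ : Fin m → ι} (hd : IsDecomposition P s s₁ s₂ η₁ η₂) {α : ι} (hα : α ∈ layer P c.h 0) :
    s • P.root α = P.root α := by
  refine ext_toLinearMap (P := P) fun x => ?_
  have hle : ⨆ i, c.U i ≤
      LinearMap.ker (P.toLinearMap (s • P.root α) - P.toLinearMap (P.root α)) := by
    refine iSup_le fun i x hx => ?_
    rw [LinearMap.mem_ker, LinearMap.sub_apply, ← root_smul, sub_eq_zero]
    change P.root' (s • α) x = P.root' α x
    rw [root'_smul]
    by_cases hi : i = 0
    · subst hi
      have := (c.mem_zero_iff x).1 hx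
      nth_rewrite 1 [← this]
      rw [coact_inv_coact]
    · have h0 : (0 : Fin (c.K + 1)) < i := Fin.pos_of_ne_zero hi
      rw [c.root'_eq_zero hα h0 hx, c.root'_eq_zero hα h0 (Choice.invariant_inv hd i x hx)]
  rw [c.isInternal.submodule_iSup_eq_top] at hle
  have := hle (x := x) Submodule.mem_top
  rwa [LinearMap.mem_ker, LinearMap.sub_apply, sub_eq_zero] at this

theorem exists_isKeyData [P.IsRootSystem] (c : Choice P s s₁ s₂) {n m : ℕ} {η₁ : Fin n → ι}
    {η₂ : Fin m → ι} (hd : IsDecomposition P s s₁ s₂ η₁ η₂) :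
    ∃ key H D, IsKeyData c key H D := by
  classical
  have hex : ∀ k, ∃ u ψ, (layer P c.h k).Nonempty → IsLayerKey c k u ψ := by
    intro k
    by_cases hne : (layer P c.h k).Nonempty
    · obtain ⟨u, ψ, h⟩ := exists_isLayerKey hd k hne
      exact ⟨u, ψ, fun _ => h⟩
    · exact ⟨0, OrderIso.refl ℝ, fun h => absurd h hne⟩
  choose u ψ hkey using hex
  choose lay hlay using c.exists_layer
  obtain ⟨e₁, he₁, hne₁⟩ := exists_generic_fixed (P := P) hd.mul_self₁
  obtain ⟨e₂, he₂, hne₂⟩ := exists_generic_fixed (P := P) hd.mul_self₂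
  have hk : ∀ α, IsLayerKey c (lay α) (u (lay α)) (ψ (lay α)) := fun α =>
    hkey (lay α) ⟨α, hlay α⟩
  let key : ι → ℝ := fun α => ψ (lay α) (c.slope (lay α) (u (lay α)) α)
  have hkeyeq : ∀ {α k}, α ∈ layer P c.h k → key α = ψ k (c.slope k (u k) α) := by
    intro α k h
    have := c.layer_unique (hlay α) h
    subst this
    rfl
  let d : ℝ → Fin (c.K + 1) → N := fun t j =>
    if (layer P c.h j).Nonempty then u j - (ψ j).symm t • c.h j else 0
  have hdU : ∀ t j, d t j ∈ c.U j := by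
    intro t j
    simp only [d]
    split_ifs with h
    · exact (c.U j).sub_mem (hkey j h).mem ((c.U j).smul_mem _ (c.h_mem j))
    · exact (c.U j).zero_mem
  have hdlay : ∀ t α, P.root' α (d t (lay α)) / P.root' α (c.h (lay α)) =
      c.slope (lay α) (u (lay α)) α - (ψ (lay α)).symm t := by
    intro t α
    simp only [d]
    rw [if_pos ⟨α, hlay α⟩, map_sub, map_smul, smul_eq_mul, sub_div,
      mul_div_cancel_right₀ _ (hlay α).2, Choice.slope]
  have hsign : ∀ t α, (t < key α ↔
        0 < c.slope (lay α) (u (lay α)) α - (ψ (lay α)).symm t) ∧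
      (key α < t ↔ c.slope (lay α) (u (lay α)) α - (ψ (lay α)).symm t < 0) := by
    intro t α
    constructor
    · rw [sub_pos]
      exact (OrderIso.symm_apply_lt _).symm
    · rw [sub_neg]
      exact (OrderIso.lt_symm_apply _).symm
  let E : ℝ → N := fun t => if t = 1 then e₁ else if t = 5 then e₂ else 0
  have hE₁ : E 1 = e₁ := if_pos rfl
  have hE₂ : E 5 = e₂ := by simp [E]
  let D : ℝ → ℝ → N := fun ε t => c.perturb (d t) (E t) ε
  let H : ℝ → N := fun ε => c.perturb c.h 0 ε
  have hlim : ∀ t α, Tendsto (fun ε => P.root' α (D ε t) / P.root' α (H ε)) (𝓝[>] 0)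
      (𝓝 (c.slope (lay α) (u (lay α)) α - (ψ (lay α)).symm t)) := by
    intro t α
    rw [← hdlay t α]
    exact Choice.tendsto_root'_perturb_div (hlay α) (hdU t) (E t)
  have hself : ∀ α, c.slope (lay α) (u (lay α)) α - (ψ (lay α)).symm (key α) = 0 := by
    intro α
    simp only [key, OrderIso.symm_apply_apply, sub_self]
  have hpos : ∀ t α, t < key α → ∀ᶠ ε in 𝓝[>] (0 : ℝ), 0 < P.root' α (D ε t) / P.root' α (H ε) :=
    fun t α h => (hlim t α).eventually (lt_mem_nhds ((hsign t α).1.1 h))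
  have hneg : ∀ t α, key α < t → ∀ᶠ ε in 𝓝[>] (0 : ℝ), P.root' α (D ε t) / P.root' α (H ε) < 0 :=
    fun t α h => (hlim t α).eventually (gt_mem_nhds ((hsign t α).2.1 h))
  have hlt : ∀ α β, key α < key β → ∀ᶠ ε in 𝓝[>] (0 : ℝ),
      P.root' α (D ε (key α)) / P.root' α (H ε) < P.root' β (D ε (key α)) / P.root' β (H ε) := by
    intro α β h
    refine (hlim _ α).eventually_lt (hlim _ β) ?_
    rw [hself α]
    exact (hsign _ β).1.1 h
  have hgt : ∀ α β, key β < key α → ∀ᶠ ε in 𝓝[>] (0 : ℝ),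
      P.root' β (D ε (key α)) / P.root' β (H ε) < P.root' α (D ε (key α)) / P.root' α (H ε) := by
    intro α β h
    refine (hlim _ β).eventually_lt (hlim _ α) ?_
    rw [hself α]
    exact (hsign _ β).2.1 h
  have hz₁ : ∀ α, ¬ s₁ • P.root α = -P.root α → ∀ᶠ ε in 𝓝[>] (0 : ℝ), P.root' α (D ε 1) ≠ 0 :=
    fun α h => Choice.eventually_root'_perturb_ne_zero _
      (by rw [hE₁]; exact fun h' => h (hne₁ α h'))
  have hz₂ : ∀ α, ¬ s₂ • P.root α = -P.root α → ∀ᶠ ε in 𝓝[>] (0 : ℝ), P.root' α (D ε 5) ≠ 0 :=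
    fun α h => Choice.eventually_root'_perturb_ne_zero _
      (by rw [hE₂]; exact fun h' => h (hne₂ α h'))
  have hall : ∀ {p : ι → Prop} {r : ι → ℝ → Prop}, (∀ α, p α → ∀ᶠ ε in 𝓝[>] (0 : ℝ), r α ε) →
      ∀ᶠ ε in 𝓝[>] (0 : ℝ), ∀ α, p α → r α ε := by
    intro p r h
    rw [eventually_all]
    intro α
    by_cases hp : p α
    · exact (h α hp).mono fun ε hε _ => hε
    · exact Eventually.of_forall fun ε h' => absurd h' hp
  have hall₂ : ∀ {p : ι → ι → Prop} {r : ι → ι → ℝ → Prop},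
      (∀ α β, p α β → ∀ᶠ ε in 𝓝[>] (0 : ℝ), r α β ε) →
      ∀ᶠ ε in 𝓝[>] (0 : ℝ), ∀ α β, p α β → r α β ε := by
    intro p r h
    rw [eventually_all]
    intro α
    exact hall (h α)
  obtain ⟨ε, h1, h2, h3, h4, h5, h6, h7, h8, h9⟩ :=
    ((hall fun α (hα : α ∈ c.pos) => Choice.eventually_root'_perturb_pos hα).and
    ((hall₂ hlt).and ((hall₂ hgt).and ((hall (hpos 1)).and
    ((hall (hneg 1)).and ((hall (hpos 5)).and
    ((hall (hneg 5)).and ((hall hz₁).and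
    (hall hz₂))))))))).exists
  have hfix₁ : coact P s₁ (D ε 1) = D ε 1 := by
    apply Choice.coact_perturb
    · intro j
      simp only [d]
      split_ifs with h
      · exact (hkey j h).fixed₁
      · exact map_zero (coactLin s₁)
    · rw [hE₁, he₁]
  have hfix₂ : coact P s₂ (D ε 5) = D ε 5 := by
    apply Choice.coact_perturb
    · intro j
      simp only [d]
      split_ifs with h
      · exact (hkey j h).fixed₂
      · exact map_zero (coactLin s₂)
    · rw [hE₂, he₂]
  have hneg0 : ∀ {w : P.weylGroup} {α x}, w * w = 1 → w • P.root α = -P.root α → coact P w x = x →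
      P.root' α x = 0 := by
    intro w α x hw hα hx
    have hinv : w⁻¹ = w := inv_eq_of_mul_eq_one_left hw
    have := pairing_coact P w (P.root α) x
    rw [hx, hinv, hα, map_neg, LinearMap.neg_apply] at this
    change P.root' α x = -P.root' α x at this
    linarith
  have hfixed_lay : ∀ α ∈ c.pos, s • P.root α = P.root α ↔ lay α = 0 := by
    intro α hα
    constructor
    · intro h
      by_contra h0
      have hs : s • α = α := P.root.injective (by rw [root_smul, h])
      have := (hk α).lt_smul h0 α (hlay α) hα (by rwa [hs])
      rw [hs] at this
      exact lt_irrefl _ this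
    · intro h
      exact smul_eq_self_of_mem_layer_zero hd (h ▸ hlay α)
  have hlower : ∀ k, ∀ α ∈ layer P c.h k, ∀ j, j < k → ∀ β ∈ layer P c.h j, ∀ δ,
      P.root δ = P.root α + P.root β → key δ = key α := by
    intro k α hα j hjk β hβ δ hδ
    obtain ⟨h, h'⟩ := Choice.add_mem_layer hα hβ hjk hδ
    rw [hkeyeq h, hkeyeq hα, Choice.slope, Choice.slope, h' _ (c.h_mem k),
      h' _ (hkey k ⟨α, hα⟩).mem]
  refine ⟨key, H ε, D ε, h1, ?_, fun α _ β _ => h2 α β, fun α _ β _ => h3 α β, ?_, ?_, ?_, ?_,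
    hfix₁, hfix₂, ?_, ?_, fun α hα => (hk α).inv₁ α (hlay α) hα,
    fun α hα => (hk α).inv₂ α (hlay α) hα, fun hdj α hα => (hk α).inv hdj α (hlay α) hα, ?_, ?_, ?_,
    ?_, hlower⟩
  · intro α hα β hβ δ hδ hr
    rcases lt_trichotomy (lay α) (lay β) with h | h | h
    · have := hlower _ β (hlay β) _ h α (hlay α) δ (by rw [hr, add_comm])
      rw [this]
      exact ⟨fun h => ⟨h.le, le_rfl⟩, fun h => h.symm⟩
    · have hα' := (c.mem_pos_iff_of_mem_layer (hlay α)).1 hα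
      have hβl : β ∈ layer P c.h (lay α) := h ▸ hlay β
      have hβ' := (c.mem_pos_iff_of_mem_layer hβl).1 hβ
      have hδl : δ ∈ layer P c.h (lay α) := by
        refine ⟨fun i hi => ?_, ?_⟩
        · rw [root'_eq_of_root_add hr, (hlay α).1 i hi, hβl.1 i hi, add_zero]
        · rw [root'_eq_of_root_add hr]
          exact (add_pos hα' hβ').ne'
      rw [hkeyeq (hlay α), hkeyeq hβl, hkeyeq hδl, OrderIso.lt_iff_lt, OrderIso.le_iff_le,
        OrderIso.le_iff_le]
      simp only [Choice.slope, root'_eq_of_root_add hr]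
      refine ⟨fun hlt => ?_, fun heq => ?_⟩
      · obtain ⟨g1, g2⟩ := lt_mediant hα' hβ' hlt
        exact ⟨g1.le, g2.le⟩
      · rw [mediant_eq hα' hβ' ((ψ (lay α)).injective heq)]
    · have := hlower _ α (hlay α) _ h β (hlay β) δ hr
      rw [this]
      exact ⟨fun h => ⟨le_rfl, h.le⟩, fun _ => rfl⟩
  · exact fun α hα h => (div_pos_iff_of_pos_right (h1 α hα)).1 (h4 α h)
  · exact fun α hα h => by
      exact (div_lt_iff₀ (h1 α hα)).1 (h5 α h) |>.trans_eq (zero_mul _)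
  · exact fun α hα h => (div_pos_iff_of_pos_right (h1 α hα)).1 (h6 α h)
  · exact fun α hα h => by
      exact (div_lt_iff₀ (h1 α hα)).1 (h7 α h) |>.trans_eq (zero_mul _)
  · intro α hα
    constructor
    · intro h
      have h0 := hneg0 hd.mul_self₁ h hfix₁
      refine ⟨?_, h0⟩
      rcases lt_trichotomy (key α) 1 with hlt | heq | hgt
      · have := h5 α hlt
        rw [h0, zero_div] at this
        exact absurd this (lt_irrefl _)
      · exact heq
      · have := h4 α hgt
        rw [h0, zero_div] at this
        exact absurd this (lt_irrefl _)
    · rintro ⟨-, h⟩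
      by_contra hn
      exact h8 α hn h
  · intro α hα
    constructor
    · intro h
      have h0 := hneg0 hd.mul_self₂ h hfix₂
      refine ⟨?_, h0⟩
      rcases lt_trichotomy (key α) 5 with hlt | heq | hgt
      · have := h7 α hlt
        rw [h0, zero_div] at this
        exact absurd this (lt_irrefl _)
      · exact heq
      · have := h6 α hgt
        rw [h0, zero_div] at this
        exact absurd this (lt_irrefl _)
    · rintro ⟨-, h⟩
      by_contra hn
      exact h9 α hn h
  · intro α hα h
    exact (hk α).lt_six (fun h' => h ((hfixed_lay α hα).2 h')) α (hlay α) hα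
  · intro α hα h
    exact (hk α).eq_seven ((hfixed_lay α hα).1 h) α (hlay α)
  · intro α hα
    rw [hfixed_lay α hα]
    exact ⟨fun h => h ▸ hlay α, fun h => c.layer_unique (hlay α) h⟩
  · intro α hα h hs
    rw [hkeyeq (Choice.smul_mem_layer_self hd (hlay α))]
    exact (hk α).lt_smul (fun h' => h ((hfixed_lay α hα).2 h')) α (hlay α) hα hs

end KeyData

section InversionsOfProduct

variable {ι V N : Type*} [AddCommGroup V] [Module ℝ V] [AddCommGroup N] [Module ℝ N]
  {P : RootPairing ι ℝ V N} {g : V →ₗ[ℝ] ℝ}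

theorem smul_smul_of_mul_self {X : Type*} [MulAction P.weylGroup X] {w : P.weylGroup}
    (hw : w * w = 1) (y : X) : w • w • y = y := by
  rw [smul_smul, hw, one_smul]

theorem inversions_mul (hg : ∀ α, g (P.root α) ≠ 0) {w₁ w₂ : P.weylGroup} (hw₂ : w₂ * w₂ = 1)
    (hdisj : Disjoint (inversions P (posOf P g) w₁) (inversions P (posOf P g) w₂)) :
    inversions P (posOf P g) (w₁ * w₂) =
      inversions P (posOf P g) w₂ ∪ (w₂ • ·) '' inversions P (posOf P g) w₁ := by
  ext α
  rw [Set.disjoint_left] at hdisj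
  constructor
  · intro h
    rw [mem_inversions_iff, mul_smul] at h
    rcases lt_or_gt_of_ne (hg (w₂ • α)) with h' | h'
    · rw [root_smul] at h'
      exact Or.inl (mem_inversions_iff.2 ⟨h.1, h'⟩)
    · refine Or.inr ⟨w₂ • α, mem_inversions_iff.2 ⟨h', ?_⟩, smul_smul_of_mul_self hw₂ α⟩
      rw [root_smul]
      exact h.2
  · rintro (h | ⟨β, hβ, rfl⟩)
    · rw [mem_inversions_iff] at h ⊢
      obtain ⟨β, hβ⟩ := exists_root_neg (P := P) (w₂ • α)
      rw [root_smul] at hβ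
      have hβ₂ : β ∈ inversions P (posOf P g) w₂ := by
        rw [mem_inversions_iff, hβ, smul_neg, smul_smul_of_mul_self hw₂, map_neg, map_neg]
        exact ⟨neg_pos.2 h.2, neg_neg_of_pos h.1⟩
      have hβ₁ := fun h' => hdisj h' hβ₂
      have hpos := (mem_inversions_iff.1 hβ₂).1
      rw [mem_inversions_iff] at hβ₁
      have h1 : 0 < g (w₁ • P.root β) := by
        refine lt_of_le_of_ne (not_lt.1 fun h' => hβ₁ ⟨hpos, h'⟩) fun h' => ?_
        rw [← root_smul] at h'
        exact hg _ h'.symm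
      rw [hβ, smul_neg, map_neg, neg_pos] at h1
      rw [mul_smul]
      exact ⟨h.1, h1⟩
    · have hβ₂ := hdisj hβ
      rw [mem_inversions_iff] at hβ hβ₂ ⊢
      rw [root_smul, mul_smul, smul_smul_of_mul_self hw₂]
      refine ⟨lt_of_le_of_ne (not_lt.1 fun h' => hβ₂ ⟨hβ.1, h'⟩) fun h' => ?_, hβ.2⟩
      rw [← root_smul] at h'
      exact hg _ h'.symm

theorem disjoint_inversions_image {w₁ w₂ : P.weylGroup} (hw₂ : w₂ * w₂ = 1) :
    Disjoint (inversions P (posOf P g) w₂) ((w₂ • ·) '' inversions P (posOf P g) w₁) := by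
  rw [Set.disjoint_left]
  rintro _ h ⟨β, hβ, rfl⟩
  rw [mem_inversions_iff] at h hβ
  rw [root_smul, smul_smul_of_mul_self hw₂] at h
  exact lt_asymm h.2 hβ.1

theorem length_mul [Fintype ι] [P.IsReduced] [P.IsCrystallographic] (hg : ∀ α, g (P.root α) ≠ 0)
    {w₁ w₂ : P.weylGroup} (hw₂ : w₂ * w₂ = 1)
    (hdisj : Disjoint (inversions P (posOf P g) w₁) (inversions P (posOf P g) w₂)) :
    length P (posOf P g) (w₁ * w₂) = length P (posOf P g) w₂ + length P (posOf P g) w₁ := by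
  rw [length_eq_ncard_inversions hg, length_eq_ncard_inversions hg, length_eq_ncard_inversions hg,
    inversions_mul hg hw₂ hdisj, Set.ncard_union_eq (disjoint_inversions_image hw₂),
    Set.ncard_image_of_injective _ (MulAction.injective w₂)]

theorem ncard_inversions_neg_le [Fintype ι] {w : P.weylGroup} (hw : w * w = 1) {x : N}
    (hx : coact P w x = x) :
    {α | α ∈ inversions P (posOf P g) w ∧ P.root' α x < 0}.ncard ≤
      {α | α ∈ inversions P (posOf P g) w ∧ 0 < P.root' α x}.ncard := by
  have hinv : w⁻¹ = w := inv_eq_of_mul_eq_one_left hw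
  choose neg hneg using exists_root_neg (P := P)
  have hx' : ∀ α, P.root' (neg (w • α)) x = -P.root' α x := by
    intro α
    have h1 : P.root' (w • α) x = P.root' α x := by rw [root'_smul, hinv, hx]
    have h2 : P.root' (neg (w • α)) x = -P.root' (w • α) x := by
      simp only [RootPairing.root', hneg, map_neg, LinearMap.neg_apply]
    rw [h2, h1]
  refine Set.ncard_le_ncard_of_injOn (fun α => neg (w • α)) ?_ ?_ (Set.toFinite _)
  · rintro α ⟨h, h'⟩
    refine ⟨?_, by rw [hx']; exact neg_pos.2 h'⟩
    rw [mem_inversions_iff] at h ⊢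
    rw [hneg, smul_neg, root_smul, smul_smul_of_mul_self hw, map_neg, map_neg]
    exact ⟨neg_pos.2 h.2, neg_neg_of_pos h.1⟩
  · intro α _ β _ h
    have h1 : P.root (neg (w • α)) = P.root (neg (w • β)) := congrArg P.root h
    rw [hneg, hneg, neg_inj] at h1
    exact MulAction.injective w (P.root.injective h1)

theorem ncard_inversions_neg_eq [Fintype ι] {w : P.weylGroup} (hw : w * w = 1) {x : N}
    (hx : coact P w x = x) :
    {α | α ∈ inversions P (posOf P g) w ∧ P.root' α x < 0}.ncard =
      {α | α ∈ inversions P (posOf P g) w ∧ 0 < P.root' α x}.ncard := by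
  refine le_antisymm (ncard_inversions_neg_le hw hx) ?_
  have h := ncard_inversions_neg_le (g := g) hw (x := -x) (by rw [coact_neg, hx])
  simpa only [map_neg, neg_lt_zero, neg_pos] using h

end InversionsOfProduct

section Reverse

variable {ι : Type*} {n : ℕ}

theorem before_reverse {L : List ι} {a b : ι} : Before L.reverse a b ↔ Before L b a := by
  rw [Before, Before, ← List.reverse_sublist]
  simp

theorem ofFn_rev (γ : Fin n → ι) : List.ofFn (γ ∘ Fin.rev) = (List.ofFn γ).reverse := by
  apply List.ext_getElem
  · simp
  · intro i h1 h2
    simp only [List.getElem_ofFn, List.getElem_reverse, Function.comp_apply]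
    congr 1
    ext
    simp
    omega

theorem SpannedBy.reverse {M : List ι} {γ : Fin n → ι} (h : SpannedBy M γ) :
    SpannedBy M.reverse (γ ∘ Fin.rev) := by
  obtain ⟨h1, h2, h3⟩ := h
  rw [SpannedBy, ofFn_rev]
  exact ⟨h1.reverse, by simpa using h3, by simpa using h2⟩

theorem IsNormalOrdering.reverse {V N : Type*} [AddCommGroup V] [Module ℝ V] [AddCommGroup N]
    [Module ℝ N] {P : RootPairing ι ℝ V N} {S : Set ι} {L : List ι} (h : IsNormalOrdering P S L) :
    IsNormalOrdering P S L.reverse where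
  nodup := List.nodup_reverse.2 h.nodup
  mem_iff α := by rw [List.mem_reverse, h.mem_iff]
  between α hα β hβ δ hδ hr := by
    simp only [before_reverse]
    exact (h.between α hα β hβ δ hδ hr).symm.imp And.symm And.symm

theorem before_of_sublist {T : Type*} [Preorder T] {κ : ι → T} {L M : List ι}
    (hL : L.Pairwise fun a b => κ a < κ b) (hM : M.Sublist L) {a b : ι} (ha : a ∈ M) (hb : b ∈ M)
    (h : Before L a b) : Before M a b :=
  before_of_lt (hL.sublist hM) ha hb (h.lt hL)

end Reverse

section SortedLists

variable {ι T : Type*} [LinearOrder T]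

/-- `L` lists the elements of `S` in the strictly increasing order of their values under `κ`. -/
structure IsSortedList (κ : ι → T) (S : Set ι) (L : List ι) : Prop where
  mem_iff : ∀ α, α ∈ L ↔ α ∈ S
  pairwise : L.Pairwise fun a b => κ a < κ b

variable {κ : ι → T} {S S' S'' : Set ι} {L L' : List ι}

theorem IsSortedList.append (h : IsSortedList κ S L) (h' : IsSortedList κ S' L')
    (hlt : ∀ a ∈ S, ∀ b ∈ S', κ a < κ b) (hS : ∀ a, a ∈ S'' ↔ a ∈ S ∨ a ∈ S') :
    IsSortedList κ S'' (L ++ L') where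
  mem_iff α := by rw [List.mem_append, h.mem_iff, h'.mem_iff, hS]
  pairwise := List.pairwise_append.2 ⟨h.pairwise, h'.pairwise, fun a ha b hb =>
    hlt a ((h.mem_iff a).1 ha) b ((h'.mem_iff b).1 hb)⟩

theorem IsSortedList.length_eq (h : IsSortedList κ S L) : L.length = S.ncard :=
  length_eq_ncard (nodup_of_pairwise_lt h.pairwise) h.mem_iff

end SortedLists

section Basis

variable {ι V N : Type*} [AddCommGroup V] [Module ℝ V] [AddCommGroup N] [Module ℝ N]
  {P : RootPairing ι ℝ V N} {s s₁ s₂ : P.weylGroup} {n m : ℕ} {η₁ γ₁ : Fin n → ι}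
  {η₂ γ₂ : Fin m → ι}

theorem span_range_elim (γ₁ : Fin n → ι) (γ₂ : Fin m → ι) :
    Submodule.span ℝ (Set.range (Sum.elim (P.root ∘ γ₁) (P.root ∘ γ₂))) =
      rootSpanOf P γ₁ ⊔ rootSpanOf P γ₂ := by
  rw [Set.Sum.elim_range, Submodule.span_union]
  rfl

theorem IsDecomposition.of_rootSpanOf_eq [Fintype ι] [P.IsRootSystem]
    (hd : IsDecomposition P s s₁ s₂ η₁ η₂)
    (ho₁ : Pairwise fun j k => P.IsOrthogonal (γ₁ j) (γ₁ k))
    (ho₂ : Pairwise fun j k => P.IsOrthogonal (γ₂ j) (γ₂ k))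
    (h₁ : rootSpanOf P γ₁ = rootSpanOf P η₁) (h₂ : rootSpanOf P γ₂ = rootSpanOf P η₂) :
    IsDecomposition P s s₁ s₂ γ₁ γ₂ where
  eq_mul := hd.eq_mul
  eq_prod₁ := hd.eq_prod₁.trans (ofFn_prod_eq_of_rootSpanOf_eq hd.orthogonal₁ ho₁ h₁)
  eq_prod₂ := hd.eq_prod₂.trans (ofFn_prod_eq_of_rootSpanOf_eq hd.orthogonal₂ ho₂ h₂)
  orthogonal₁ := ho₁
  orthogonal₂ := ho₂
  linearIndependent := by
    rw [linearIndependent_iff_card_eq_finrank_span, Set.finrank, span_range_elim, h₁, h₂,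
      ← span_range_elim]
    exact linearIndependent_iff_card_eq_finrank_span.1 hd.linearIndependent
  mem_span_iff y := by
    rw [span_range_elim, h₁, h₂, ← span_range_elim]
    exact hd.mem_span_iff y

theorem IsDecomposition.disjoint_rootSpanOf (hd : IsDecomposition P s s₁ s₂ γ₁ γ₂) :
    Disjoint (rootSpanOf P γ₁) (rootSpanOf P γ₂) := by
  have h := (linearIndependent_sum.1 hd.linearIndependent).2.2
  simpa [Function.comp_def, rootSpanOf] using h

end Basis

section Refinement

variable {ι V N : Type*} [AddCommGroup V] [Module ℝ V] [AddCommGroup N] [Module ℝ N]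
  {P : RootPairing ι ℝ V N} {key : ι → ℝ} {H : N} {D : ℝ → N}

/-- The preorder on the roots by `key` and, for equal keys `t`, by the slope of `D t`. -/
noncomputable def coarseOrder (P : RootPairing ι ℝ V N) (key : ι → ℝ) (H : N) (D : ℝ → N) (α : ι) :
    ℝ ×ₗ ℝ :=
  toLex (key α, P.root' α (D (key α)) / P.root' α H)

theorem coarseOrder_lt_of_key_lt {α β : ι} (h : key α < key β) :
    coarseOrder P key H D α < coarseOrder P key H D β :=
  Prod.Lex.toLex_lt_toLex.2 (Or.inl h)

namespace IsKeyData

variable [Fintype ι] {s s₁ s₂ : P.weylGroup} {c : Choice P s s₁ s₂}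

theorem isConvexOrder_coarseOrder (hk : IsKeyData c key H D)
    : IsConvexOrder P c.pos (coarseOrder P key H D) := by
  intro α hα β hβ δ hδ hr
  have hHα := hk.H_pos α hα
  have hHβ := hk.H_pos β hβ
  obtain ⟨h1, h2⟩ := hk.add α hα β hβ δ hδ hr
  simp only [coarseOrder, Prod.Lex.toLex_lt_toLex, toLex_inj, Prod.mk.injEq]
  constructor
  · rintro (h | ⟨h, h'⟩)
    · obtain ⟨h3, h4⟩ := h1 h
      constructor
      · rcases h3.lt_or_eq with h5 | h5
        · exact Or.inl h5
        · refine Or.inr ⟨h5, ?_⟩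
          have := hk.lt α hα β hβ h
          rw [← h5, root'_eq_of_root_add hr, root'_eq_of_root_add hr]
          exact (lt_mediant hHα hHβ this).1
      · rcases h4.lt_or_eq with h5 | h5
        · exact Or.inl h5
        · refine Or.inr ⟨h5, ?_⟩
          have := hk.gt β hβ α hα h
          rw [h5, root'_eq_of_root_add hr, root'_eq_of_root_add hr]
          exact (lt_mediant hHα hHβ this).2
    · have h5 := h2 h
      rw [← h] at h'
      rw [h5, ← h, root'_eq_of_root_add hr, root'_eq_of_root_add hr]
      have := lt_mediant hHα hHβ h'
      exact ⟨Or.inr ⟨rfl, this.1⟩, Or.inr ⟨rfl, this.2⟩⟩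
  · rintro ⟨h, h'⟩
    have h5 := h2 h
    rw [← h] at h'
    rw [h5, root'_eq_of_root_add hr, root'_eq_of_root_add hr]
    exact ⟨rfl, mediant_eq hHα hHβ h'⟩

theorem negated₁_iff (hk : IsKeyData c key H D) {α : ι} (hα : α ∈ c.pos) :
    s₁ • P.root α = -P.root α ↔ P.root' α (D 1) = 0 := by
  rw [hk.negated₁ α hα]
  refine ⟨And.right, fun h => ⟨?_, h⟩⟩
  rcases lt_trichotomy (key α) 1 with h' | h' | h'
  · exact absurd h (hk.neg₁ α hα h').ne
  · exact h'
  · exact absurd h (hk.pos₁ α hα h').ne'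

theorem negated₂_iff (hk : IsKeyData c key H D) {α : ι} (hα : α ∈ c.pos) :
    s₂ • P.root α = -P.root α ↔ P.root' α (D 5) = 0 := by
  rw [hk.negated₂ α hα]
  refine ⟨And.right, fun h => ⟨?_, h⟩⟩
  rcases lt_trichotomy (key α) 5 with h' | h' | h'
  · exact absurd h (hk.neg₂ α hα h').ne
  · exact h'
  · exact absurd h (hk.pos₂ α hα h').ne'

theorem le_one (hk : IsKeyData c key H D)
    {α : ι} (hα : α ∈ c.pos) (h : P.root' α (D 1) ≤ 0) : key α ≤ 1 :=
  not_lt.1 fun h' => (hk.pos₁ α hα h').not_ge h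

theorem one_le (hk : IsKeyData c key H D)
    {α : ι} (hα : α ∈ c.pos) (h : 0 ≤ P.root' α (D 1)) : 1 ≤ key α :=
  not_lt.1 fun h' => (hk.neg₁ α hα h').not_ge h

theorem le_five (hk : IsKeyData c key H D)
    {α : ι} (hα : α ∈ c.pos) (h : P.root' α (D 5) ≤ 0) : key α ≤ 5 :=
  not_lt.1 fun h' => (hk.pos₂ α hα h').not_ge h

theorem five_le (hk : IsKeyData c key H D)
    {α : ι} (hα : α ∈ c.pos) (h : 0 ≤ P.root' α (D 5)) : 5 ≤ key α :=
  not_lt.1 fun h' => (hk.neg₂ α hα h').not_ge h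

theorem coarseOrder_lt (hk : IsKeyData c key H D)
    {α β : ι} (hα : α ∈ c.pos) (hβ : β ∈ c.pos) {t : ℝ} (h1 : key α ≤ t)
    (h2 : t ≤ key β) (h3 : (P.root' α (D t) < 0 ∧ 0 ≤ P.root' β (D t)) ∨
      (P.root' α (D t) ≤ 0 ∧ 0 < P.root' β (D t))) :
    coarseOrder P key H D α < coarseOrder P key H D β := by
  rcases h1.lt_or_eq with h | h
  · exact coarseOrder_lt_of_key_lt (h.trans_le h2)
  rcases h2.lt_or_eq with h' | h'
  · exact coarseOrder_lt_of_key_lt (h1.trans_lt h')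
  refine Prod.Lex.toLex_lt_toLex.2 (Or.inr ⟨h.trans h', ?_⟩)
  have hHα := hk.H_pos α hα
  have hHβ := hk.H_pos β hβ
  simp only [h, ← h']
  rcases h3 with ⟨h3, h4⟩ | ⟨h3, h4⟩
  · exact (div_neg_of_neg_of_pos h3 hHα).trans_le (div_nonneg h4 hHβ.le)
  · exact (div_nonpos_of_nonpos_of_nonneg h3 hHα.le).trans_lt (div_pos h4 hHβ)

theorem coarseOrder_eq₁ (hk : IsKeyData c key H D)
    {α β : ι} (hα : α ∈ c.pos) (hα₁ : s₁ • P.root α = -P.root α)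
    (hβ : β ∈ c.pos) :
    coarseOrder P key H D α = coarseOrder P key H D β ↔ s₁ • P.root β = -P.root β := by
  obtain ⟨h1, h2⟩ := (hk.negated₁ α hα).1 hα₁
  rw [hk.negated₁ β hβ, coarseOrder, coarseOrder, h1, h2, zero_div, toLex_inj, Prod.mk.injEq]
  constructor
  · rintro ⟨h3, h4⟩
    rw [← h3, eq_comm, div_eq_zero_iff] at h4
    exact ⟨h3.symm, h4.resolve_right (hk.H_pos β hβ).ne'⟩
  · rintro ⟨h3, h4⟩
    rw [h3, h4, zero_div]
    exact ⟨rfl, rfl⟩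

theorem coarseOrder_eq₂ (hk : IsKeyData c key H D)
    {α β : ι} (hα : α ∈ c.pos) (hα₂ : s₂ • P.root α = -P.root α)
    (hβ : β ∈ c.pos) :
    coarseOrder P key H D α = coarseOrder P key H D β ↔ s₂ • P.root β = -P.root β := by
  obtain ⟨h1, h2⟩ := (hk.negated₂ α hα).1 hα₂
  rw [hk.negated₂ β hβ, coarseOrder, coarseOrder, h1, h2, zero_div, toLex_inj, Prod.mk.injEq]
  constructor
  · rintro ⟨h3, h4⟩
    rw [← h3, eq_comm, div_eq_zero_iff] at h4
    exact ⟨h3.symm, h4.resolve_right (hk.H_pos β hβ).ne'⟩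
  · rintro ⟨h3, h4⟩
    rw [h3, h4, zero_div]
    exact ⟨rfl, rfl⟩

theorem not_negated₂ (hk : IsKeyData c key H D)
    {α : ι} (hα : α ∈ c.pos) (h : s₁ • P.root α = -P.root α) :
    ¬ s₂ • P.root α = -P.root α := by
  intro h'
  have h1 := ((hk.negated₁ α hα).1 h).1
  have h2 := ((hk.negated₂ α hα).1 h').1
  linarith

/-- The coarse order has a convex refinement that separates the positive roots and orders the
roots negated by `s₁`, and those negated by `s₂`, as prescribed. -/
theorem exists_refinement (hk : IsKeyData c key H D) [P.IsReduced] {L₁ L₂ : List ι}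
    (h₁ : IsNormalOrdering P {α | α ∈ c.pos ∧ s₁ • P.root α = -P.root α} L₁)
    (h₂ : IsNormalOrdering P {α | α ∈ c.pos ∧ s₂ • P.root α = -P.root α} L₂) :
    ∃ κ : ι → (ℝ ×ₗ ℝ) ×ₗ ℝ, IsConvexOrder P c.pos κ ∧ Set.InjOn κ c.pos ∧
      (∀ α β, coarseOrder P key H D α < coarseOrder P key H D β → κ α < κ β) ∧
      IsSortedList κ {α | α ∈ c.pos ∧ s₁ • P.root α = -P.root α} L₁ ∧
      IsSortedList κ {α | α ∈ c.pos ∧ s₂ • P.root α = -P.root α} L₂ := by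
  classical
  obtain ⟨f, hf⟩ := exists_generic_slope (P := P) c.height
  let σ : ι → ℝ := fun α => if s₁ • P.root α = -P.root α then (L₁.idxOf α : ℝ) else
    if s₂ • P.root α = -P.root α then (L₂.idxOf α : ℝ) else
      f (P.root α) / c.height (P.root α)
  have hσ₁ : ∀ α ∈ c.pos, s₁ • P.root α = -P.root α → σ α = L₁.idxOf α := fun α _ h => if_pos h
  have hσ₂ : ∀ α ∈ c.pos, s₂ • P.root α = -P.root α → σ α = L₂.idxOf α := fun α hα h => by
    simp only [σ]
    rw [if_neg fun h' => hk.not_negated₂ hα h' h, if_pos h]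
  have hcast : ∀ {S : Set ι} {κ : ι → ℕ}, IsConvexOrder P S κ →
      IsConvexOrder P S fun α => (κ α : ℝ) := by
    intro S κ h α hα β hβ δ hδ hr
    simpa only [Nat.cast_lt, Nat.cast_inj] using h α hα β hβ δ hδ hr
  have hclass : ∀ t, IsConvexOrder P {α | α ∈ c.pos ∧ coarseOrder P key H D α = t} σ := by
    intro t
    by_cases ht₁ : ∃ β ∈ c.pos, coarseOrder P key H D β = t ∧ s₁ • P.root β = -P.root β
    · obtain ⟨β, hβ, rfl, hβ₁⟩ := ht₁
      have h : ∀ α ∈ {α | α ∈ c.pos ∧ coarseOrder P key H D α = coarseOrder P key H D β},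
          s₁ • P.root α = -P.root α := fun α hα => (hk.coarseOrder_eq₁ hβ hβ₁ hα.1).1 hα.2.symm
      exact ((hcast h₁.isConvexOrder_idxOf).mono fun α hα => ⟨hα.1, h α hα⟩).congr
        fun α hα => hσ₁ α hα.1 (h α hα)
    by_cases ht₂ : ∃ β ∈ c.pos, coarseOrder P key H D β = t ∧ s₂ • P.root β = -P.root β
    · obtain ⟨β, hβ, rfl, hβ₁⟩ := ht₂
      have h : ∀ α ∈ {α | α ∈ c.pos ∧ coarseOrder P key H D α = coarseOrder P key H D β},
          s₂ • P.root α = -P.root α := fun α hα => (hk.coarseOrder_eq₂ hβ hβ₁ hα.1).1 hα.2.symm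
      exact ((hcast h₂.isConvexOrder_idxOf).mono fun α hα => ⟨hα.1, h α hα⟩).congr
        fun α hα => hσ₂ α hα.1 (h α hα)
    · refine (isConvexOrder_slope f c.height fun α hα => hα.1).congr fun α hα => ?_
      simp only [σ]
      rw [if_neg fun h => ht₁ ⟨α, hα.1, hα.2, h⟩, if_neg fun h => ht₂ ⟨α, hα.1, hα.2, h⟩]
  refine ⟨fun α => toLex (coarseOrder P key H D α, σ α), hk.isConvexOrder_coarseOrder.lex hclass,
    ?_, fun α β h => Prod.Lex.toLex_lt_toLex.2 (Or.inl h), ⟨h₁.mem_iff, ?_⟩, ⟨h₂.mem_iff, ?_⟩⟩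
  · intro α hα β hβ h
    simp only [toLex_inj, Prod.mk.injEq] at h
    obtain ⟨h, h'⟩ := h
    by_cases hα₁ : s₁ • P.root α = -P.root α
    · have hβ₁ := (hk.coarseOrder_eq₁ hα hα₁ hβ).1 h
      rw [hσ₁ α hα hα₁, hσ₁ β hβ hβ₁, Nat.cast_inj] at h'
      exact (List.idxOf_inj ((h₁.mem_iff α).2 ⟨hα, hα₁⟩)).1 h'
    by_cases hα₂ : s₂ • P.root α = -P.root α
    · have hβ₂ := (hk.coarseOrder_eq₂ hα hα₂ hβ).1 h
      rw [hσ₂ α hα hα₂, hσ₂ β hβ hβ₂, Nat.cast_inj] at h'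
      exact (List.idxOf_inj ((h₂.mem_iff α).2 ⟨hα, hα₂⟩)).1 h'
    · have hβ₁ := fun hβ₁ => hα₁ ((hk.coarseOrder_eq₁ hβ hβ₁ hα).1 h.symm)
      have hβ₂ := fun hβ₂ => hα₂ ((hk.coarseOrder_eq₂ hβ hβ₂ hα).1 h.symm)
      simp only [σ] at h'
      rw [if_neg hα₁, if_neg hα₂, if_neg hβ₁, if_neg hβ₂] at h'
      exact hf hα hβ h'
  · refine (pairwise_idxOf h₁.nodup).imp_of_mem fun {a b} ha hb hab => ?_
    obtain ⟨ha, ha'⟩ := (h₁.mem_iff a).1 ha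
    obtain ⟨hb, hb'⟩ := (h₁.mem_iff b).1 hb
    refine Prod.Lex.toLex_lt_toLex.2 (Or.inr ⟨(hk.coarseOrder_eq₁ ha ha' hb).2 hb', ?_⟩)
    simp only [hσ₁ a ha ha', hσ₁ b hb hb']
    exact_mod_cast hab
  · refine (pairwise_idxOf h₂.nodup).imp_of_mem fun {a b} ha hb hab => ?_
    obtain ⟨ha, ha'⟩ := (h₂.mem_iff a).1 ha
    obtain ⟨hb, hb'⟩ := (h₂.mem_iff b).1 hb
    refine Prod.Lex.toLex_lt_toLex.2 (Or.inr ⟨(hk.coarseOrder_eq₂ ha ha' hb).2 hb', ?_⟩)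
    simp only [hσ₂ a ha ha', hσ₂ b hb hb']
    exact_mod_cast hab

end IsKeyData

end Refinement

section Segments

variable {ι V N : Type*} [Fintype ι] [AddCommGroup V] [Module ℝ V] [AddCommGroup N] [Module ℝ N]
  {P : RootPairing ι ℝ V N} {s s₁ s₂ : P.weylGroup} {c : Choice P s s₁ s₂} {key : ι → ℝ} {H : N}
  {D : ℝ → N}

/-- The positive roots, sorted by a convex refinement `κ` of the coarse order, and the segments that
the keys and the signs of `D 1` and `D 5` cut out. -/
structure IsSegmentation (c : Choice P s s₁ s₂) (key : ι → ℝ) (D : ℝ → N)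
    (κ : ι → (ℝ ×ₗ ℝ) ×ₗ ℝ) (A₁ L₁ C₁ R₁ R₂ A₂ L₂ C₂ Z : List ι) : Prop where
  convex : IsConvexOrder P c.pos κ
  sorted : IsSortedList κ c.pos (A₁ ++ (L₁ ++ (C₁ ++ (R₁ ++ (R₂ ++ (A₂ ++ (L₂ ++ (C₂ ++ Z))))))))
  lt_of_key_lt : ∀ α β, key α < key β → κ α < κ β
  lt_of_pos : ∀ α ∈ c.pos, ∀ β ∈ c.pos, s₁ • P.root α = -P.root α → 0 < P.root' β (D 1) → κ α < κ β
  lt_of_neg : ∀ α ∈ c.pos, ∀ β ∈ c.pos, P.root' α (D 5) < 0 → s₂ • P.root β = -P.root β → κ α < κ β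
  mem_A₁ : ∀ α, α ∈ A₁ ↔ α ∈ c.pos ∧ P.root' α (D 1) < 0
  mem_L₁ : ∀ α, α ∈ L₁ ↔ α ∈ c.pos ∧ s₁ • P.root α = -P.root α
  mem_C₁ : ∀ α, α ∈ C₁ ↔ α ∈ c.pos ∧ 0 < P.root' α (D 1) ∧ key α < 2
  mem_R₁ : ∀ α, α ∈ R₁ ↔ α ∈ c.pos ∧ 2 ≤ key α ∧ key α ≤ 3
  mem_R₂ : ∀ α, α ∈ R₂ ↔ α ∈ c.pos ∧ 3 < key α ∧ key α ≤ 4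
  mem_A₂ : ∀ α, α ∈ A₂ ↔ α ∈ c.pos ∧ 4 < key α ∧ P.root' α (D 5) < 0
  mem_L₂ : ∀ α, α ∈ L₂ ↔ α ∈ c.pos ∧ s₂ • P.root α = -P.root α
  mem_C₂ : ∀ α, α ∈ C₂ ↔ α ∈ c.pos ∧ 0 < P.root' α (D 5) ∧ key α < 6
  mem_Z : ∀ α, α ∈ Z ↔ α ∈ c.pos ∧ 6 ≤ key α

theorem IsKeyData.exists_isSegmentation [P.IsReduced] (hk : IsKeyData c key H D) {L₁ L₂ : List ι}
    (h₁ : IsNormalOrdering P {α | α ∈ c.pos ∧ s₁ • P.root α = -P.root α} L₁)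
    (h₂ : IsNormalOrdering P {α | α ∈ c.pos ∧ s₂ • P.root α = -P.root α} L₂) :
    ∃ κ A₁ C₁ R₁ R₂ A₂ C₂ Z, IsSegmentation c key D κ A₁ L₁ C₁ R₁ R₂ A₂ L₂ C₂ Z := by
  obtain ⟨κ, hconv, hinj, hlt, hL₁, hL₂⟩ := hk.exists_refinement h₁ h₂
  have hsort : ∀ p : ι → Prop, ∃ L, IsSortedList κ {α | α ∈ c.pos ∧ p α} L := fun p => by
    obtain ⟨L, h, h'⟩ := exists_sorted_list κ {α | α ∈ c.pos ∧ p α} (hinj.mono fun α h => h.1)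
    exact ⟨L, h, h'⟩
  have hkey : ∀ α β, key α < key β → κ α < κ β := fun α β h => hlt _ _ (coarseOrder_lt_of_key_lt h)
  obtain ⟨A₁, hA₁⟩ := hsort fun α => P.root' α (D 1) < 0
  obtain ⟨C₁, hC₁⟩ := hsort fun α => 0 < P.root' α (D 1) ∧ key α < 2
  obtain ⟨R₁, hR₁⟩ := hsort fun α => 2 ≤ key α ∧ key α ≤ 3
  obtain ⟨R₂, hR₂⟩ := hsort fun α => 3 < key α ∧ key α ≤ 4
  obtain ⟨A₂, hA₂⟩ := hsort fun α => 4 < key α ∧ P.root' α (D 5) < 0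
  obtain ⟨C₂, hC₂⟩ := hsort fun α => 0 < P.root' α (D 5) ∧ key α < 6
  obtain ⟨Z, hZ⟩ := hsort fun α => 6 ≤ key α
  have x8 : IsSortedList κ {α | α ∈ c.pos ∧ 0 < P.root' α (D 5)} (C₂ ++ Z) := by
    refine hC₂.append hZ (fun a ha b hb => hkey a b (ha.2.2.trans_le hb.2)) fun a => ?_
    have := hk.pos₂ a
    simp only [Set.mem_ofPred_eq]
    constructor
    · rintro ⟨h, h'⟩
      rcases lt_or_ge (key a) 6 with h6 | h6
      · exact Or.inl ⟨h, h', h6⟩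
      · exact Or.inr ⟨h, h6⟩
    · rintro (⟨h, h', -⟩ | ⟨h, h'⟩)
      · exact ⟨h, h'⟩
      · exact ⟨h, this h (by linarith)⟩
  have x7 : IsSortedList κ {α | α ∈ c.pos ∧ 0 ≤ P.root' α (D 5)} (L₂ ++ (C₂ ++ Z)) := by
    refine hL₂.append x8 ?_ fun a => ?_
    · rintro a ⟨ha, ha'⟩ b ⟨hb, hb'⟩
      rw [hk.negated₂_iff ha] at ha'
      exact hlt _ _ (hk.coarseOrder_lt ha hb (hk.le_five ha ha'.le) (hk.five_le hb hb'.le)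
        (Or.inr ⟨ha'.le, hb'⟩))
    · simp only [Set.mem_ofPred_eq, ← and_or_left]
      refine and_congr_right fun h => ?_
      rw [hk.negated₂_iff h, le_iff_eq_or_lt, eq_comm]
  have x6 : IsSortedList κ {α | α ∈ c.pos ∧ 4 < key α} (A₂ ++ (L₂ ++ (C₂ ++ Z))) := by
    refine hA₂.append x7 ?_ fun a => ?_
    · rintro a ⟨ha, -, ha'⟩ b ⟨hb, hb'⟩
      exact hlt _ _ (hk.coarseOrder_lt ha hb (hk.le_five ha ha'.le) (hk.five_le hb hb')
        (Or.inl ⟨ha', hb'⟩))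
    · simp only [Set.mem_ofPred_eq, ← and_or_left]
      refine and_congr_right fun h => ⟨fun h' => ?_, ?_⟩
      · rcases lt_or_ge (P.root' a (D 5)) 0 with h0 | h0
        · exact Or.inl ⟨h', h0⟩
        · exact Or.inr h0
      · rintro (h' | h')
        · exact h'.1
        · linarith [hk.five_le h h']
  have x5 : IsSortedList κ {α | α ∈ c.pos ∧ 3 < key α} (R₂ ++ (A₂ ++ (L₂ ++ (C₂ ++ Z)))) := by
    refine hR₂.append x6 (fun a ha b hb => hkey a b (ha.2.2.trans_lt hb.2)) fun a => ?_
    simp only [Set.mem_ofPred_eq, ← and_or_left]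
    refine and_congr_right fun h => ⟨fun h' => ?_, ?_⟩
    · exact (le_or_gt (key a) 4).imp (fun h0 => ⟨h', h0⟩) id
    · rintro (h' | h')
      · exact h'.1
      · linarith
  have x4 : IsSortedList κ {α | α ∈ c.pos ∧ 2 ≤ key α}
      (R₁ ++ (R₂ ++ (A₂ ++ (L₂ ++ (C₂ ++ Z))))) := by
    refine hR₁.append x5 (fun a ha b hb => hkey a b (ha.2.2.trans_lt hb.2)) fun a => ?_
    simp only [Set.mem_ofPred_eq, ← and_or_left]
    refine and_congr_right fun h => ⟨fun h' => ?_, ?_⟩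
    · exact (le_or_gt (key a) 3).imp (fun h0 => ⟨h', h0⟩) id
    · rintro (h' | h')
      · exact h'.1
      · linarith
  have x3 : IsSortedList κ {α | α ∈ c.pos ∧ 0 < P.root' α (D 1)}
      (C₁ ++ (R₁ ++ (R₂ ++ (A₂ ++ (L₂ ++ (C₂ ++ Z)))))) := by
    refine hC₁.append x4 (fun a ha b hb => hkey a b (ha.2.2.trans_le hb.2)) fun a => ?_
    simp only [Set.mem_ofPred_eq, ← and_or_left]
    refine and_congr_right fun h => ⟨fun h' => ?_, ?_⟩
    · exact (lt_or_ge (key a) 2).imp (fun h0 => ⟨h', h0⟩) id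
    · rintro (h' | h')
      · exact h'.1
      · exact hk.pos₁ a h (by linarith)
  have hpos₁ : ∀ a ∈ c.pos, ∀ b ∈ c.pos, s₁ • P.root a = -P.root a → 0 < P.root' b (D 1) →
      κ a < κ b := by
    intro a ha b hb ha' hb'
    rw [hk.negated₁_iff ha] at ha'
    exact hlt _ _ (hk.coarseOrder_lt ha hb (hk.le_one ha ha'.le) (hk.one_le hb hb'.le)
      (Or.inr ⟨ha'.le, hb'⟩))
  have x2 : IsSortedList κ {α | α ∈ c.pos ∧ 0 ≤ P.root' α (D 1)}
      (L₁ ++ (C₁ ++ (R₁ ++ (R₂ ++ (A₂ ++ (L₂ ++ (C₂ ++ Z))))))) := by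
    refine hL₁.append x3 (fun a ha b hb => hpos₁ a ha.1 b hb.1 ha.2 hb.2) fun a => ?_
    simp only [Set.mem_ofPred_eq, ← and_or_left]
    refine and_congr_right fun h => ?_
    rw [hk.negated₁_iff h, le_iff_eq_or_lt, eq_comm]
  have x1 : IsSortedList κ c.pos
      (A₁ ++ (L₁ ++ (C₁ ++ (R₁ ++ (R₂ ++ (A₂ ++ (L₂ ++ (C₂ ++ Z)))))))) := by
    refine hA₁.append x2 ?_ fun a => ?_
    · rintro a ⟨ha, ha'⟩ b ⟨hb, hb'⟩
      exact hlt _ _ (hk.coarseOrder_lt ha hb (hk.le_one ha ha'.le) (hk.one_le hb hb')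
        (Or.inl ⟨ha', hb'⟩))
    · simp only [Set.mem_ofPred_eq, ← and_or_left]
      exact ⟨fun h => ⟨h, lt_or_ge _ _⟩, And.left⟩
  refine ⟨κ, A₁, C₁, R₁, R₂, A₂, C₂, Z, hconv, x1, hkey, hpos₁, ?_, hA₁.mem_iff, h₁.mem_iff,
    hC₁.mem_iff, hR₁.mem_iff, hR₂.mem_iff, hA₂.mem_iff, h₂.mem_iff, hC₂.mem_iff, hZ.mem_iff⟩
  intro a ha b hb ha' hb'
  rw [hk.negated₂_iff hb] at hb'
  exact hlt _ _ (hk.coarseOrder_lt ha hb (hk.le_five ha ha'.le) (hk.five_le hb hb'.ge)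
    (Or.inl ⟨ha', hb'.ge⟩))

end Segments

section Properties

variable {ι V N : Type*} [Fintype ι] [AddCommGroup V] [Module ℝ V] [AddCommGroup N] [Module ℝ N]
  {P : RootPairing ι ℝ V N} {s s₁ s₂ : P.weylGroup} {c : Choice P s s₁ s₂} {key : ι → ℝ} {H : N}
  {D : ℝ → N} {κ : ι → (ℝ ×ₗ ℝ) ×ₗ ℝ} {A₁ L₁ C₁ R₁ R₂ A₂ L₂ C₂ Z : List ι}

namespace IsKeyData

theorem disjoint_inversions (hk : IsKeyData c key H D)
    : Disjoint (inversions P c.pos s₁) (inversions P c.pos s₂) := by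
  rw [Set.disjoint_left]
  intro α h₁ h₂
  have h1 := (hk.inv₁ α h₁.1).1 h₁
  have h2 := (hk.inv₂ α h₂.1).1 h₂
  linarith

theorem mem_layer_zero_of_smul_eq (hk : IsKeyData c key H D)
    {α : ι} (h : s • P.root α = P.root α) : α ∈ layer P c.h 0 := by
  rcases lt_or_gt_of_ne (c.height_ne_zero α) with hα | hα
  · obtain ⟨β, hβ⟩ := exists_root_neg (P := P) α
    have hβpos : β ∈ c.pos := by
      rw [c.pos_eq, mem_posOf, hβ, map_neg]
      exact neg_pos.2 hα
    have hβ0 := (hk.mem_layer_zero β hβpos).1 (by rw [hβ, smul_neg, h])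
    have hroot : ∀ x, P.root' β x = -P.root' α x := fun x => by
      simp only [RootPairing.root', hβ, map_neg, LinearMap.neg_apply]
    refine ⟨fun j hj => ?_, fun h0 => hβ0.2 ?_⟩
    · have := hβ0.1 j hj
      rwa [hroot, neg_eq_zero] at this
    · rw [hroot, h0, neg_zero]
  · exact (hk.mem_layer_zero α hα).1 h

theorem add_lower_mem_pos (hk : IsKeyData c key H D)
    {k j : Fin (c.K + 1)} {α β δ : ι} (hα : α ∈ layer P c.h k)
    (hpos : α ∈ c.pos) (hjk : j < k) (hβ : β ∈ layer P c.h j)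
    (hδ : P.root δ = P.root α + P.root β) : δ ∈ c.pos ∧ key δ = key α := by
  obtain ⟨h, h'⟩ := Choice.add_mem_layer hα hβ hjk hδ
  refine ⟨?_, hk.add_lower k α hα j hjk β hβ δ hδ⟩
  rw [c.mem_pos_iff_of_mem_layer h, h' _ (c.h_mem k)]
  exact (c.mem_pos_iff_of_mem_layer hα).1 hpos

end IsKeyData

namespace IsSegmentation

theorem mem_inversions₁ (hk : IsKeyData c key H D)
    (hs : IsSegmentation c key D κ A₁ L₁ C₁ R₁ R₂ A₂ L₂ C₂ Z)
    (α : ι) :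
    α ∈ A₁ ++ (L₁ ++ C₁) ↔ α ∈ inversions P c.pos s₁ := by
  simp only [List.mem_append, hs.mem_A₁, hs.mem_L₁, hs.mem_C₁]
  by_cases hα : α ∈ c.pos
  · rw [hk.inv₁ α hα, hk.negated₁_iff hα]
    simp only [hα, true_and]
    constructor
    · rintro (h | h | h)
      · linarith [hk.le_one hα h.le]
      · linarith [hk.le_one hα h.le]
      · exact h.2
    · intro h
      rcases lt_trichotomy (P.root' α (D 1)) 0 with h' | h' | h'
      · exact Or.inl h'
      · exact Or.inr (Or.inl h')
      · exact Or.inr (Or.inr ⟨h', h⟩)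
  · simp only [hα, false_and, or_false, false_iff]
    exact fun h => hα h.1

theorem mem_inversions₂ (hk : IsKeyData c key H D)
    (hs : IsSegmentation c key D κ A₁ L₁ C₁ R₁ R₂ A₂ L₂ C₂ Z)
    (α : ι) :
    α ∈ A₂ ++ (L₂ ++ C₂) ↔ α ∈ inversions P c.pos s₂ := by
  simp only [List.mem_append, hs.mem_A₂, hs.mem_L₂, hs.mem_C₂]
  by_cases hα : α ∈ c.pos
  · rw [hk.inv₂ α hα, hk.negated₂_iff hα]
    simp only [hα, true_and]
    constructor
    · rintro (h | h | h)
      · exact ⟨h.1, by linarith [hk.le_five hα h.2.le]⟩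
      · exact ⟨by linarith [hk.five_le hα h.ge], by linarith [hk.le_five hα h.le]⟩
      · exact ⟨by linarith [hk.five_le hα h.1.le], h.2⟩
    · intro h
      rcases lt_trichotomy (P.root' α (D 5)) 0 with h' | h' | h'
      · exact Or.inl ⟨h.1, h'⟩
      · exact Or.inr (Or.inl h')
      · exact Or.inr (Or.inr ⟨h', h.2⟩)
  · simp only [hα, false_and, or_false, false_iff]
    exact fun h => hα h.1

theorem mem_inversions (hk : IsKeyData c key H D)
    (hs : IsSegmentation c key D κ A₁ L₁ C₁ R₁ R₂ A₂ L₂ C₂ Z)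
    
    (hdisj : Disjoint (inversions P c.pos s₁) ((s₂ • ·) '' inversions P c.pos s₁)) (α : ι) :
    α ∈ R₂ ++ (A₂ ++ (L₂ ++ C₂)) ↔ α ∈ inversions P c.pos s := by
  rw [List.mem_append, mem_inversions₂ hk hs, hs.mem_R₂]
  by_cases hα : α ∈ c.pos
  · rw [hk.inv hdisj α hα, hk.inv₂ α hα]
    simp only [hα, true_and]
    constructor
    · rintro (h | h)
      · exact ⟨h.1, by linarith⟩
      · exact ⟨by linarith, h.2⟩
    · intro h
      exact (le_or_gt (key α) 4).imp (fun h' => ⟨h.1, h'⟩) fun h' => ⟨h', h.2⟩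
  · simp only [hα, false_and, false_or]
    exact ⟨fun h => absurd h.1 hα, fun h => absurd h.1 hα⟩

theorem mem_Z_iff (hk : IsKeyData c key H D)
    (hs : IsSegmentation c key D κ A₁ L₁ C₁ R₁ R₂ A₂ L₂ C₂ Z)
    (α : ι) : α ∈ Z ↔ α ∈ c.pos ∧ s • P.root α = P.root α := by
  rw [hs.mem_Z]
  refine and_congr_right fun hα => ⟨fun h => ?_, fun h => ?_⟩
  · by_contra h'
    exact (hk.lt_six α hα h').not_ge h
  · rw [hk.eq_seven α hα h]
    norm_num

theorem length_A₁ (hk : IsKeyData c key H D)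
    (hs : IsSegmentation c key D κ A₁ L₁ C₁ R₁ R₂ A₂ L₂ C₂ Z)
    (hw : s₁ * s₁ = 1) : A₁.length = C₁.length := by
  have hnd := nodup_of_pairwise_lt hs.sorted.pairwise
  have h1 : ∀ α, α ∈ A₁ ↔ α ∈ {α | α ∈ inversions P c.pos s₁ ∧ P.root' α (D 1) < 0} := by
    intro α
    rw [hs.mem_A₁]
    refine ⟨fun h => ⟨?_, h.2⟩, fun h => ⟨h.1.1, h.2⟩⟩
    rw [hk.inv₁ α h.1]
    linarith [hk.le_one h.1 h.2.le]
  have h2 : ∀ α, α ∈ C₁ ↔ α ∈ {α | α ∈ inversions P c.pos s₁ ∧ 0 < P.root' α (D 1)} := by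
    intro α
    rw [hs.mem_C₁]
    exact ⟨fun h => ⟨(hk.inv₁ α h.1).2 h.2.2, h.2.1⟩,
      fun h => ⟨h.1.1, h.2, (hk.inv₁ α h.1.1).1 h.1⟩⟩
  rw [length_eq_ncard (hnd.sublist (by simp)) h1, length_eq_ncard (hnd.sublist ?_) h2]
  · rw [c.pos_eq]
    exact ncard_inversions_neg_eq (g := c.height) hw hk.fixed₁
  · exact (List.sublist_append_left _ _).trans
      ((List.sublist_append_right _ _).trans (List.sublist_append_right _ _))

theorem length_A₂ (hk : IsKeyData c key H D)
    (hs : IsSegmentation c key D κ A₁ L₁ C₁ R₁ R₂ A₂ L₂ C₂ Z)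
    (hw : s₂ * s₂ = 1) : A₂.length = C₂.length := by
  have hnd := nodup_of_pairwise_lt hs.sorted.pairwise
  have h1 : ∀ α, α ∈ A₂ ↔ α ∈ {α | α ∈ inversions P c.pos s₂ ∧ P.root' α (D 5) < 0} := by
    intro α
    rw [hs.mem_A₂]
    refine ⟨fun h => ⟨?_, h.2.2⟩, fun h => ⟨h.1.1, ((hk.inv₂ α h.1.1).1 h.1).1, h.2⟩⟩
    rw [hk.inv₂ α h.1]
    exact ⟨h.2.1, by linarith [hk.le_five h.1 h.2.2.le]⟩
  have h2 : ∀ α, α ∈ C₂ ↔ α ∈ {α | α ∈ inversions P c.pos s₂ ∧ 0 < P.root' α (D 5)} := by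
    intro α
    rw [hs.mem_C₂]
    refine ⟨fun h => ⟨(hk.inv₂ α h.1).2 ⟨?_, h.2.2⟩, h.2.1⟩,
      fun h => ⟨h.1.1, h.2, ((hk.inv₂ α h.1.1).1 h.1).2⟩⟩
    linarith [hk.five_le h.1 h.2.1.le]
  rw [length_eq_ncard (hnd.sublist ?_) h1, length_eq_ncard (hnd.sublist ?_) h2]
  · rw [c.pos_eq]
    exact ncard_inversions_neg_eq (g := c.height) hw hk.fixed₂
  · iterate 7 refine List.Sublist.trans ?_ (List.sublist_append_right _ _)
    exact List.sublist_append_left _ _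
  · iterate 5 refine List.Sublist.trans ?_ (List.sublist_append_right _ _)
    exact List.sublist_append_left _ _

theorem length_eq (hk : IsKeyData c key H D)
    (hs : IsSegmentation c key D κ A₁ L₁ C₁ R₁ R₂ A₂ L₂ C₂ Z)
    [P.IsReduced] [P.IsCrystallographic] {n m : ℕ} {η₁ : Fin n → ι} {η₂ : Fin m → ι}
    (hd : IsDecomposition P s s₁ s₂ η₁ η₂) :
    length P c.pos s = 2 * C₁.length + L₁.length + (2 * A₂.length + L₂.length) := by
  have hnd := nodup_of_pairwise_lt hs.sorted.pairwise
  have h1 := length_eq_ncard (L := A₁ ++ (L₁ ++ C₁)) (hnd.sublist (by simp))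
    (hs.mem_inversions₁ hk)
  have h2 := length_eq_ncard (L := A₂ ++ (L₂ ++ C₂)) (hnd.sublist ?_) (hs.mem_inversions₂ hk)
  · have h3 := length_mul (P := P) (g := c.height) c.height_ne_zero hd.mul_self₂
      hk.disjoint_inversions
    rw [length_eq_ncard_inversions (w := s₁) c.height_ne_zero,
      length_eq_ncard_inversions (w := s₂) c.height_ne_zero, ← c.pos_eq, ← hd.eq_mul,
      ← h1, ← h2] at h3
    have h4 := hs.length_A₁ hk hd.mul_self₁
    have h5 := hs.length_A₂ hk hd.mul_self₂
    simp only [List.length_append] at h3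
    omega
  · iterate 5 refine List.Sublist.trans ?_ (List.sublist_append_right _ _)
    simp

/-- What membership in the part of the ordering between the first root of `γ₁` and the last root of
`γ₂` means for the signs of `D 1` and `D 5`. -/
theorem mem_middle (hk : IsKeyData c key H D)
    (hs : IsSegmentation c key D κ A₁ L₁ C₁ R₁ R₂ A₂ L₂ C₂ Z)
    {B₁ M₁ M₂ B₂ : List ι} (hL₁ : L₁ = B₁ ++ M₁) (hL₂ : L₂ = M₂ ++ B₂) {α : ι}
    (hα : α ∈ M₁ ++ C₁ ++ (R₁ ++ R₂) ++ A₂ ++ M₂) :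
    α ∈ c.pos ∧ 0 ≤ P.root' α (D 1) ∧ P.root' α (D 5) ≤ 0 ∧
      (P.root' α (D 1) = 0 → α ∈ M₁) ∧ (P.root' α (D 5) = 0 → α ∈ M₂) := by
  have hgt : α ∈ c.pos → 1 < key α → 0 ≤ P.root' α (D 1) ∧ (P.root' α (D 1) = 0 → α ∈ M₁) :=
    fun h h' => ⟨(hk.pos₁ α h h').le, fun h0 => absurd h0 (hk.pos₁ α h h').ne'⟩
  have hlt : α ∈ c.pos → key α < 5 → P.root' α (D 5) ≤ 0 ∧ (P.root' α (D 5) = 0 → α ∈ M₂) :=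
    fun h h' => ⟨(hk.neg₂ α h h').le, fun h0 => absurd h0 (hk.neg₂ α h h').ne⟩
  simp only [List.mem_append] at hα
  rcases hα with (((h | h) | h | h) | h) | h
  · have h' := (hs.mem_L₁ α).1 (by rw [hL₁]; exact List.mem_append_right _ h)
    obtain ⟨h1, h2⟩ := (hk.negated₁ α h'.1).1 h'.2
    obtain ⟨h3, h4⟩ := hlt h'.1 (by linarith)
    exact ⟨h'.1, h2.ge, h3, fun _ => h, h4⟩
  · have h' := (hs.mem_C₁ α).1 h
    obtain ⟨h3, h4⟩ := hlt h'.1 (by linarith)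
    exact ⟨h'.1, h'.2.1.le, h3, fun h0 => absurd h0 h'.2.1.ne', h4⟩
  · have h' := (hs.mem_R₁ α).1 h
    obtain ⟨h1, h2⟩ := hgt h'.1 (by linarith)
    obtain ⟨h3, h4⟩ := hlt h'.1 (by linarith)
    exact ⟨h'.1, h1, h3, h2, h4⟩
  · have h' := (hs.mem_R₂ α).1 h
    obtain ⟨h1, h2⟩ := hgt h'.1 (by linarith)
    obtain ⟨h3, h4⟩ := hlt h'.1 (by linarith)
    exact ⟨h'.1, h1, h3, h2, h4⟩
  · have h' := (hs.mem_A₂ α).1 h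
    obtain ⟨h1, h2⟩ := hgt h'.1 (by linarith)
    exact ⟨h'.1, h1, h'.2.2.le, h2, fun h0 => absurd h0 h'.2.2.ne⟩
  · have h' := (hs.mem_L₂ α).1 (by rw [hL₂]; exact List.mem_append_left _ h)
    obtain ⟨h5, h6⟩ := (hk.negated₂ α h'.1).1 h'.2
    obtain ⟨h1, h2⟩ := hgt h'.1 (by linarith)
    exact ⟨h'.1, h1, h6.le, h2, fun _ => h⟩

theorem not_sumRepresentable (hk : IsKeyData c key H D)
    (hs : IsSegmentation c key D κ A₁ L₁ C₁ R₁ R₂ A₂ L₂ C₂ Z)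
    {n m : ℕ} {γ₁ : Fin n → ι} {γ₂ : Fin m → ι} {S₁ S₂ : Set ι}
    {B₁ M₁ B₂ M₂ L : List ι} (hL₁ : L₁ = B₁ ++ M₁) (hL₂ : L₂ = M₂.reverse ++ B₂.reverse)
    (hL : L = A₁ ++ (L₁ ++ (C₁ ++ (R₁ ++ (R₂ ++ (A₂ ++ (L₂ ++ (C₂ ++ Z))))))))
    (h₁ : IsOrthogonalOrdering P S₁ γ₁ B₁ M₁) (h₂ : IsOrthogonalOrdering P S₂ γ₂ B₂ M₂)
    (hdisj : Disjoint (rootSpanOf P γ₁) (rootSpanOf P (γ₂ ∘ Fin.rev)))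
    (hmem₁ : ∀ α ∈ M₁, P.root α ∈ rootSpanOf P γ₁)
    (hmem₂ : ∀ α ∈ M₂, P.root α ∈ rootSpanOf P (γ₂ ∘ Fin.rev)) {α β : ι}
    (hα : α ∈ M₁ ++ C₁ ++ (R₁ ++ R₂) ++ A₂ ++ M₂.reverse)
    (hβ : β ∈ M₁ ++ C₁ ++ (R₁ ++ R₂) ++ A₂ ++ M₂.reverse) :
    ¬ SumRepresentable P L γ₁ (γ₂ ∘ Fin.rev) α β := by
  rintro ⟨c₁, c₂, hc₁, hc₂, hsum⟩
  have hpw : L.Pairwise fun a b => κ a < κ b := hL ▸ hs.sorted.pairwise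
  have hsub₁ : M₁.Sublist L := by
    rw [hL, hL₁]
    refine List.Sublist.trans ?_ (List.sublist_append_right _ _)
    exact (List.sublist_append_right _ _).trans (List.sublist_append_left _ _)
  have hsub₂ : M₂.reverse.Sublist L := by
    rw [hL, hL₂]
    iterate 6 refine List.Sublist.trans ?_ (List.sublist_append_right _ _)
    exact (List.sublist_append_left _ _).trans (List.sublist_append_left _ _)
  obtain ⟨hα0, hα1, hα2, hα3, hα4⟩ := hs.mem_middle hk hL₁ hL₂ hα
  obtain ⟨hβ0, hβ1, hβ2, hβ3, hβ4⟩ := hs.mem_middle hk hL₁ hL₂ hβ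
  have hγ₁ : ∀ k, γ₁ k ∈ c.pos ∧ s₁ • P.root (γ₁ k) = -P.root (γ₁ k) := fun k =>
    (hs.mem_L₁ _).1 (by rw [hL₁]; exact List.mem_append_right _ (h₁.spanned.mem k))
  have hγ₂ : ∀ k, γ₂ k ∈ c.pos ∧ s₂ • P.root (γ₂ k) = -P.root (γ₂ k) := fun k =>
    (hs.mem_L₂ _).1 (by
      rw [hL₂]; exact List.mem_append_left _ (List.mem_reverse.2 (h₂.spanned.mem k)))
  have hval : ∀ x, P.root' α x + P.root' β x =
      ∑ k, (c₁ k : ℝ) * P.root' (γ₁ k) x + ∑ k, (c₂ k : ℝ) * P.root' (γ₂ (Fin.rev k)) x := by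
    intro x
    have := congrArg (fun y => P.toLinearMap y x) hsum
    simpa [RootPairing.root'] using this
  by_cases hz₂ : ∀ k, c₂ k = 0
  · have h0 : P.root' α (D 1) + P.root' β (D 1) = 0 := by
      rw [hval]
      simp [hz₂, fun k => ((hk.negated₁ _ (hγ₁ k).1).1 (hγ₁ k).2).2]
    have hαM := hα3 (by linarith)
    have hβM := hβ3 (by linarith)
    refine h₁.add_ne α hαM β hβM c₁ (fun k hk => ?_) (by rw [hsum]; simp [hz₂])
    exact ⟨before_of_sublist hpw hsub₁ hαM (h₁.spanned.mem k) (hc₁ k hk).1,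
      before_of_sublist hpw hsub₁ (h₁.spanned.mem k) hβM (hc₁ k hk).2⟩
  by_cases hz₁ : ∀ k, c₁ k = 0
  · have h0 : P.root' α (D 5) + P.root' β (D 5) = 0 := by
      rw [hval]
      simp [hz₁, fun k => ((hk.negated₂ _ (hγ₂ k).1).1 (hγ₂ k).2).2]
    have hαM := hα4 (by linarith)
    have hβM := hβ4 (by linarith)
    have hγM : ∀ k, γ₂ k ∈ M₂.reverse := fun k => List.mem_reverse.2 (h₂.spanned.mem k)
    refine h₂.add_ne β (List.mem_reverse.1 hβM) α (List.mem_reverse.1 hαM) (c₂ ∘ Fin.rev)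
      (fun k hk => ?_) ?_
    · have := hc₂ (Fin.rev k) hk
      simp only [Function.comp_apply, Fin.rev_rev] at this
      exact ⟨before_reverse.1 (before_of_sublist hpw hsub₂ (hγM k) hβM this.2),
        before_reverse.1 (before_of_sublist hpw hsub₂ hαM (hγM k) this.1)⟩
    · rw [add_comm, hsum,
        ← Equiv.sum_comp Fin.revPerm (fun k => c₂ k • P.root ((γ₂ ∘ Fin.rev) k))]
      simp [hz₁]
  · push Not at hz₁ hz₂
    obtain ⟨k₁, hk₁⟩ := hz₁
    obtain ⟨k₂, hk₂⟩ := hz₂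
    have hαM : α ∈ M₁ := by
      refine hα3 (le_antisymm (not_lt.1 fun h => ?_) hα1)
      exact lt_asymm ((hc₁ k₁ hk₁).1.lt hpw)
        (hs.lt_of_pos _ (hγ₁ k₁).1 α hα0 (hγ₁ k₁).2 h)
    have hβM : β ∈ M₂.reverse := by
      refine hβ4 (le_antisymm hβ2 (not_lt.1 fun h => ?_))
      exact lt_asymm ((hc₂ k₂ hk₂).2.lt hpw)
        (hs.lt_of_neg β hβ0 _ (hγ₂ _).1 h (hγ₂ _).2)
    have hmem : P.root α - ∑ k, c₁ k • P.root (γ₁ k) ∈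
        rootSpanOf P γ₁ ⊓ rootSpanOf P (γ₂ ∘ Fin.rev) := by
      constructor
      · exact Submodule.sub_mem _ (hmem₁ α hαM) (Submodule.sum_mem _ fun k _ =>
          nsmul_mem (root_mem_rootSpanOf γ₁ k) _)
      · have : P.root α - ∑ k, c₁ k • P.root (γ₁ k) =
            ∑ k, c₂ k • P.root ((γ₂ ∘ Fin.rev) k) - P.root β := by
          rw [sub_eq_sub_iff_add_eq_add, hsum, add_comm]
        rw [this]
        exact Submodule.sub_mem _ (Submodule.sum_mem _ fun k _ =>
          nsmul_mem (root_mem_rootSpanOf (γ₂ ∘ Fin.rev) k) _) (hmem₂ β (List.mem_reverse.1 hβM))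
    rw [hdisj.eq_bot, Submodule.mem_bot, sub_eq_zero] at hmem
    refine h₁.ne_sum α hαM c₁ (fun k hk => ?_) hmem
    exact before_of_sublist hpw hsub₁ hαM (h₁.spanned.mem k) (hc₁ k hk).1

end IsSegmentation

end Properties

end WeylOrdering


open WeylOrdering in
theorem proposition2p2 {ι V N : Type*} [Fintype ι] [AddCommGroup V] [Module ℝ V]
    [AddCommGroup N] [Module ℝ N] (P : RootPairing ι ℝ V N) [P.IsRootSystem]
    [P.IsCrystallographic] [P.IsReduced] (s s₁ s₂ : P.weylGroup) {n m : ℕ}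
    (hdec : ∃ (η₁ : Fin n → ι) (η₂ : Fin m → ι), IsDecomposition P s s₁ s₂ η₁ η₂)
    (c : Choice P s s₁ s₂) :
    -- the decomposition is reduced
    length P c.pos s = length P c.pos s₂ + length P c.pos s₁ ∧
    inversions P c.pos s = inversions P c.pos s₂ ∪ (s₂ • ·) '' inversions P c.pos s₁ ∧
    Disjoint (inversions P c.pos s₂) ((s₂ • ·) '' inversions P c.pos s₁) ∧
    inversions P c.pos s⁻¹ = inversions P c.pos s₁ ∪ (s₁ • ·) '' inversions P c.pos s₂ ∧
    Disjoint (inversions P c.pos s₁) ((s₁ • ·) '' inversions P c.pos s₂) ∧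
    ∃ (γ₁ : Fin n → ι) (γ₂ : Fin m → ι),
      IsDecomposition P s s₁ s₂ γ₁ γ₂ ∧ (∀ k, γ₁ k ∈ c.pos) ∧ (∀ k, γ₂ k ∈ c.pos) ∧
      ∃ L A₁ B₁ M₁ C₁ R A₂ M₂ B₂ C₂ Z : List ι,
        -- the normal ordering and its form
        IsNormalOrdering P c.pos L ∧
        L = A₁ ++ B₁ ++ M₁ ++ C₁ ++ R ++ A₂ ++ M₂ ++ B₂ ++ C₂ ++ Z ∧
        (∀ α, α ∈ A₁ ++ B₁ ++ M₁ ++ C₁ ↔ α ∈ inversions P c.pos s₁) ∧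
        (∀ α, α ∈ B₁ ++ M₁ ↔ α ∈ c.pos ∧ s₁ • P.root α = -P.root α) ∧
        SpannedBy M₁ γ₁ ∧ 2 * B₁.length + n = (B₁ ++ M₁).length ∧
        (∀ α, α ∈ A₂ ++ M₂ ++ B₂ ++ C₂ ↔ α ∈ inversions P c.pos s₂) ∧
        (∀ α, α ∈ M₂ ++ B₂ ↔ α ∈ c.pos ∧ s₂ • P.root α = -P.root α) ∧
        SpannedBy M₂ γ₂ ∧ 2 * M₂.length = (M₂ ++ B₂).length + m ∧
        (∀ α, α ∈ Z ↔ α ∈ c.pos ∧ s • P.root α = P.root α) ∧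
        -- the segment from the first root of `γ₁` to the last root of `γ₂`
        ((M₁ ++ C₁ ++ R ++ A₂ ++ M₂).length : ℝ) =
          (c.pos.ncard : ℝ) - (((length P c.pos s : ℝ) - ((n + m : ℕ) : ℝ)) / 2 +
            ({α | α ∈ c.pos ∧ s • P.root α = P.root α}.ncard : ℝ)) ∧
        (∀ α ∈ M₁ ++ C₁ ++ R ++ A₂ ++ M₂, ∀ β ∈ M₁ ++ C₁ ++ R ++ A₂ ++ M₂, Before L α β →
          ¬ SumRepresentable P L γ₁ γ₂ α β) ∧
        -- the inversions of `s` form a segment that ends where those of `s₂` end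
        (Disjoint (inversions P c.pos s₁) ((s₂ • ·) '' inversions P c.pos s₁) →
          ∃ R₁ R₂ : List ι, R = R₁ ++ R₂ ∧
            ∀ α, α ∈ R₂ ++ A₂ ++ M₂ ++ B₂ ++ C₂ ↔ α ∈ inversions P c.pos s) ∧
        -- behaviour under `s`
        (∀ k, k ≠ 0 → ∀ α, α ∈ layer P c.h k → α ∈ c.pos →
          s • α ∈ layer P c.h k → s • α ∈ c.pos →
          Before L α (s • α) ∧
          ∀ j, j < k → ∀ β ∈ layer P c.h j, ∀ δ ∈ layer P c.h j, ∀ μ ν : ι,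
            P.root μ = P.root (s • α) + P.root β → P.root ν = P.root α + P.root δ →
            μ ∈ c.pos ∧ ν ∈ c.pos ∧ Before L ν μ) ∧
        (∀ α ∈ c.pos, s • P.root α ≠ P.root α → s • α ∈ c.pos →
          Before L α (s • α) ∧
          ∀ α₀, s • P.root α₀ = P.root α₀ → ∀ μ : ι,
            P.root μ = P.root (s • α) + P.root α₀ → Before L α μ) := by
  obtain ⟨η₁, η₂, hd⟩ := hdec
  have hg := c.height_ne_zero
  obtain ⟨key, H, D, hk⟩ := exists_isKeyData c hd
  obtain ⟨γ₁, ho₁, hγ₁, hspan₁, B₁, M₁, hM₁⟩ := exists_isOrthogonalOrdering hg η₁ hd.orthogonal₁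
  obtain ⟨γ₂, ho₂, hγ₂, hspan₂, B₂, M₂, hM₂⟩ := exists_isOrthogonalOrdering hg η₂ hd.orthogonal₂
  have hset₁ : {α | α ∈ posOf P c.height ∧ P.root α ∈ rootSpanOf P η₁} =
      {α | α ∈ c.pos ∧ s₁ • P.root α = -P.root α} := by
    ext α
    simp only [Set.mem_ofPred_eq, hd.smul_eq_neg_iff₁, c.pos_eq]
  have hset₂ : {α | α ∈ posOf P c.height ∧ P.root α ∈ rootSpanOf P η₂} =
      {α | α ∈ c.pos ∧ s₂ • P.root α = -P.root α} := by
    ext α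
    simp only [Set.mem_ofPred_eq, hd.smul_eq_neg_iff₂, c.pos_eq]
  rw [hset₁] at hM₁
  rw [hset₂] at hM₂
  have hrev : rootSpanOf P (γ₂ ∘ Fin.rev) = rootSpanOf P η₂ := by
    rw [← hspan₂, rootSpanOf, rootSpanOf, ← Function.comp_assoc,
      Fin.rev_surjective.range_comp]
  have hdγ : IsDecomposition P s s₁ s₂ γ₁ (γ₂ ∘ Fin.rev) :=
    hd.of_rootSpanOf_eq ho₁ (fun j k hjk => ho₂ (Fin.rev_injective.ne hjk)) hspan₁ hrev
  obtain ⟨κ, A₁, C₁, R₁, R₂, A₂, C₂, Z, hs⟩ :=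
    hk.exists_isSegmentation hM₁.normal (L₂ := M₂.reverse ++ B₂.reverse)
      (by rw [← List.reverse_append]; exact hM₂.normal.reverse)
  have hdisj := hk.disjoint_inversions
  have hbefore : ∀ {α β}, α ∈ c.pos → β ∈ c.pos → key α < key β →
      Before (A₁ ++ (B₁ ++ M₁ ++ (C₁ ++ (R₁ ++ (R₂ ++ (A₂ ++
        (M₂.reverse ++ B₂.reverse ++ (C₂ ++ Z)))))))) α β := fun hα hβ h =>
    before_of_lt hs.sorted.pairwise ((hs.sorted.mem_iff _).2 hα) ((hs.sorted.mem_iff _).2 hβ)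
      (hs.lt_of_key_lt _ _ h)
  refine ⟨?_, ?_, disjoint_inversions_image (g := c.height) hd.mul_self₂, ?_,
    disjoint_inversions_image (g := c.height) hd.mul_self₁,
    γ₁, γ₂ ∘ Fin.rev, hdγ, hγ₁, fun k => hγ₂ _, _, A₁, B₁, M₁, C₁, R₁ ++ R₂, A₂, M₂.reverse,
    B₂.reverse, C₂, Z, isNormalOrdering_of_isConvexOrder hs.convex hs.sorted.mem_iff
      hs.sorted.pairwise, by simp only [List.append_assoc], ?_, hs.mem_L₁, hM₁.spanned,
    hM₁.length_eq, ?_, hs.mem_L₂, hM₂.spanned.reverse, ?_, hs.mem_Z_iff hk, ?_, ?_, ?_, ?_, ?_⟩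
  · exact (congrArg (length P c.pos) hd.eq_mul).trans (length_mul hg hd.mul_self₂ hdisj)
  · exact (congrArg (inversions P c.pos) hd.eq_mul).trans (inversions_mul hg hd.mul_self₂ hdisj)
  · rw [hd.inv]
    exact inversions_mul hg hd.mul_self₁ hdisj.symm
  · intro α
    rw [← hs.mem_inversions₁ hk]
    simp only [List.append_assoc]
  · intro α
    rw [← hs.mem_inversions₂ hk]
    simp only [List.append_assoc]
  · have := hM₂.length_eq
    simp only [List.length_append, List.length_reverse] at this ⊢
    omega
  · have h1 := hs.length_eq hk hd
    have h2 := hs.sorted.length_eq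
    have h3 := length_eq_ncard ((nodup_of_pairwise_lt hs.sorted.pairwise).sublist ?_)
      (S := {α | α ∈ c.pos ∧ s • P.root α = P.root α}) (hs.mem_Z_iff hk)
    · have h4 := hM₁.length_eq
      have h5 := hM₂.length_eq
      have h6 := hs.length_A₁ hk hd.mul_self₁
      have h7 := hs.length_A₂ hk hd.mul_self₂
      rw [h1, ← h2, ← h3]
      simp only [List.length_append, List.length_reverse] at h4 h5 ⊢
      rw [h6, ← h7]
      have h4' : (2 * B₁.length + n : ℝ) = B₁.length + M₁.length := by exact_mod_cast h4
      have h5' : (2 * B₂.length + m : ℝ) = B₂.length + M₂.length := by exact_mod_cast h5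
      push_cast
      linear_combination -(1 / 2 : ℝ) * h4' - (1 / 2 : ℝ) * h5'
    · iterate 8 refine List.Sublist.trans ?_ (List.sublist_append_right _ _)
      exact List.Sublist.refl _
  · intro α hα β hβ _
    refine hs.not_sumRepresentable hk rfl rfl rfl hM₁ hM₂ hdγ.disjoint_rootSpanOf ?_ ?_ hα hβ
    · intro α hα
      rw [hspan₁, ← hd.smul_eq_neg_iff₁]
      exact ((hs.mem_L₁ α).1 (List.mem_append_right _ hα)).2
    · intro α hα
      rw [hrev, ← hd.smul_eq_neg_iff₂]
      exact ((hs.mem_L₂ α).1 (List.mem_append_left _ (List.mem_reverse.2 hα))).2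
  · intro h
    refine ⟨R₁, R₂, rfl, fun α => ?_⟩
    rw [← hs.mem_inversions hk h]
    simp only [List.append_assoc]
  · intro k hk0 α hα hpos hsα hsα'
    have hne : s • P.root α ≠ P.root α := fun h =>
      hk0 (c.layer_unique hα ((hk.mem_layer_zero α hpos).1 h))
    have hlt := hk.lt_smul α hpos hne hsα'
    refine ⟨hbefore hpos hsα' hlt, fun j hj β hβ δ hδ μ ν hμ hν => ?_⟩
    obtain ⟨h1, h2⟩ := hk.add_lower_mem_pos hsα hsα' hj hβ hμ
    obtain ⟨h3, h4⟩ := hk.add_lower_mem_pos hα hpos hj hδ hν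
    exact ⟨h1, h3, hbefore h3 h1 (by rwa [h2, h4])⟩
  · intro α hpos hne hsα
    have hlt := hk.lt_smul α hpos hne hsα
    refine ⟨hbefore hpos hsα hlt, fun α₀ h₀ μ hμ => ?_⟩
    obtain ⟨k, hα⟩ := c.exists_layer α
    have hk0 : 0 < k := Fin.pos_of_ne_zero fun h =>
      hne ((hk.mem_layer_zero α hpos).2 (h ▸ hα))
    obtain ⟨h1, h2⟩ := hk.add_lower_mem_pos (Choice.smul_mem_layer_self hd hα) hsα hk0
      (hk.mem_layer_zero_of_smul_eq h₀) hμ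
    exact hbefore hpos h1 (by rwa [h2])
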